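/- Let $\Gamma$ be a finite quiver with vertex set $I$, let $\theta:I\to\mathbb Z$ be a map (stability), extended linearly to $\mathbb Z^I$, and put $\mu(\alpha)=\theta(\alpha)/\sum_{i}\alpha^i$ for $\alpha\in\mathbb N^I\setminus\{0\}$ and $\mu(M)=\mu(\dim M)$ for a nonzero representation $M$. A representation $M$ over a field $k$ is semistable if $\mu(N)\le\mu(M)$ for all nonzero proper subrepresentations $N\subset M$ (the zero representation is semistable); it is stable if $M\ne0$ and $\mu(N)<\mu(M)$ for all such $N$; it is absolutely stable if it is stable and stays stable after every finite field extension of $k$. For $\alpha\in\mathbb N^I$ let $R_\alpha(k)=\bigoplus_{h:i\to j}\operatorname{Hom}_k(k^{\alpha^i},k^{\alpha^j})$, let $R_\alpha^{ss}(k)\subset R_\alpha(k)$ be the subset of semistable representations, and let $\mathrm{GL}_\alpha(k)=\prod_{i}\mathrm{GL}_{\alpha^i}(k)$. For every $\alpha\in\mathbb N^I$ there are a unique polynomial $a_\alpha\in\mathbb Z[q]$ and a unique rational function $r_\alpha\in\mathbb Q(q)$ such that, for every finite field $k$, the number of isomorphism classes of absolutely stable representations of $\Gamma$ over $k$ of dimension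 vector $\alpha$ is $a_\alpha(\#k)$, and $r_\alpha$ has no pole at $\#k$ and $r_\alpha(\#k)=\#R_\alpha^{ss}(k)/\#\mathrm{GL}_\alpha(k)$. Fix $m\in\mathbb Q$ and put $$a(q)=\sum_{\alpha}a_\alpha(q)x^\alpha,\qquad r(q)=\sum_{\alpha}r_\alpha(q)x^\alpha\qquad\text{in }\mathbb Q(q)[[x_i\mid i\in I]],$$ where both sums run over $\alpha=0$ (for which $a_0=0$, $r_0=1$) and all $\alpha\in\mathbb N^I\setminus\{0\}$ with $\mu(\alpha)=m$. For a power series $f$ without constant term let $$\operatorname{Exp}(f)=\exp\Bigl(\sum_{n\ge1}\tfrac1n\psi_n(f)\Bigr),\qquad \psi_n(f)(q,(x_i)_i)=f(q^n,(x_i^n)_i).$$ Let $\langle\alpha,\beta\rangle=\sum_{i}\alpha^i\beta^i-\sum_{h:i\to j}\alpha^i\beta^j$, and let $\mathbb Q(q)^{\rm tw}[[x_i\mid i\in I]]$ be the algebra of power series with the continuous $\mathbb Q(q)$-bilinear product $x^\alpha\circ x^\beta=q^{-\langle\alpha,\beta\rangle}x^{\alpha+\beta}$. Then $$r(q)\circ\operatorname{Exp}\left(\frac{a(q)}{1-q}\right)=1\qquad\text{in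 }\mathbb Q(q)^{\rm tw}[[x_i\mid i\in I]].$$ -/

import Mathlib

open Polynomial

namespace QuiverCount

noncomputable section

universe u v w

/-! ### Quiver representations over a field -/

section Representations

variable {I : Type u} [Quiver.{v} I]

/-- `R_α(k)`, the space of representations of the quiver over `k` of dimension vector `α`: an arrow
`h : i ⟶ j` acts as a linear map `k ^ (α i) → k ^ (α j)`, given by its matrix. -/
def Rep (k : Type w) (α : I → ℕ) : Type (max u v w) :=
  ∀ ⦃i j : I⦄, (i ⟶ j) → Matrix (Fin (α j)) (Fin (α i)) k

/-- The group `GL_α(k)`, the product of the groups `GL_{α i}(k)`. -/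
abbrev GLDim (k : Type w) [Field k] (α : I → ℕ) : Type (max u w) :=
  ∀ i : I, GL (Fin (α i)) k

/-- The base change action `(g • x)_h = g_j x_h g_i⁻¹` for `h : i ⟶ j`. Its orbits are the
isomorphism classes of representations of dimension vector `α`. -/
instance (k : Type w) [Field k] (α : I → ℕ) : MulAction (GLDim k α) (Rep k α) where
  smul g x := fun i j h => (g j).val * x h * ((g i)⁻¹).val
  one_smul x := by
    funext i j h
    change (1 : GL (Fin (α j)) k).val * x h * ((1 : GL (Fin (α i)) k)⁻¹).val = x h
    simp
  mul_smul g g' x := by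
    funext i j h
    change (g j * g' j).val * x h * ((g i * g' i)⁻¹).val =
      (g j).val * ((g' j).val * x h * ((g' i)⁻¹).val) * ((g i)⁻¹).val
    rw [mul_inv_rev, Units.val_mul, Units.val_mul]
    simp only [Matrix.mul_assoc]

/-- Extension of scalars of a representation. -/
def Rep.baseChange {k : Type w} [Field k] {α : I → ℕ} (x : Rep k α)
    (K : Type w) [Field K] [Algebra k K] : Rep K α :=
  fun _ _ h => (x h).map (algebraMap k K)

/-- A subrepresentation: a family of subspaces preserved by all arrows. -/
structure Subrep {k : Type w} [Field k] {α : I → ℕ} (x : Rep k α) where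
  space : ∀ i : I, Submodule k (Fin (α i) → k)
  map_mem : ∀ ⦃i j : I⦄ (h : i ⟶ j), ∀ v ∈ space i, (x h).mulVec v ∈ space j

/-- The dimension vector of a subrepresentation. -/
def Subrep.dim {k : Type w} [Field k] {α : I → ℕ} {x : Rep k α} (N : Subrep x) : I → ℕ :=
  fun i => Module.finrank k (N.space i)

/-- The slope `θ(α) / ∑ α i` (only meaningful for `α ≠ 0`). -/
def slope [Fintype I] (θ : I → ℤ) (α : I → ℕ) : ℚ :=
  ((∑ i, θ i * (α i : ℤ) : ℤ) : ℚ) / ((∑ i, α i : ℕ) : ℚ)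

/-- Semistability. The zero representation counts as semistable. -/
def IsSemistable [Fintype I] (θ : I → ℤ) {k : Type w} [Field k] {α : I → ℕ} (x : Rep k α) : Prop :=
  ∀ N : Subrep x, (∃ i, N.space i ≠ ⊥) → (∃ i, N.space i ≠ ⊤) → slope θ N.dim ≤ slope θ α

/-- Stability. The zero representation is not stable. -/
def IsStable [Fintype I] (θ : I → ℤ) {k : Type w} [Field k] {α : I → ℕ} (x : Rep k α) : Prop :=
  α ≠ 0 ∧
    ∀ N : Subrep x, (∃ i, N.space i ≠ ⊥) → (∃ i, N.space i ≠ ⊤) → slope θ N.dim < slope θ α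

/-- Absolute stability: stable, and still stable after every finite field extension. -/
def IsAbsolutelyStable [Fintype I] (θ : I → ℤ) {k : Type w} [Field k] {α : I → ℕ}
    (x : Rep k α) : Prop :=
  IsStable θ x ∧ ∀ (K : Type w) [Field K] [Algebra k K] [FiniteDimensional k K],
    IsStable θ (x.baseChange K)

/-- The number of isomorphism classes of absolutely stable representations over `k` of dimension
vector `α`. -/
def numAbsolutelyStable [Fintype I] (θ : I → ℤ) (k : Type w) [Field k] (α : I → ℕ) : ℕ :=
  Set.ncard ((fun x : Rep k α => (Quotient.mk (MulAction.orbitRel (GLDim k α) (Rep k α)) x)) ''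
    {x : Rep k α | IsAbsolutelyStable θ x})

/-- `#R_α^ss(k)`, the number of semistable points of `R_α(k)`. -/
def numSemistable [Fintype I] (θ : I → ℤ) (k : Type w) [Field k] (α : I → ℕ) : ℕ :=
  Set.ncard {x : Rep k α | IsSemistable θ x}

end Representations

/-! ### Counting functions -/

section Counting

variable {I : Type u} [Quiver.{v} I] [Fintype I]

/-- `a` is the family of integral polynomials `a_α` whose value at `#k` is, for every finite
field `k`, the number of isomorphism classes of absolutely stable representations of dimension
vector `α` over `k`. -/
def CountsAbsolutelyStable (θ : I → ℤ) (a : (I →₀ ℕ) → ℤ[X]) : Prop :=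
  ∀ (α : I →₀ ℕ) (k : Type) [Field k] [Finite k],
    (a α).eval (Nat.card k : ℤ) = (numAbsolutelyStable θ k α : ℤ)

/-- `r` is the family of rational functions `r_α` over `ℚ` which, for every finite field `k`, have
no pole at `#k` and take there the value `#R_α^ss(k) / #GL_α(k)`. -/
def CountsSemistable (θ : I → ℤ) (r : (I →₀ ℕ) → RatFunc ℚ) : Prop :=
  ∀ (α : I →₀ ℕ) (k : Type) [Field k] [Finite k],
    (r α).denom.eval (Nat.card k : ℚ) ≠ 0 ∧
    (r α).eval (RingHom.id ℚ) (Nat.card k : ℚ) =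
      (numSemistable θ k α : ℚ) / (Nat.card (GLDim k α) : ℚ)

end Counting

/-! ### Power series over `ℚ(q)` -/

section Series

variable {I : Type u} [Fintype I] [DecidableEq I]

/-- The generating function `∑ c_α x^α` over the dimension vectors `α` of slope `m`; the zero
vector is included. -/
def slopeSeries (θ : I → ℤ) (m : ℚ) (c : (I →₀ ℕ) → RatFunc ℚ) : MvPowerSeries I (RatFunc ℚ) :=
  fun α => if α = 0 ∨ slope θ α = m then c α else 0

/-- The Adams operation `f(q, x) ↦ f(q ^ n, x ^ n)` on `ℚ(q)[[x_i]]`, for `n ≥ 1`. -/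
def adams (n : ℕ) (f : MvPowerSeries I (RatFunc ℚ)) : MvPowerSeries I (RatFunc ℚ) :=
  fun γ => if ∀ i, n ∣ γ i then
      (MvPowerSeries.coeff (γ.mapRange (· / n) (Nat.zero_div n)) f).eval
        (algebraMap ℚ (RatFunc ℚ)) (RatFunc.X ^ n)
    else 0

/-- The series `∑_{n ≥ 1} ψ_n(f) / n` for `f` without constant term. The coefficient of `x^γ` in
`ψ_n(f)` vanishes for `n` larger than the total degree of `γ`, so the sum is finite in each
degree. -/
def adamsSum (f : MvPowerSeries I (RatFunc ℚ)) : MvPowerSeries I (RatFunc ℚ) :=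
  fun γ => ∑ n ∈ Finset.Icc 1 (∑ i, γ i),
    (1 / (n : RatFunc ℚ)) * MvPowerSeries.coeff γ (adams n f)

/-- The plethystic exponential `Exp(f) = exp(∑_{n ≥ 1} ψ_n(f) / n)` for `f` without constant
term. -/
def plethysticExp (f : MvPowerSeries I (RatFunc ℚ)) : MvPowerSeries I (RatFunc ℚ) :=
  (PowerSeries.exp (RatFunc ℚ)).subst (adamsSum f)

/-- The Ringel form `⟨α, β⟩ = ∑_i α_i β_i - ∑_{h : i → j} α_i β_j`. -/
def ringelForm [Quiver.{v} I] [∀ i j : I, Fintype (i ⟶ j)] (α β : I → ℤ) : ℤ :=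
  ∑ i, α i * β i - ∑ i, ∑ j, ∑ _h : i ⟶ j, α i * β j

/-- The product `f ∘ g` of the twisted algebra of power series: the continuous bilinear product
with `x^α ∘ x^β = q ^ (-⟨α, β⟩) x^(α + β)`. -/
def twMul [Quiver.{v} I] [∀ i j : I, Fintype (i ⟶ j)] (f g : MvPowerSeries I (RatFunc ℚ)) :
    MvPowerSeries I (RatFunc ℚ) :=
  fun γ => ∑ p ∈ Finset.HasAntidiagonal.antidiagonal γ,
    RatFunc.X ^ (-ringelForm (fun i => (p.1 i : ℤ)) (fun i => (p.2 i : ℤ))) *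
      (MvPowerSeries.coeff p.1 f * MvPowerSeries.coeff p.2 g)

end Series

end

end QuiverCount

/-! Fix a finite field k with q elements. Semistable representations of slope m form a finite length
category whose simple objects are the stable ones S_j; put Q_j = #End S_j. For semistable L, the
number of embeddings of ⊕ S_j^{n_j} into L is ∏_j ∏_{i<n_j} (H_j - Q_j^i), where H_j = #Hom(S_j, L)
is a power of Q_j (`numInj_listSum`). Weight this by ∏_j ∏_{1≤i≤n_j} (1 - Q_j^i)⁻¹ and sum over n.
The sum is a product over j, and by a finite q-binomial identity (`sum_qExpCoeff_mul_prod`) the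
factor of j is zero as soon as H_j > 1. A nonzero L contains a stable subrepresentation, so the sum
vanishes. On the other hand, pairs of a point of R_α and an embedding of a fixed M with semistable
cokernel are counted, relative to GL_α, by q^{-⟨β, dim M⟩} r_β with β = α - dim M
(`card_embeddings`). Summing over L shows that r is inverted in the twisted algebra by ∏_j ∑_n x^{n
dim S_j} / ∏_{1≤i≤n} (1 - Q_j^i) (`twisted_inverse`).

This product of quantum exponentials is the exponential of ∑_j ∑_l x^{l dim S_j} / (l (1 - Q_j^l)).
The endomorphism field F_j of S_j has some degree d_j over k, and S_j is an absolutely stable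
representation over F_j of some dimension vector B_j, regarded over k; so dim S_j = d_j B_j and Q_j
= q^{d_j}. Over the extension K of degree n, the absolutely stable representations are obtained from
these along the k-embeddings F_j → K, so those of dimension vector b number ∑ d_j over the j with
B_j = b and d_j ∣ n (`exists_descent_data`). Substituting n = d_j l turns the exponent into the
value at q of ∑_n ψ_n(a/(1-q))/n (`numeric_identity`). Rational functions that agree at all primes
are equal, which gives the theorem.

The r_α exist by the Harder-Narasimhan recursion: R_α is stratified by the dimension vector of the
maximal destabilizing subrepresentation (`isCount_numSS_and_numLT`). The a_α exist by induction on
the degree of α (`exists_polynomial`). The inverse of r has rational coefficients. The plethystic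
exponential of the terms of lower degree has coefficients with integral numerators and monic
denominators (`integralExp`). The two differ at α by a_α/(1-q). So a_α is a rational function with
monic denominator and integral values at the primes, hence an integral polynomial
(`exists_ofInt_of_integral_values`). -/

namespace QuiverCount

noncomputable section

universe u v

/-! ### Exponentials of power series through the Euler derivation -/

section Exponential

variable {σ : Type*} {R : Type*} [CommRing R]

/-- The Euler derivation, which multiplies the coefficient of `x ^ γ` by the total degree of `γ`. -/
def euler (f : MvPowerSeries σ R) : MvPowerSeries σ R :=
  fun γ => (γ.degree : R) * MvPowerSeries.coeff γ f

lemma coeff_euler (f : MvPowerSeries σ R) (γ : σ →₀ ℕ) :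
    MvPowerSeries.coeff γ (euler f) = (γ.degree : R) * MvPowerSeries.coeff γ f := rfl

lemma euler_add (f g : MvPowerSeries σ R) : euler (f + g) = euler f + euler g := by
  ext γ; simp only [coeff_euler, map_add, mul_add]

lemma euler_zero : euler (0 : MvPowerSeries σ R) = 0 := by
  ext γ; simp [coeff_euler]

lemma euler_neg (f : MvPowerSeries σ R) : euler (-f) = -euler f := by
  ext γ; simp [coeff_euler]

lemma euler_smul (c : R) (f : MvPowerSeries σ R) : euler (c • f) = c • euler f := by
  ext γ; simp [coeff_euler]; ring

lemma euler_one : euler (1 : MvPowerSeries σ R) = 0 := by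
  classical
  ext γ
  rw [coeff_euler, MvPowerSeries.coeff_one]
  split_ifs with h <;> simp [h]

lemma euler_mul [DecidableEq σ] (f g : MvPowerSeries σ R) :
    euler (f * g) = euler f * g + f * euler g := by
  ext γ
  rw [coeff_euler, map_add, MvPowerSeries.coeff_mul, MvPowerSeries.coeff_mul,
    MvPowerSeries.coeff_mul, Finset.mul_sum, ← Finset.sum_add_distrib]
  refine Finset.sum_congr rfl fun p hp => ?_
  rw [Finset.HasAntidiagonal.mem_antidiagonal] at hp
  rw [coeff_euler, coeff_euler, ← hp, map_add]
  push_cast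
  ring

lemma euler_pow_succ [DecidableEq σ] (f : MvPowerSeries σ R) (n : ℕ) :
    euler (f ^ (n + 1)) = ((n : R) + 1) • (euler f * f ^ n) := by
  induction n with
  | zero => simp
  | succ n ih =>
    rw [pow_succ, euler_mul, ih, smul_mul_assoc]
    push_cast
    rw [add_smul ((n : R) + 1), one_smul, pow_succ f n, mul_assoc, mul_comm (f ^ n * f)]

/-- `E` is the exponential of `f`: its constant coefficient is `1` and it solves the logarithmic
differential equation. -/
def IsExp (f E : MvPowerSeries σ R) : Prop :=
  MvPowerSeries.coeff 0 E = 1 ∧ euler E = euler f * E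

lemma IsExp.coeff_eq [DecidableEq σ] {f E : MvPowerSeries σ R} (h : IsExp f E) (γ : σ →₀ ℕ) :
    (γ.degree : R) * MvPowerSeries.coeff γ E =
      ∑ p ∈ Finset.HasAntidiagonal.antidiagonal γ,
        (p.1.degree : R) * MvPowerSeries.coeff p.1 f * MvPowerSeries.coeff p.2 E := by
  rw [← coeff_euler, h.2, MvPowerSeries.coeff_mul]
  rfl

lemma isExp_zero : IsExp (0 : MvPowerSeries σ R) 1 := by
  classical
  refine ⟨by simp, ?_⟩
  rw [euler_one, euler_zero, zero_mul]

lemma IsExp.add {f g E F : MvPowerSeries σ R} (h : IsExp f E) (h' : IsExp g F) :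
    IsExp (f + g) (E * F) := by
  classical
  refine ⟨?_, ?_⟩
  · have h1 := h.1
    have h2 := h'.1
    rw [MvPowerSeries.coeff_zero_eq_constantCoeff_apply] at h1 h2 ⊢
    rw [map_mul, h1, h2, one_mul]
  · rw [euler_mul, euler_add, h.2, h'.2]
    ring

lemma isExp_sum {ι : Type*} (s : Finset ι) {f E : ι → MvPowerSeries σ R}
    (h : ∀ i ∈ s, IsExp (f i) (E i)) : IsExp (∑ i ∈ s, f i) (∏ i ∈ s, E i) := by
  classical
  induction s using Finset.induction_on with
  | empty => simpa using isExp_zero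
  | insert a s ha ih =>
    rw [Finset.sum_insert ha, Finset.prod_insert ha]
    exact (h a (Finset.mem_insert_self a s)).add
      (ih fun i hi => h i (Finset.mem_insert_of_mem hi))

/-- The inverse series is part of the data, so that integrality of its coefficients can be
established separately. -/
lemma IsExp.neg {f E F : MvPowerSeries σ R} (h : IsExp f E) (hEF : E * F = 1) : IsExp (-f) F := by
  classical
  refine ⟨?_, ?_⟩
  · have h1 := congrArg MvPowerSeries.constantCoeff hEF
    have h2 := h.1
    rw [MvPowerSeries.coeff_zero_eq_constantCoeff_apply] at h2 ⊢
    rwa [map_mul, h2, one_mul, map_one] at h1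
  · have h1 := congrArg euler hEF
    rw [euler_mul, euler_one, h.2] at h1
    rw [euler_neg]
    calc euler F = (E * F) * euler F := by rw [hEF, one_mul]
      _ = F * (euler f * E * F + E * euler F) - F * euler f * (E * F) := by ring
      _ = -euler f * F := by rw [h1, hEF]; ring

lemma degree_lt_of_mem_antidiagonal [DecidableEq σ] {γ : σ →₀ ℕ} {p : (σ →₀ ℕ) × (σ →₀ ℕ)}
    (hp : p ∈ Finset.HasAntidiagonal.antidiagonal γ) (h : p.1 ≠ 0) : p.2.degree < γ.degree := by
  rw [Finset.HasAntidiagonal.mem_antidiagonal] at hp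
  have h0 : p.1.degree ≠ 0 := fun h0 => h ((Finsupp.degree_eq_zero_iff _).1 h0)
  rw [← hp, map_add]
  omega

lemma degree_fst_le_of_mem_antidiagonal [DecidableEq σ] {γ : σ →₀ ℕ} {p : (σ →₀ ℕ) × (σ →₀ ℕ)}
    (hp : p ∈ Finset.HasAntidiagonal.antidiagonal γ) : p.1.degree ≤ γ.degree := by
  rw [Finset.HasAntidiagonal.mem_antidiagonal] at hp
  rw [← hp, map_add]
  omega

lemma degree_fst_lt_of_mem_antidiagonal [DecidableEq σ] {γ : σ →₀ ℕ} {p : (σ →₀ ℕ) × (σ →₀ ℕ)}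
    (hp : p ∈ Finset.HasAntidiagonal.antidiagonal γ) (h : p.2 ≠ 0) : p.1.degree < γ.degree := by
  rw [Finset.HasAntidiagonal.mem_antidiagonal] at hp
  have h0 : p.2.degree ≠ 0 := fun h0 => h ((Finsupp.degree_eq_zero_iff _).1 h0)
  rw [← hp, map_add]
  omega

/-- The exponential in degrees `≤ N` depends only on the exponent in degrees `≤ N`. -/
lemma IsExp.coeff_congr [CharZero R] [IsDomain R] {f g E F : MvPowerSeries σ R}
    (h : IsExp f E) (h' : IsExp g F) {N : ℕ}
    (hfg : ∀ γ : σ →₀ ℕ, γ.degree ≤ N → MvPowerSeries.coeff γ f = MvPowerSeries.coeff γ g)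
    (γ : σ →₀ ℕ) (hγ : γ.degree ≤ N) : MvPowerSeries.coeff γ E = MvPowerSeries.coeff γ F := by
  classical
  induction hn : γ.degree using Nat.strong_induction_on generalizing γ with
  | _ n ih =>
    by_cases h0 : γ = 0
    · rw [h0, h.1, h'.1]
    have hd : (γ.degree : R) ≠ 0 := by
      rw [Nat.cast_ne_zero]
      exact fun h1 => h0 ((Finsupp.degree_eq_zero_iff _).1 h1)
    refine mul_left_cancel₀ hd ?_
    rw [h.coeff_eq, h'.coeff_eq]
    refine Finset.sum_congr rfl fun p hp => ?_
    by_cases hp1 : p.1 = 0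
    · simp [hp1]
    have hlt := degree_lt_of_mem_antidiagonal hp hp1
    have hle := degree_fst_le_of_mem_antidiagonal hp
    rw [hfg p.1 (by omega), ih p.2.degree (by omega) p.2 (by omega) rfl]

/-- If two exponents agree in degrees below that of `γ`, then the exponentials differ at `γ` by
the difference of the exponents. -/
lemma IsExp.coeff_sub [CharZero R] [IsDomain R] {f g E F : MvPowerSeries σ R}
    (h : IsExp f E) (h' : IsExp g F) (γ : σ →₀ ℕ) (hγ : γ ≠ 0)
    (hfg : ∀ β : σ →₀ ℕ, β.degree < γ.degree →
      MvPowerSeries.coeff β f = MvPowerSeries.coeff β g) :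
    MvPowerSeries.coeff γ E - MvPowerSeries.coeff γ F =
      MvPowerSeries.coeff γ f - MvPowerSeries.coeff γ g := by
  classical
  have hd : γ.degree ≠ 0 := fun h1 => hγ ((Finsupp.degree_eq_zero_iff _).1 h1)
  have hd' : (γ.degree : R) ≠ 0 := Nat.cast_ne_zero.2 hd
  have key : ∀ β : σ →₀ ℕ, β.degree < γ.degree →
      MvPowerSeries.coeff β E = MvPowerSeries.coeff β F := fun β hβ =>
    h.coeff_congr h' (N := γ.degree - 1) (fun δ hδ => hfg δ (by omega)) β (by omega)
  refine mul_left_cancel₀ hd' ?_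
  -- In the two convolutions all terms but that at (γ, 0) agree, and this one is the degree of γ
  -- times the coefficient of the exponent.
  rw [mul_sub, h.coeff_eq, h'.coeff_eq, ← Finset.sum_sub_distrib,
    Finset.sum_eq_single (γ, (0 : σ →₀ ℕ))]
  · simp only [h.1, h'.1]; ring
  · intro p hp hne
    by_cases hp1 : p.1 = 0
    · simp [hp1]
    rw [key p.2 (degree_lt_of_mem_antidiagonal hp hp1)]
    by_cases hp2 : p.2 = 0
    · refine absurd (Prod.ext ?_ hp2) hne
      have := Finset.HasAntidiagonal.mem_antidiagonal.1 hp
      rwa [hp2, add_zero] at this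
    · rw [hfg p.1 (degree_fst_lt_of_mem_antidiagonal hp hp2), sub_self]
  · intro h1
    exact absurd (Finset.HasAntidiagonal.mem_antidiagonal.2 (add_zero γ)) h1

lemma coeff_pow_eq_zero {f : MvPowerSeries σ R} (hf : MvPowerSeries.coeff 0 f = 0) (n : ℕ)
    (γ : σ →₀ ℕ) (h : γ.degree < n) : MvPowerSeries.coeff γ (f ^ n) = 0 := by
  classical
  induction n generalizing γ with
  | zero => omega
  | succ n ih =>
    rw [pow_succ', MvPowerSeries.coeff_mul]
    refine Finset.sum_eq_zero fun p hp => ?_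
    by_cases hp1 : p.1 = 0
    · rw [hp1, hf, zero_mul]
    · rw [ih p.2 (by have := degree_lt_of_mem_antidiagonal hp hp1; omega), mul_zero]

/-- The power f ^ n has no terms of degree below n, so the exponential may be truncated in each
degree. -/
lemma coeff_exp_subst [Algebra ℚ R] {f : MvPowerSeries σ R}
    (hf : MvPowerSeries.coeff 0 f = 0) (γ : σ →₀ ℕ) (M : ℕ) (hM : γ.degree < M) :
    MvPowerSeries.coeff γ ((PowerSeries.exp R).subst f) =
      MvPowerSeries.coeff γ
        (∑ n ∈ Finset.range M, algebraMap ℚ R (1 / (n.factorial : ℚ)) • f ^ n) := by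
  have hs : PowerSeries.HasSubst f := PowerSeries.HasSubst.of_constantCoeff_zero hf
  rw [PowerSeries.coeff_subst hs, finsum_eq_sum_of_support_subset (s := Finset.range M), map_sum]
  · exact Finset.sum_congr rfl fun n _ => by rw [PowerSeries.coeff_exp, map_smul]
  · intro n hn
    rw [Finset.coe_range, Set.mem_Iio]
    by_contra hlt
    exact hn (by simp only [coeff_pow_eq_zero hf n γ (by omega), smul_zero])

lemma isExp_exp_subst [Algebra ℚ R] {f : MvPowerSeries σ R}
    (hf : MvPowerSeries.coeff 0 f = 0) : IsExp f ((PowerSeries.exp R).subst f) := by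
  classical
  refine ⟨?_, ?_⟩
  · rw [coeff_exp_subst hf 0 1 (by simp)]
    simp
  · ext γ
    -- Differentiation shortens the truncated exponential by one term; hence the two truncation
    -- bounds `γ.degree + 2` and `γ.degree + 1` below.
    have hsum : ∀ M : ℕ,
        euler (∑ n ∈ Finset.range (M + 1), algebraMap ℚ R (1 / (n.factorial : ℚ)) • f ^ n) =
          euler f * ∑ n ∈ Finset.range M, algebraMap ℚ R (1 / (n.factorial : ℚ)) • f ^ n := by
      intro M
      induction M with
      | zero => simp [euler_one]
      | succ M ih =>
        rw [Finset.sum_range_succ, euler_add, ih, Finset.sum_range_succ _ M, mul_add, euler_smul,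
          euler_pow_succ, smul_smul, mul_smul_comm]
        congr 2
        have h1 : ((M : R) + 1) = algebraMap ℚ R ((M : ℚ) + 1) := by simp
        rw [h1, ← map_mul]
        congr 1
        rw [Nat.factorial_succ]
        have : ((M : ℚ) + 1) ≠ 0 := by positivity
        push_cast
        field_simp
    rw [coeff_euler, coeff_exp_subst hf γ (γ.degree + 2) (by omega), ← coeff_euler, hsum,
      MvPowerSeries.coeff_mul, MvPowerSeries.coeff_mul]
    refine Finset.sum_congr rfl fun p hp => ?_
    rw [coeff_exp_subst hf p.2 (γ.degree + 1)]
    rw [Finset.HasAntidiagonal.mem_antidiagonal] at hp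
    rw [← hp, map_add]
    omega

end Exponential

/-! ### Series supported on a ray, and the quantum exponential -/

section Ray

variable {σ : Type*} {R : Type*} [CommRing R]

/-- The series `∑ u_n x ^ (n δ)`. -/
def ray (δ : σ →₀ ℕ) (u : PowerSeries R) : MvPowerSeries σ R :=
  u.subst (MvPowerSeries.monomial δ (1 : R))

lemma coeff_ray [DecidableEq σ] {δ : σ →₀ ℕ} (hδ : δ ≠ 0) (u : PowerSeries R) (γ : σ →₀ ℕ) (M : ℕ)
    (hM : γ.degree < M) :
    MvPowerSeries.coeff γ (ray δ u) =
      ∑ n ∈ Finset.range M, if n • δ = γ then PowerSeries.coeff n u else 0 := by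
  have hd : δ.degree ≠ 0 := fun h1 => hδ ((Finsupp.degree_eq_zero_iff _).1 h1)
  rw [ray, PowerSeries.coeff_subst (PowerSeries.HasSubst.monomial hδ 1),
    finsum_eq_sum_of_support_subset (s := Finset.range M)]
  · refine Finset.sum_congr rfl fun n _ => ?_
    rw [MvPowerSeries.monomial_pow, one_pow, MvPowerSeries.coeff_monomial]
    by_cases h : n • δ = γ
    · rw [if_pos h, if_pos h.symm, smul_eq_mul, mul_one]
    · rw [if_neg h, if_neg (Ne.symm h), smul_zero]
  · intro n hn
    rw [Finset.coe_range, Set.mem_Iio]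
    by_contra hlt
    refine hn ?_
    simp only
    rw [MvPowerSeries.monomial_pow, one_pow, MvPowerSeries.coeff_monomial, if_neg, smul_zero]
    rintro rfl
    rw [map_nsmul, smul_eq_mul] at hM
    have := Nat.le_mul_of_pos_right n (Nat.pos_of_ne_zero hd)
    omega

lemma nsmul_injective_of_ne_zero {δ : σ →₀ ℕ} (hδ : δ ≠ 0) :
    Function.Injective fun n : ℕ => n • δ := by
  intro a b hab
  obtain ⟨i, hi⟩ := Finsupp.ne_iff.1 hδ
  have := DFunLike.congr_fun hab i
  simp only [Finsupp.smul_apply, smul_eq_mul] at this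
  exact Nat.eq_of_mul_eq_mul_right (Nat.pos_of_ne_zero hi) this

lemma coeff_ray_nsmul {δ : σ →₀ ℕ} (hδ : δ ≠ 0) (u : PowerSeries R) (n : ℕ) :
    MvPowerSeries.coeff (n • δ) (ray δ u) = PowerSeries.coeff n u := by
  classical
  have hd : δ.degree ≠ 0 := fun h1 => hδ ((Finsupp.degree_eq_zero_iff _).1 h1)
  rw [coeff_ray hδ u _ ((n • δ).degree + 1) (by omega), Finset.sum_eq_single n]
  · simp
  · intro b _ hb
    rw [if_neg fun h => hb (nsmul_injective_of_ne_zero hδ h)]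
  · intro h
    refine absurd ?_ h
    rw [Finset.mem_range, map_nsmul, smul_eq_mul]
    have := Nat.le_mul_of_pos_right n (Nat.pos_of_ne_zero hd)
    omega

lemma coeff_ray_of_ne {δ : σ →₀ ℕ} (hδ : δ ≠ 0) (u : PowerSeries R) {γ : σ →₀ ℕ}
    (h : ∀ n : ℕ, n • δ ≠ γ) : MvPowerSeries.coeff γ (ray δ u) = 0 := by
  classical
  rw [coeff_ray hδ u _ _ (Nat.lt_succ_self _)]
  exact Finset.sum_eq_zero fun n _ => if_neg (h n)

lemma euler_ray {δ : σ →₀ ℕ} (hδ : δ ≠ 0) (u : PowerSeries R) :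
    euler (ray δ u) =
      (δ.degree : R) • ray δ (PowerSeries.mk fun n => (n : R) * PowerSeries.coeff n u) := by
  ext γ
  rw [coeff_euler, map_smul, smul_eq_mul]
  by_cases h : ∃ n : ℕ, n • δ = γ
  · obtain ⟨n, rfl⟩ := h
    rw [coeff_ray_nsmul hδ, coeff_ray_nsmul hδ, PowerSeries.coeff_mk, map_nsmul]
    simp only [smul_eq_mul, Nat.cast_mul]
    ring
  · push Not at h
    rw [coeff_ray_of_ne hδ _ h, coeff_ray_of_ne hδ _ h, mul_zero, mul_zero]

lemma ray_mul {δ : σ →₀ ℕ} (hδ : δ ≠ 0) (u v : PowerSeries R) :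
    ray δ (u * v) = ray δ u * ray δ v :=
  PowerSeries.subst_mul (PowerSeries.HasSubst.monomial hδ 1) u v

/-- On the ray, the Euler derivation is `δ.degree` times the one-variable operator u_n ↦ n u_n, and
the factor `δ.degree` is common to both sides of the differential equation. -/
lemma isExp_ray {δ : σ →₀ ℕ} (hδ : δ ≠ 0) {u v : PowerSeries R}
    (h0 : PowerSeries.coeff 0 v = 1)
    (h : ∀ n : ℕ, (n : R) * PowerSeries.coeff n v =
      ∑ p ∈ Finset.HasAntidiagonal.antidiagonal n,
        (p.1 : R) * PowerSeries.coeff p.1 u * PowerSeries.coeff p.2 v) :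
    IsExp (ray δ u) (ray δ v) := by
  refine ⟨?_, ?_⟩
  · have := coeff_ray_nsmul hδ v 0
    rwa [zero_smul, h0] at this
  · rw [euler_ray hδ, euler_ray hδ, smul_mul_assoc, ← ray_mul hδ]
    congr 2
    ext n
    rw [PowerSeries.coeff_mk, h, PowerSeries.coeff_mul]
    simp only [PowerSeries.coeff_mk]

end Ray

/-! ### Recursion and summation formulas for the quantum exponential -/

section QExp

variable {K : Type*} [Field K]

/-- The coefficients `1 / ∏_{i = 1}^n (1 - Q ^ i)` of the quantum exponential. -/
def qExpCoeff (Q : K) (n : ℕ) : K := ∏ i ∈ Finset.range n, (1 - Q ^ (i + 1))⁻¹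

lemma qExpCoeff_zero (Q : K) : qExpCoeff Q 0 = 1 := by simp [qExpCoeff]

lemma qExpCoeff_succ {Q : K} (hQ : ∀ n : ℕ, Q ^ (n + 1) ≠ 1) (n : ℕ) :
    qExpCoeff Q (n + 1) * (1 - Q ^ (n + 1)) = qExpCoeff Q n := by
  rw [qExpCoeff, Finset.prod_range_succ, mul_assoc, inv_mul_cancel₀, mul_one]
  · rfl
  · exact sub_ne_zero.2 (hQ n).symm

/-- This is the coefficientwise form of x e'(x) = (∑_{n ≥ 1} x^n / (1 - Q^n)) e(x) for the quantum
exponential e. -/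
lemma natCast_mul_qExpCoeff {Q : K} (hQ : ∀ n : ℕ, Q ^ (n + 1) ≠ 1) (n : ℕ) :
    (n : K) * qExpCoeff Q n =
      ∑ j ∈ Finset.range n, (1 - Q ^ (j + 1))⁻¹ * qExpCoeff Q (n - 1 - j) := by
  induction n with
  | zero => simp
  | succ n ih =>
    have h1 : ∀ m : ℕ, (1 - Q ^ (m + 1)) ≠ 0 := fun m => sub_ne_zero.2 (hQ m).symm
    refine mul_right_cancel₀ (h1 n) ?_
    rw [mul_assoc, qExpCoeff_succ hQ, Finset.sum_mul]
    -- Write 1 - Q^(n+1) = (1 - Q^(j+1)) + Q^(j+1) (1 - Q^(n-j)); the factor 1 - Q^(n-j) lowers the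
    -- index of `qExpCoeff` by one.
    have key : ∀ j ∈ Finset.range (n + 1),
        (1 - Q ^ (j + 1))⁻¹ * qExpCoeff Q (n + 1 - 1 - j) * (1 - Q ^ (n + 1)) =
          qExpCoeff Q (n - j) +
            (if j < n then ((1 - Q ^ (j + 1))⁻¹ - 1) * qExpCoeff Q (n - 1 - j) else 0) := by
      intro j hj
      rw [Finset.mem_range] at hj
      rcases Nat.lt_or_ge j n with hjn | hjn
      · rw [if_pos hjn]
        obtain ⟨m, rfl⟩ := Nat.exists_eq_add_of_lt hjn
        have e1 : j + m + 1 + 1 - 1 - j = m + 1 := by omega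
        have e2 : j + m + 1 - j = m + 1 := by omega
        have e3 : j + m + 1 - 1 - j = m := by omega
        rw [e1, e2, e3, ← qExpCoeff_succ hQ m]
        have := h1 j
        field_simp
        ring
      · have : j = n := by omega
        subst this
        have e1 : j + 1 - 1 - j = 0 := by omega
        rw [if_neg (by omega), e1, Nat.sub_self, qExpCoeff_zero, mul_one, add_zero,
          inv_mul_cancel₀ (h1 j)]
    rw [Finset.sum_congr rfl key, Finset.sum_add_distrib, Finset.sum_range_succ (fun j =>
      if j < n then ((1 - Q ^ (j + 1))⁻¹ - 1) * qExpCoeff Q (n - 1 - j) else 0),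
      if_neg (lt_irrefl n), add_zero]
    have : ∑ j ∈ Finset.range n,
        (if j < n then ((1 - Q ^ (j + 1))⁻¹ - 1) * qExpCoeff Q (n - 1 - j) else 0) =
        (n : K) * qExpCoeff Q n - ∑ j ∈ Finset.range n, qExpCoeff Q (n - 1 - j) := by
      rw [ih, ← Finset.sum_sub_distrib]
      refine Finset.sum_congr rfl fun j hj => ?_
      rw [if_pos (Finset.mem_range.1 hj)]
      ring
    rw [this, Finset.sum_range_reflect (fun j => qExpCoeff Q j) n]
    have : ∑ j ∈ Finset.range (n + 1), qExpCoeff Q (n - j) =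
        ∑ j ∈ Finset.range (n + 1), qExpCoeff Q j := by
      have := Finset.sum_range_reflect (fun j => qExpCoeff Q j) (n + 1)
      simpa using this
    rw [this, Finset.sum_range_succ]
    push_cast
    ring

/-- A finite q-binomial identity. Its use is that the right side vanishes for H = Q ^ i with 1 ≤ i ≤
N, whereas it equals 1 for H = 1. -/
lemma sum_qExpCoeff_mul_prod {Q : K} (hQ : ∀ n : ℕ, Q ^ (n + 1) ≠ 1) (H : K) (N : ℕ) :
    ∑ n ∈ Finset.range (N + 1), qExpCoeff Q n * ∏ i ∈ Finset.range n, (H - Q ^ i) =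
      qExpCoeff Q N * ∏ i ∈ Finset.range N, (H - Q ^ (i + 1)) := by
  induction N with
  | zero => simp
  | succ N ih =>
    rw [Finset.sum_range_succ, ih, ← qExpCoeff_succ hQ N,
      Finset.prod_range_succ' (fun i => H - Q ^ i), Finset.prod_range_succ _ N]
    ring

/-- The series `∑ y ^ n x ^ (n δ) / (n (1 - Q ^ n))`. -/
def qLogSeries {σ : Type*} (Q y : K) (δ : σ →₀ ℕ) : MvPowerSeries σ K :=
  ray δ (PowerSeries.mk fun n => (n : K)⁻¹ * (1 - Q ^ n)⁻¹ * y ^ n)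

/-- The series `∑ y ^ n x ^ (n δ) / ∏_{i = 1}^n (1 - Q ^ i)`. -/
def qExpSeries {σ : Type*} (Q y : K) (δ : σ →₀ ℕ) : MvPowerSeries σ K :=
  ray δ (PowerSeries.mk fun n => qExpCoeff Q n * y ^ n)

/-- The logarithmic differential equation on the ray is the recursion `natCast_mul_qExpCoeff`, with
the term of index n scaled by y ^ n. -/
lemma isExp_qExpSeries {σ : Type*} [CharZero K] {Q : K} (hQ : ∀ n : ℕ, Q ^ (n + 1) ≠ 1) (y : K)
    {δ : σ →₀ ℕ} (hδ : δ ≠ 0) : IsExp (qLogSeries Q y δ) (qExpSeries Q y δ) := by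
  refine isExp_ray hδ (by simp [qExpCoeff_zero]) fun n => ?_
  rw [PowerSeries.coeff_mk, ← mul_assoc, natCast_mul_qExpCoeff hQ,
    Finset.Nat.sum_antidiagonal_eq_sum_range_succ_mk, Finset.sum_range_succ', Finset.sum_mul]
  simp only [PowerSeries.coeff_mk, Nat.cast_zero, zero_mul, add_zero]
  refine Finset.sum_congr rfl fun j hj => ?_
  rw [Finset.mem_range] at hj
  have h1 : n - (j + 1) = n - 1 - j := by omega
  have h2 : y ^ n = y ^ (j + 1) * y ^ (n - 1 - j) := by rw [← pow_add]; congr 1; omega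
  have h3 : ((j + 1 : ℕ) : K) ≠ 0 := Nat.cast_ne_zero.2 (by omega)
  rw [h1, h2]
  field_simp

end QExp

/-! ### The category of finite-dimensional representations -/

/-- A finite-dimensional representation of the quiver, on arbitrary vector spaces. -/
structure QRep (I : Type u) [Quiver.{v} I] (k : Type) [Field k] where
  V : I → Type
  [grp : ∀ i, AddCommGroup (V i)]
  [mod : ∀ i, Module k (V i)]
  [fin : ∀ i, Module.Finite k (V i)]
  map : ∀ ⦃i j : I⦄, (i ⟶ j) → V i →ₗ[k] V j

attribute [instance] QRep.grp QRep.mod QRep.fin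

namespace QRep

variable {I : Type u} [Quiver.{v} I] {k : Type} [Field k]

/-- The space of homomorphisms of representations. -/
def homs (M N : QRep I k) : Submodule k (∀ i, M.V i →ₗ[k] N.V i) where
  carrier := {φ | ∀ ⦃i j : I⦄ (h : i ⟶ j) (v : M.V i), φ j (M.map h v) = N.map h (φ i v)}
  add_mem' := fun ha hb i j h v => by
    simp only [Pi.add_apply, LinearMap.add_apply, map_add]
    rw [ha h v, hb h v]
  zero_mem' := fun i j h v => by simp
  smul_mem' := fun c a ha i j h v => by
    simp only [Pi.smul_apply, LinearMap.smul_apply, map_smul]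
    rw [ha h v]

/-- Homomorphisms of representations. -/
abbrev Hom (M N : QRep I k) : Type u := homs M N

lemma Hom.comm {M N : QRep I k} (φ : Hom M N) {i j : I} (h : i ⟶ j) (v : M.V i) :
    φ.1 j (M.map h v) = N.map h (φ.1 i v) := φ.2 h v

lemma Hom.ext' {M N : QRep I k} {φ ψ : Hom M N} (h : ∀ i v, φ.1 i v = ψ.1 i v) : φ = ψ :=
  Subtype.ext (funext fun i => LinearMap.ext (h i))

/-- Composition of homomorphisms. -/
def Hom.comp {M N P : QRep I k} (ψ : Hom N P) (φ : Hom M N) : Hom M P :=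
  ⟨fun i => ψ.1 i ∘ₗ φ.1 i, fun i j h v => by simp [φ.comm h v, ψ.comm h]⟩

@[simp] lemma Hom.comp_apply {M N P : QRep I k} (ψ : Hom N P) (φ : Hom M N) (i : I) (v : M.V i) :
    (ψ.comp φ).1 i v = ψ.1 i (φ.1 i v) := rfl

/-- The identity homomorphism. -/
def Hom.id (M : QRep I k) : Hom M M := ⟨fun _ => LinearMap.id, fun _ _ _ _ => rfl⟩

@[simp] lemma Hom.zero_apply {M N : QRep I k} (i : I) (v : M.V i) : (0 : Hom M N).1 i v = 0 := rfl

@[simp] lemma Hom.add_apply {M N : QRep I k} (φ ψ : Hom M N) (i : I) (v : M.V i) :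
    (φ + ψ).1 i v = φ.1 i v + ψ.1 i v := rfl

@[simp] lemma Hom.sub_apply {M N : QRep I k} (φ ψ : Hom M N) (i : I) (v : M.V i) :
    (φ - ψ).1 i v = φ.1 i v - ψ.1 i v := rfl

@[simp] lemma Hom.smul_apply {M N : QRep I k} (c : k) (φ : Hom M N) (i : I) (v : M.V i) :
    (c • φ).1 i v = c • φ.1 i v := rfl

/-- Injective homomorphisms. -/
def Hom.Inj {M N : QRep I k} (φ : Hom M N) : Prop := ∀ i, Function.Injective (φ.1 i)

/-- Surjective homomorphisms. -/
def Hom.Surj {M N : QRep I k} (φ : Hom M N) : Prop := ∀ i, Function.Surjective (φ.1 i)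

lemma Hom.Inj.comp {M N P : QRep I k} {ψ : Hom N P} {φ : Hom M N} (h : ψ.Inj) (h' : φ.Inj) :
    (ψ.comp φ).Inj := fun i _ _ hab => h' i (h i hab)

lemma Hom.Surj.comp {M N P : QRep I k} {ψ : Hom N P} {φ : Hom M N} (h : ψ.Surj) (h' : φ.Surj) :
    (ψ.comp φ).Surj := fun i => (h i).comp (h' i)

/-- The inverse of a bijective homomorphism. -/
def Hom.inv {M N : QRep I k} (φ : Hom M N) (h : φ.Inj) (h' : φ.Surj) : Hom N M :=
  ⟨fun i => (LinearEquiv.ofBijective (φ.1 i) ⟨h i, h' i⟩).symm, fun i j e v => by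
    apply h j
    rw [φ.comm]
    have h1 : ∀ (i : I) (w : N.V i),
        φ.1 i ((LinearEquiv.ofBijective (φ.1 i) ⟨h i, h' i⟩).symm w) = w := fun i w =>
      (LinearEquiv.ofBijective (φ.1 i) ⟨h i, h' i⟩).apply_symm_apply w
    exact (h1 j _).trans (congrArg _ (h1 i v).symm)⟩

@[simp] lemma Hom.apply_inv {M N : QRep I k} (φ : Hom M N) (h : φ.Inj) (h' : φ.Surj) (i : I)
    (w : N.V i) : φ.1 i ((φ.inv h h').1 i w) = w :=
  (LinearEquiv.ofBijective (φ.1 i) ⟨h i, h' i⟩).apply_symm_apply w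

@[simp] lemma Hom.inv_apply {M N : QRep I k} (φ : Hom M N) (h : φ.Inj) (h' : φ.Surj) (i : I)
    (w : M.V i) : (φ.inv h h').1 i (φ.1 i w) = w :=
  (LinearEquiv.ofBijective (φ.1 i) ⟨h i, h' i⟩).symm_apply_apply w

lemma Hom.inv_inj {M N : QRep I k} (φ : Hom M N) (h : φ.Inj) (h' : φ.Surj) : (φ.inv h h').Inj :=
  fun i => Function.LeftInverse.injective (g := φ.1 i) fun w => φ.apply_inv h h' i w

lemma Hom.inv_surj {M N : QRep I k} (φ : Hom M N) (h : φ.Inj) (h' : φ.Surj) :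
    (φ.inv h h').Surj :=
  fun i w => ⟨φ.1 i w, φ.inv_apply h h' i w⟩

/-- Isomorphic representations. -/
def Iso (M N : QRep I k) : Prop := ∃ φ : Hom M N, φ.Inj ∧ φ.Surj

lemma Iso.symm {M N : QRep I k} (h : Iso M N) : Iso N M := by
  obtain ⟨φ, h, h'⟩ := h
  exact ⟨φ.inv h h', φ.inv_inj h h', φ.inv_surj h h'⟩

lemma Iso.trans {M N P : QRep I k} (h : Iso M N) (h' : Iso N P) : Iso M P := by
  obtain ⟨φ, h1, h2⟩ := h
  obtain ⟨ψ, h3, h4⟩ := h'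
  exact ⟨ψ.comp φ, h3.comp h1, h4.comp h2⟩

/-! ### Subrepresentations -/

/-- Families of subspaces preserved by all arrows. -/
def IsSub (M : QRep I k) (U : ∀ i, Submodule k (M.V i)) : Prop :=
  ∀ ⦃i j : I⦄ (h : i ⟶ j) (v : M.V i), v ∈ U i → M.map h v ∈ U j

lemma isSub_top (M : QRep I k) : M.IsSub ⊤ := fun _ _ _ _ _ => trivial

lemma IsSub.inf {M : QRep I k} {U W : ∀ i, Submodule k (M.V i)} (hU : M.IsSub U)
    (hW : M.IsSub W) : M.IsSub (U ⊓ W) := fun _ _ h v hv => ⟨hU h v hv.1, hW h v hv.2⟩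

lemma IsSub.sup {M : QRep I k} {U W : ∀ i, Submodule k (M.V i)} (hU : M.IsSub U)
    (hW : M.IsSub W) : M.IsSub (U ⊔ W) := fun i j h v hv => by
  obtain ⟨a, ha, b, hb, rfl⟩ := Submodule.mem_sup.1 (show v ∈ U i ⊔ W i from hv)
  rw [map_add]
  exact Submodule.add_mem_sup (hU h a ha) (hW h b hb)

/-- The preimage of a family of subspaces. -/
def Hom.comap {M N : QRep I k} (φ : Hom M N) (W : ∀ i, Submodule k (N.V i)) :
    ∀ i, Submodule k (M.V i) := fun i => (W i).comap (φ.1 i)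

/-- The image of a family of subspaces. -/
def Hom.image {M N : QRep I k} (φ : Hom M N) (U : ∀ i, Submodule k (M.V i)) :
    ∀ i, Submodule k (N.V i) := fun i => (U i).map (φ.1 i)

/-- The kernel of a homomorphism. -/
def Hom.ker {M N : QRep I k} (φ : Hom M N) : ∀ i, Submodule k (M.V i) :=
  fun i => LinearMap.ker (φ.1 i)

/-- The image of a homomorphism. -/
def Hom.range {M N : QRep I k} (φ : Hom M N) : ∀ i, Submodule k (N.V i) :=
  fun i => LinearMap.range (φ.1 i)

lemma Hom.image_top {M N : QRep I k} (φ : Hom M N) : φ.image ⊤ = φ.range :=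
  funext fun _ => Submodule.map_top _

lemma Hom.Inj.image_injective {M N : QRep I k} {φ : Hom M N} (h : φ.Inj) :
    Function.Injective φ.image := fun _ _ hUW => funext fun i =>
  Submodule.map_injective_of_injective (h i) (congrFun hUW i)

lemma Hom.image_bot {M N : QRep I k} (φ : Hom M N) : φ.image ⊥ = ⊥ :=
  funext fun _ => Submodule.map_bot _

lemma IsSub.comap {M N : QRep I k} (φ : Hom M N) {W : ∀ i, Submodule k (N.V i)}
    (hW : N.IsSub W) : M.IsSub (φ.comap W) := fun i j h v hv => by
  change φ.1 j (M.map h v) ∈ W j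
  rw [φ.comm]
  exact hW h _ hv

lemma IsSub.image {M N : QRep I k} (φ : Hom M N) {U : ∀ i, Submodule k (M.V i)}
    (hU : M.IsSub U) : N.IsSub (φ.image U) := by
  rintro i j h _ ⟨v, hv, rfl⟩
  exact ⟨M.map h v, hU h v hv, φ.comm h v⟩

lemma Hom.isSub_ker {M N : QRep I k} (φ : Hom M N) : M.IsSub φ.ker := fun i j h v hv => by
  have hv : φ.1 i v = 0 := hv
  change φ.1 j (M.map h v) = 0
  rw [φ.comm, hv, map_zero]

lemma Hom.isSub_range {M N : QRep I k} (φ : Hom M N) : N.IsSub φ.range := by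
  rw [← Hom.image_top]
  exact (isSub_top M).image φ

lemma Hom.inj_iff {M N : QRep I k} (φ : Hom M N) : φ.Inj ↔ φ.ker = ⊥ := by
  constructor
  · intro h; funext i; exact LinearMap.ker_eq_bot.2 (h i)
  · intro h i; exact LinearMap.ker_eq_bot.1 (congrFun h i)

lemma Hom.surj_iff {M N : QRep I k} (φ : Hom M N) : φ.Surj ↔ φ.range = ⊤ := by
  constructor
  · intro h; funext i; exact LinearMap.range_eq_top.2 (h i)
  · intro h i; exact LinearMap.range_eq_top.1 (congrFun h i)

lemma Hom.ker_eq_top_iff {M N : QRep I k} (φ : Hom M N) : φ.ker = ⊤ ↔ φ = 0 := by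
  constructor
  · intro h
    refine Hom.ext' fun i v => ?_
    exact LinearMap.congr_fun (LinearMap.ker_eq_top.1 (congrFun h i)) v
  · rintro rfl; funext i; exact LinearMap.ker_eq_top.2 rfl

lemma Hom.range_eq_bot_iff {M N : QRep I k} (φ : Hom M N) : φ.range = ⊥ ↔ φ = 0 := by
  constructor
  · intro h
    refine Hom.ext' fun i v => ?_
    exact LinearMap.congr_fun (LinearMap.range_eq_bot.1 (congrFun h i)) v
  · rintro rfl; funext i; exact LinearMap.range_eq_bot.2 rfl

/-- A subrepresentation as a representation. -/
def sub (M : QRep I k) (U : ∀ i, Submodule k (M.V i)) (hU : M.IsSub U) : QRep I k where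
  V := fun i => U i
  map := fun _ _ h => (M.map h).restrict (hU h)

/-- The inclusion of a subrepresentation. -/
def incl (M : QRep I k) (U : ∀ i, Submodule k (M.V i)) (hU : M.IsSub U) : Hom (M.sub U hU) M :=
  ⟨fun i => (U i).subtype, fun _ _ _ _ => rfl⟩

lemma incl_inj (M : QRep I k) (U : ∀ i, Submodule k (M.V i)) (hU : M.IsSub U) :
    (M.incl U hU).Inj := fun i => Submodule.injective_subtype (U i)

lemma range_incl (M : QRep I k) (U : ∀ i, Submodule k (M.V i)) (hU : M.IsSub U) :
    (M.incl U hU).range = U := funext fun i => Submodule.range_subtype (U i)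

/-- The zero representation. -/
def zero (I : Type u) [Quiver.{v} I] (k : Type) [Field k] : QRep I k where
  V := fun _ => PUnit
  map := fun _ _ _ => 0

/-- The direct sum of two representations. -/
abbrev prod (M N : QRep I k) : QRep I k where
  V := fun i => M.V i × N.V i
  map := fun _ _ h => (M.map h).prodMap (N.map h)

/-- The first inclusion into a direct sum. -/
def inl (M N : QRep I k) : Hom M (M.prod N) :=
  ⟨fun i => LinearMap.inl k (M.V i) (N.V i), fun _ _ h _ => Prod.ext rfl (map_zero (N.map h)).symm⟩

/-- The second inclusion into a direct sum. -/
def inr (M N : QRep I k) : Hom N (M.prod N) :=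
  ⟨fun i => LinearMap.inr k (M.V i) (N.V i), fun _ _ h _ => Prod.ext (map_zero (M.map h)).symm rfl⟩

/-- The first projection of a direct sum. -/
def fst (M N : QRep I k) : Hom (M.prod N) M :=
  ⟨fun i => LinearMap.fst k (M.V i) (N.V i), fun _ _ _ _ => rfl⟩

/-- The second projection of a direct sum. -/
def snd (M N : QRep I k) : Hom (M.prod N) N :=
  ⟨fun i => LinearMap.snd k (M.V i) (N.V i), fun _ _ _ _ => rfl⟩

@[simp] lemma inl_apply (M N : QRep I k) (i : I) (v : M.V i) : (inl M N).1 i v = (v, 0) := rfl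
@[simp] lemma inr_apply (M N : QRep I k) (i : I) (v : N.V i) : (inr M N).1 i v = (0, v) := rfl
@[simp] lemma fst_apply (M N : QRep I k) (i : I) (v : (M.prod N).V i) :
    (fst M N).1 i v = v.1 := rfl
@[simp] lemma snd_apply (M N : QRep I k) (i : I) (v : (M.prod N).V i) :
    (snd M N).1 i v = v.2 := rfl

/-- The homomorphism out of a direct sum with given components. -/
def coprod {M N P : QRep I k} (f : Hom M P) (g : Hom N P) : Hom (M.prod N) P :=
  f.comp (fst M N) + g.comp (snd M N)

@[simp] lemma coprod_apply {M N P : QRep I k} (f : Hom M P) (g : Hom N P) (i : I)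
    (v : (M.prod N).V i) : (coprod f g).1 i v = f.1 i v.1 + g.1 i v.2 := rfl

/-- The homomorphism into a direct sum with given components. -/
def lift {M N P : QRep I k} (f : Hom P M) (g : Hom P N) : Hom P (M.prod N) :=
  (inl M N).comp f + (inr M N).comp g

@[simp] lemma lift_apply {M N P : QRep I k} (f : Hom P M) (g : Hom P N) (i : I)
    (v : P.V i) : (lift f g).1 i v = (f.1 i v, g.1 i v) := by
  exact Prod.ext (add_zero (f.1 i v)) (zero_add (g.1 i v))

lemma coprod_comp_inl {M N P : QRep I k} (f : Hom M P) (g : Hom N P) :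
    (coprod f g).comp (inl M N) = f := Hom.ext' fun i v => by
  change f.1 i v + g.1 i 0 = f.1 i v
  rw [map_zero, add_zero]

lemma coprod_comp_inr {M N P : QRep I k} (f : Hom M P) (g : Hom N P) :
    (coprod f g).comp (inr M N) = g := Hom.ext' fun i v => by
  change f.1 i 0 + g.1 i v = g.1 i v
  rw [map_zero, zero_add]

lemma coprod_comp_eq {M N P : QRep I k} (φ : Hom (M.prod N) P) :
    coprod (φ.comp (inl M N)) (φ.comp (inr M N)) = φ := Hom.ext' fun i v => by
  change φ.1 i (v.1, 0) + φ.1 i (0, v.2) = φ.1 i v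
  refine (map_add (φ.1 i) (v.1, 0) (0, v.2)).symm.trans (congrArg (φ.1 i) ?_)
  exact Prod.ext (add_zero v.1) (zero_add v.2)

lemma fst_comp_lift {M N P : QRep I k} (f : Hom P M) (g : Hom P N) :
    (fst M N).comp (lift f g) = f := Hom.ext' fun i v =>
  congrArg Prod.fst (lift_apply f g i v)

lemma snd_comp_lift {M N P : QRep I k} (f : Hom P M) (g : Hom P N) :
    (snd M N).comp (lift f g) = g := Hom.ext' fun i v =>
  congrArg Prod.snd (lift_apply f g i v)

lemma lift_comp_eq {M N P : QRep I k} (φ : Hom P (M.prod N)) :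
    lift ((fst M N).comp φ) ((snd M N).comp φ) = φ := Hom.ext' fun i v =>
  lift_apply _ _ i v

/-- If the range of `g` is contained in that of the injective homomorphism `f`, then `g` factors
through `f`. -/
lemma Hom.exists_factor {M N P : QRep I k} (f : Hom M N) (hf : f.Inj) (g : Hom P N)
    (h : g.range ≤ f.range) : ∃ g' : Hom P M, f.comp g' = g := by
  have h1 : ∀ (i : I) (v : P.V i), g.1 i v ∈ LinearMap.range (f.1 i) := fun i v =>
    h i (LinearMap.mem_range_self (g.1 i) v)
  let e : ∀ i, M.V i ≃ₗ[k] LinearMap.range (f.1 i) := fun i => LinearEquiv.ofInjective (f.1 i) (hf i)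
  have h2 : ∀ (i : I) (w : LinearMap.range (f.1 i)), f.1 i ((e i).symm w) = w := fun i w =>
    congrArg Subtype.val ((e i).apply_symm_apply w)
  refine ⟨⟨fun i => (e i).symm.toLinearMap ∘ₗ (g.1 i).codRestrict _ (h1 i), ?_⟩, ?_⟩
  · intro i j a v
    apply hf j
    rw [f.comm]
    simp only [LinearMap.comp_apply, LinearEquiv.coe_coe, h2, LinearMap.codRestrict_apply]
    exact g.comm a v
  · refine Hom.ext' fun i v => ?_
    simp only [Hom.comp_apply, LinearMap.comp_apply, LinearEquiv.coe_coe, h2,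
      LinearMap.codRestrict_apply]

/-- Short exact sequences `M → L → C`. -/
def Exact {M L C : QRep I k} (φ : Hom M L) (ψ : Hom L C) : Prop :=
  φ.Inj ∧ ψ.Surj ∧ φ.range = ψ.ker

lemma exact_inl_snd (M N : QRep I k) : Exact (inl M N) (snd M N) :=
  ⟨fun _ => LinearMap.inl_injective, fun _ => Prod.snd_surjective,
    funext fun i => LinearMap.range_inl k (M.V i) (N.V i)⟩

/-! ### Weights, semistability and stability -/

section Weight

variable [Fintype I]

/-- The weight of a family of subspaces. -/
def wt {M : QRep I k} (c : I → ℚ) (U : ∀ i, Submodule k (M.V i)) : ℚ :=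
  ∑ i, c i * Module.finrank k (U i)

lemma wt_bot {M : QRep I k} (c : I → ℚ) : wt c (⊥ : ∀ i, Submodule k (M.V i)) = 0 := by
  simp [wt]

lemma wt_top {M : QRep I k} (c : I → ℚ) :
    wt c (⊤ : ∀ i, Submodule k (M.V i)) = ∑ i, c i * Module.finrank k (M.V i) := by
  simp [wt]

lemma wt_sup_add_inf {M : QRep I k} (c : I → ℚ) (U W : ∀ i, Submodule k (M.V i)) :
    wt c (U ⊔ W) + wt c (U ⊓ W) = wt c U + wt c W := by
  simp only [wt, ← Finset.sum_add_distrib, ← mul_add]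
  refine Finset.sum_congr rfl fun i _ => ?_
  congr 1
  exact_mod_cast Submodule.finrank_sup_add_finrank_inf_eq (U i) (W i)

lemma _root_.Submodule.finrank_map_add_finrank_inf_ker {V W : Type*} [AddCommGroup V] [Module k V]
    [AddCommGroup W] [Module k W] [Module.Finite k V] (f : V →ₗ[k] W) (U : Submodule k V) :
    Module.finrank k (U.map f) + Module.finrank k (U ⊓ LinearMap.ker f : Submodule k V) =
      Module.finrank k U := by
  have h := LinearMap.finrank_range_add_finrank_ker (f.domRestrict U)
  rw [LinearMap.range_domRestrict] at h
  rw [← h]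
  congr 1
  rw [LinearMap.ker_domRestrict]
  exact (Submodule.comapSubtypeEquivOfLe (p := U ⊓ LinearMap.ker f) (q := U) inf_le_left
    |>.finrank_eq.symm.trans (by rw [Submodule.comap_inf, Submodule.comap_subtype_self, top_inf_eq]))

lemma wt_image_add_inf_ker {M N : QRep I k} (c : I → ℚ) (φ : Hom M N)
    (U : ∀ i, Submodule k (M.V i)) : wt c (φ.image U) + wt c (U ⊓ φ.ker) = wt c U := by
  simp only [wt, ← Finset.sum_add_distrib, ← mul_add]
  refine Finset.sum_congr rfl fun i _ => ?_
  congr 1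
  exact_mod_cast Submodule.finrank_map_add_finrank_inf_ker (φ.1 i) (U i)

lemma wt_range_add_ker {M N : QRep I k} (c : I → ℚ) (φ : Hom M N) :
    wt c φ.range + wt c φ.ker = wt c (⊤ : ∀ i, Submodule k (M.V i)) := by
  rw [← wt_image_add_inf_ker c φ ⊤, φ.image_top, top_inf_eq]

lemma wt_image_of_inj {M N : QRep I k} (c : I → ℚ) {φ : Hom M N} (h : φ.Inj)
    (U : ∀ i, Submodule k (M.V i)) : wt c (φ.image U) = wt c U := by
  rw [← wt_image_add_inf_ker c φ U, φ.inj_iff.1 h, inf_bot_eq, wt_bot, add_zero]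

lemma wt_comap_of_exact {M L C : QRep I k} (c : I → ℚ) {φ : Hom M L} {ψ : Hom L C}
    (hφ : φ.Inj) (hr : φ.range = ψ.ker) (U : ∀ i, Submodule k (L.V i)) :
    wt c (ψ.image U) + wt c (φ.comap U) = wt c U := by
  rw [← wt_image_add_inf_ker c ψ U, ← hr, ← wt_image_of_inj c hφ (φ.comap U)]
  congr 2
  funext i
  exact (Submodule.map_comap_eq (φ.1 i) (U i)).trans (inf_comm _ _)

/-- Semistability with respect to a weight `c` with `c (dim M) = 0`. -/
def SS (c : I → ℚ) (M : QRep I k) : Prop :=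
  wt c (⊤ : ∀ i, Submodule k (M.V i)) = 0 ∧ ∀ U, M.IsSub U → wt c U ≤ 0

/-- A representation is nonzero. -/
def Nonzero (M : QRep I k) : Prop := (⊤ : ∀ i, Submodule k (M.V i)) ≠ ⊥

/-- Stability with respect to a weight `c` with `c (dim M) = 0`. -/
def Stable (c : I → ℚ) (M : QRep I k) : Prop :=
  M.Nonzero ∧ wt c (⊤ : ∀ i, Submodule k (M.V i)) = 0 ∧
    ∀ U, M.IsSub U → U ≠ ⊥ → U ≠ ⊤ → wt c U < 0

lemma Stable.ss {c : I → ℚ} {M : QRep I k} (h : M.Stable c) : M.SS c := by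
  refine ⟨h.2.1, fun U hU => ?_⟩
  by_cases h1 : U = ⊥
  · rw [h1, wt_bot]
  by_cases h2 : U = ⊤
  · rw [h2, h.2.1]
  exact (h.2.2 U hU h1 h2).le

lemma Stable.eq_bot_or_top {c : I → ℚ} {M : QRep I k} (h : M.Stable c)
    {U : ∀ i, Submodule k (M.V i)} (hU : M.IsSub U) (h0 : wt c U = 0) : U = ⊥ ∨ U = ⊤ := by
  by_contra hne
  push Not at hne
  exact (h.2.2 U hU hne.1 hne.2).ne h0

/-- As a subrepresentation of L the image has weight at most 0; as a quotient of M it has weight at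
least 0. -/
lemma SS.wt_range {c : I → ℚ} {M L : QRep I k} (hM : M.SS c) (hL : L.SS c) (φ : Hom M L) :
    wt c φ.range = 0 := by
  have h1 := hL.2 _ φ.isSub_range
  have h2 := hM.2 _ φ.isSub_ker
  have h3 := wt_range_add_ker c φ
  rw [hM.1] at h3
  linarith

lemma SS.wt_ker {c : I → ℚ} {M L : QRep I k} (hM : M.SS c) (hL : L.SS c) (φ : Hom M L) :
    wt c φ.ker = 0 := by
  have h3 := wt_range_add_ker c φ
  rw [hM.1, hM.wt_range hL] at h3
  linarith

/-- One half of Schur's lemma: the kernel has weight 0, so stability leaves only the zero kernel. -/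
lemma Stable.inj_of_ne_zero {c : I → ℚ} {S L : QRep I k} (hS : S.Stable c) (hL : L.SS c)
    {φ : Hom S L} (h : φ ≠ 0) : φ.Inj := by
  rw [φ.inj_iff]
  refine (hS.eq_bot_or_top φ.isSub_ker (hS.ss.wt_ker hL φ)).resolve_right fun h1 => ?_
  exact h (φ.ker_eq_top_iff.1 h1)

lemma Stable.surj_of_ne_zero {c : I → ℚ} {M T : QRep I k} (hM : M.SS c) (hT : T.Stable c)
    {φ : Hom M T} (h : φ ≠ 0) : φ.Surj := by
  rw [φ.surj_iff]
  refine (hT.eq_bot_or_top φ.isSub_range (hM.wt_range hT.ss φ)).resolve_left fun h1 => ?_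
  exact h (φ.range_eq_bot_iff.1 h1)

lemma Stable.iso_of_ne_zero {c : I → ℚ} {S T : QRep I k} (hS : S.Stable c) (hT : T.Stable c)
    {φ : Hom S T} (h : φ ≠ 0) : Iso S T :=
  ⟨φ, hS.inj_of_ne_zero hT.ss h, hT.surj_of_ne_zero hS.ss h⟩

/-- A homomorphism from a stable representation whose image is not contained in that of `f` is
injective, with image independent of that of `f`. -/
lemma Stable.comap_range_eq_bot {c : I → ℚ} {S M L : QRep I k} (hS : S.Stable c) (hM : M.SS c)
    (hL : L.SS c) (f : Hom M L) (g : Hom S L) (h : ¬ g.range ≤ f.range) :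
    g.comap f.range = ⊥ := by
  have hU : S.IsSub (g.comap f.range) := f.isSub_range.comap g
  have h1 := hM.wt_range hL f
  have h2 := hS.ss.wt_range hL g
  have h3 := wt_sup_add_inf c g.range f.range
  have h4 := hL.2 _ (g.isSub_range.sup f.isSub_range)
  have h5 := hL.2 _ (g.isSub_range.inf f.isSub_range)
  have h6 := wt_image_add_inf_ker c g (g.comap f.range)
  have h7 : g.image (g.comap f.range) = g.range ⊓ f.range := funext fun i =>
    Submodule.map_comap_eq (g.1 i) (f.range i)
  have h8 : g.comap f.range ⊓ g.ker = g.ker := by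
    refine inf_eq_right.2 fun i v hv => ?_
    have hv : g.1 i v = 0 := hv
    change g.1 i v ∈ f.range i
    rw [hv]
    exact Submodule.zero_mem _
  rw [h7, h8, hS.ss.wt_ker hL] at h6
  refine (hS.eq_bot_or_top hU (by linarith)).resolve_right fun h9 => h fun i => ?_
  rintro _ ⟨v, rfl⟩
  have : v ∈ g.comap f.range i := by rw [h9]; trivial
  exact this

lemma Stable.coprod_inj {c : I → ℚ} {S M L : QRep I k} (hS : S.Stable c) (hM : M.SS c)
    (hL : L.SS c) {f : Hom M L} (hf : f.Inj) {g : Hom S L} (h : ¬ g.range ≤ f.range) :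
    (coprod g f).Inj := by
  have h0 := hS.comap_range_eq_bot hM hL f g h
  intro i
  rw [← LinearMap.ker_eq_bot, LinearMap.ker_eq_bot']
  rintro ⟨s, m⟩ hsm
  have hsm : g.1 i s + f.1 i m = 0 := hsm
  have h1 : s ∈ g.comap f.range i :=
    ⟨-m, by rw [map_neg]; exact (eq_neg_of_add_eq_zero_left hsm).symm⟩
  rw [h0] at h1
  have h1 : s = 0 := h1
  rw [h1, map_zero, zero_add] at hsm
  have h2 : m = 0 := hf i (by rw [hsm, map_zero])
  rw [h1, h2]
  rfl

lemma Exact.wt_eq {M L C : QRep I k} {φ : Hom M L} {ψ : Hom L C} (h : Exact φ ψ) (c : I → ℚ)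
    (U : ∀ i, Submodule k (L.V i)) : wt c U = wt c (ψ.image U) + wt c (φ.comap U) :=
  (wt_comap_of_exact c h.1 h.2.2 U).symm

lemma Exact.wt_comap {M L C : QRep I k} {φ : Hom M L} {ψ : Hom L C} (h : Exact φ ψ) (c : I → ℚ)
    (W : ∀ i, Submodule k (C.V i)) :
    wt c (ψ.comap W) = wt c W + wt c (⊤ : ∀ i, Submodule k (M.V i)) := by
  rw [h.wt_eq c]
  congr 2
  · funext i
    exact Submodule.map_comap_eq_of_surjective (h.2.1 i) (W i)
  · funext i
    rw [Pi.top_apply, eq_top_iff]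
    intro v _
    have : φ.1 i v ∈ ψ.ker i := by rw [← h.2.2]; exact ⟨v, rfl⟩
    have : ψ.1 i (φ.1 i v) = 0 := this
    change ψ.1 i (φ.1 i v) ∈ W i
    rw [this]
    exact Submodule.zero_mem _

lemma Exact.wt_top {M L C : QRep I k} {φ : Hom M L} {ψ : Hom L C} (h : Exact φ ψ) (c : I → ℚ) :
    wt c (⊤ : ∀ i, Submodule k (L.V i)) =
      wt c (⊤ : ∀ i, Submodule k (C.V i)) + wt c (⊤ : ∀ i, Submodule k (M.V i)) := by
  rw [← h.wt_comap c ⊤]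
  rfl

/-- Weights are additive in exact sequences, and since M has weight 0 a subrepresentation of C has
the same weight as its preimage in L. -/
lemma Exact.ss_iff {M L C : QRep I k} {φ : Hom M L} {ψ : Hom L C} (h : Exact φ ψ) {c : I → ℚ}
    (hM : M.SS c) : L.SS c ↔ C.SS c := by
  have h1 := h.wt_top c
  rw [hM.1, add_zero] at h1
  constructor
  · intro hL
    refine ⟨by rw [← h1, hL.1], fun W hW => ?_⟩
    have := h.wt_comap c W
    rw [hM.1, add_zero] at this
    rw [← this]
    exact hL.2 _ (hW.comap ψ)
  · intro hC
    refine ⟨by rw [h1, hC.1], fun U hU => ?_⟩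
    rw [h.wt_eq c]
    exact add_nonpos (hC.2 _ (hU.image ψ)) (hM.2 _ (hU.comap φ))

lemma SS.prod {c : I → ℚ} {M N : QRep I k} (hM : M.SS c) (hN : N.SS c) : (M.prod N).SS c :=
  ((exact_inl_snd M N).ss_iff hM).2 hN

lemma ss_zero (c : I → ℚ) : (zero I k).SS c := by
  have h : ∀ U : ∀ i, Submodule k ((zero I k).V i), wt c U = 0 := fun U => by
    have : U = ⊥ := funext fun i => (Submodule.eq_bot_iff _).2 fun _ _ => rfl
    rw [this, wt_bot]
  exact ⟨h _, fun U _ => (h U).le⟩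

lemma Iso.ss {c : I → ℚ} {M N : QRep I k} (h : Iso M N) (hM : M.SS c) : N.SS c := by
  obtain ⟨φ, hi, hs⟩ := h.symm
  refine ⟨?_, fun U hU => ?_⟩
  · rw [← wt_image_of_inj c hi, φ.image_top, φ.surj_iff.1 hs, hM.1]
  · rw [← wt_image_of_inj c hi]
    exact hM.2 _ (hU.image φ)

lemma Iso.stable {c : I → ℚ} {M N : QRep I k} (h : Iso M N) (hM : M.Stable c) : N.Stable c := by
  have hN := h.ss hM.ss
  obtain ⟨φ, hi, hs⟩ := h.symm
  refine ⟨fun h0 => hM.1 ?_, hN.1, fun U hU h1 h2 => ?_⟩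
  · rw [← φ.surj_iff.1 hs, ← φ.image_top, h0, φ.image_bot]
  · rw [← wt_image_of_inj c hi]
    refine hM.2.2 _ (hU.image φ) (fun h3 => h1 ?_) fun h3 => h2 ?_
    · exact hi.image_injective (h3.trans φ.image_bot.symm)
    · exact hi.image_injective (h3.trans ((φ.surj_iff.1 hs).symm.trans φ.image_top.symm))

/-- The total dimension of a family of subspaces. -/
def size {M : QRep I k} (U : ∀ i, Submodule k (M.V i)) : ℕ := ∑ i, Module.finrank k (U i)

lemma size_mono {M : QRep I k} {U W : ∀ i, Submodule k (M.V i)} (h : U ≤ W) : size U ≤ size W :=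
  Finset.sum_le_sum fun i _ => Submodule.finrank_mono (h i)

lemma eq_of_le_of_size_le {M : QRep I k} {U W : ∀ i, Submodule k (M.V i)} (h : U ≤ W)
    (hs : size W ≤ size U) : U = W := by
  have h1 : ∀ i ∈ Finset.univ, Module.finrank k (U i) ≤ Module.finrank k (W i) := fun i _ =>
    Submodule.finrank_mono (h i)
  have h2 := (Finset.sum_eq_sum_iff_of_le h1).1 (le_antisymm (Finset.sum_le_sum h1) hs)
  exact funext fun i => Submodule.eq_of_le_of_finrank_eq (h i) (h2 i (Finset.mem_univ i))

lemma size_lt_of_lt {M : QRep I k} {U W : ∀ i, Submodule k (M.V i)} (h : U < W) :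
    size U < size W := by
  by_contra hs
  exact h.ne (eq_of_le_of_size_le h.le (not_lt.1 hs))

/-- A nonzero subrepresentation of weight zero contains a stable one. -/
lemma SS.exists_stable_sub {c : I → ℚ} {M : QRep I k} (hM : M.SS c)
    {U : ∀ i, Submodule k (M.V i)} (hU : M.IsSub U) (h0 : wt c U = 0) (hne : U ≠ ⊥) :
    ∃ (W : ∀ i, Submodule k (M.V i)) (hW : M.IsSub W), W ≤ U ∧ (M.sub W hW).Stable c := by
  classical
  -- A nonzero subrepresentation of weight 0 inside U with minimal total dimension is stable.
  have hex : ∃ n, ∃ W : ∀ i, Submodule k (M.V i), M.IsSub W ∧ W ≤ U ∧ wt c W = 0 ∧ W ≠ ⊥ ∧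
      size W = n := ⟨_, U, hU, le_rfl, h0, hne, rfl⟩
  obtain ⟨W, hW, hWU, hW0, hWne, hn⟩ := Nat.find_spec hex
  have hmin : ∀ W' : ∀ i, Submodule k (M.V i), M.IsSub W' → W' ≤ W → wt c W' = 0 → W' ≠ ⊥ →
      W' = W := fun W' h1 h2 h3 h4 => by
    refine eq_of_le_of_size_le h2 ?_
    rw [hn]
    exact Nat.find_min' hex ⟨W', h1, h2.trans hWU, h3, h4, rfl⟩
  have hi := M.incl_inj W hW
  have htop : (M.incl W hW).image ⊤ = W := by rw [Hom.image_top, range_incl]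
  have hle : ∀ U', (M.incl W hW).image U' ≤ W := fun U' i => by
    rintro _ ⟨v, _, rfl⟩; exact v.2
  have hbot : ∀ U', (M.incl W hW).image U' = ⊥ → U' = ⊥ := fun U' h =>
    hi.image_injective (h.trans (Hom.image_bot _).symm)
  refine ⟨W, hW, hWU, fun h => hWne ?_, ?_, fun U' hU' h1 h2 => ?_⟩
  · rw [← htop, h, Hom.image_bot]
  · rw [← wt_image_of_inj c hi, htop, hW0]
  · rw [← wt_image_of_inj c hi]
    refine lt_of_le_of_ne (hM.2 _ (hU'.image _)) fun h3 => h2 ?_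
    have h4 := hmin _ (hU'.image _) (hle U') h3 fun h => h1 (hbot U' h)
    exact hi.image_injective (h4.trans htop.symm)

lemma SS.exists_stable_hom {c : I → ℚ} {M : QRep I k} (hM : M.SS c) (hne : M.Nonzero) :
    ∃ (W : ∀ i, Submodule k (M.V i)) (hW : M.IsSub W), (M.sub W hW).Stable c := by
  obtain ⟨W, hW, -, h⟩ := hM.exists_stable_sub (isSub_top M) hM.1 hne
  exact ⟨W, hW, h⟩

/-- A subrepresentation on which finitely many homomorphisms to semistable representations are
jointly injective has nonpositive weight. -/
lemma wt_nonpos_of_jointly_injective {c : I → ℚ} {M N : QRep I k} (hN : N.SS c) {ι : Type*}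
    (s : Finset ι) (π : ι → Hom M N) {U : ∀ i, Submodule k (M.V i)} (hU : M.IsSub U)
    (h : ∀ i, ∀ v ∈ U i, (∀ a ∈ s, (π a).1 i v = 0) → v = 0) : wt c U ≤ 0 := by
  classical
  induction s using Finset.induction_on generalizing U with
  | empty =>
    have : U = ⊥ := funext fun i => (Submodule.eq_bot_iff _).2 fun v hv => h i v hv (by simp)
    rw [this, wt_bot]
  | insert a s ha ih =>
    -- The image under one homomorphism has nonpositive weight; on its kernel the remaining
    -- homomorphisms are still jointly injective.
    rw [← wt_image_add_inf_ker c (π a) U]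
    refine add_nonpos (hN.2 _ (hU.image _)) (ih (hU.inf (π a).isSub_ker) fun i v hv h' => ?_)
    refine h i v hv.1 fun b hb => ?_
    rcases Finset.mem_insert.1 hb with rfl | hb
    · exact hv.2
    · exact h' b hb

end Weight

end QRep

namespace QRep

/-! ### Counting homomorphisms over a finite field -/

section Count

variable {I : Type u} [Quiver.{v} I] {k : Type} [Field k] [Fintype I] [Finite k]

instance finite_space (M : QRep I k) (i : I) : Finite (M.V i) := Module.finite_of_finite k

instance finite_hom (M N : QRep I k) : Finite (Hom M N) := by
  have : ∀ i, Finite (M.V i →ₗ[k] N.V i) := fun i =>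
    Finite.of_injective (fun f : M.V i →ₗ[k] N.V i => (f : M.V i → N.V i)) DFunLike.coe_injective
  exact Subtype.finite

/-- The number of injective homomorphisms. -/
def numInj (M L : QRep I k) : ℕ := Nat.card {φ : Hom M L // φ.Inj}

/-- The number of homomorphisms. -/
def numHom (M L : QRep I k) : ℕ := Nat.card (Hom M L)

omit [Fintype I] [Finite k] in
lemma numHom_prod (P M N : QRep I k) : numHom P (M.prod N) = numHom P M * numHom P N := by
  rw [numHom, numHom, numHom, ← Nat.card_prod]
  refine Nat.card_congr ⟨fun φ => ((fst M N).comp φ, (snd M N).comp φ), fun p => lift p.1 p.2,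
    lift_comp_eq, fun p => Prod.ext (fst_comp_lift p.1 p.2) (snd_comp_lift p.1 p.2)⟩

omit [Fintype I] [Finite k] in
lemma numHom_zero (P : QRep I k) : numHom P (zero I k) = 1 := by
  rw [numHom, Nat.card_eq_one_iff_unique]
  exact ⟨⟨fun a b => Hom.ext' fun _ _ => rfl⟩, ⟨0⟩⟩

omit [Finite k] in
lemma Stable.numHom_eq_one {c : I → ℚ} {S T : QRep I k} (hS : S.Stable c) (hT : T.Stable c)
    (h : ¬ Iso S T) : numHom S T = 1 := by
  rw [numHom, Nat.card_eq_one_iff_unique]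
  have h0 : ∀ φ : Hom S T, φ = 0 := fun φ => by
    by_contra hφ
    exact h (hS.iso_of_ne_zero hT hφ)
  exact ⟨⟨fun a b => (h0 a).trans (h0 b).symm⟩, ⟨0⟩⟩

lemma numHom_gt_one {M N : QRep I k} {φ : Hom M N} (h : φ ≠ 0) : 1 < numHom M N := by
  rw [numHom, Finite.one_lt_card_iff_nontrivial]
  exact ⟨φ, 0, h⟩

lemma Stable.one_lt_numHom_self {c : I → ℚ} {S : QRep I k} (hS : S.Stable c) :
    1 < numHom S S := by
  refine numHom_gt_one (φ := Hom.id S) fun h => hS.1 ?_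
  rw [← (Hom.ker_eq_top_iff (Hom.id S)).2 h]
  exact (Hom.inj_iff _).1 fun _ => Function.injective_id

/-- Adding a stable summand multiplies the number of injective homomorphisms by the number of
homomorphisms from that summand that do not factor through the previous ones. -/
lemma Stable.numInj_prod {c : I → ℚ} {S M L : QRep I k} (hS : S.Stable c) (hM : M.SS c)
    (hL : L.SS c) :
    (numInj (S.prod M) L : ℚ) = (numInj M L : ℚ) * ((numHom S L : ℚ) - (numHom S M : ℚ)) := by
  classical
  have := Fintype.ofFinite {φ : Hom M L // φ.Inj}
  -- By stability of S, a pair (g, f) with f injective is injective on S ⊕ M exactly if the image of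
  -- g is not contained in that of f.
  have e : {φ : Hom (S.prod M) L // φ.Inj} ≃
      Σ f : {φ : Hom M L // φ.Inj}, {g : Hom S L // ¬ g.range ≤ f.1.range} :=
    { toFun := fun φ => ⟨⟨φ.1.comp (inr S M), φ.2.comp fun _ => LinearMap.inr_injective⟩,
        φ.1.comp (inl S M), fun h => hS.1 <| by
          have hz : ∀ (i : I) (s : S.V i), s = 0 := fun i s => by
            obtain ⟨m, hm⟩ := h i ⟨s, rfl⟩
            have := φ.2 i hm
            exact (congrArg Prod.fst this).symm
          exact funext fun i => (Submodule.eq_bot_iff _).2 fun s _ => hz i s⟩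
      invFun := fun p => ⟨coprod p.2.1 p.1.1, hS.coprod_inj hM hL p.1.2 p.2.2⟩
      left_inv := fun φ => Subtype.ext (coprod_comp_eq φ.1)
      right_inv := fun p => by
        obtain ⟨⟨f, hf⟩, ⟨g, hg⟩⟩ := p
        have h1 : (coprod g f).comp (inr S M) = f := coprod_comp_inr g f
        have h2 : (coprod g f).comp (inl S M) = g := coprod_comp_inl g f
        have key : ∀ (f' : Hom M L) (hf' : f'.Inj) (g' : Hom S L) (hg' : ¬ g'.range ≤ f'.range),
            f' = f → g' = g → (⟨⟨f', hf'⟩, ⟨g', hg'⟩⟩ : Σ f : {φ : Hom M L // φ.Inj},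
              {g : Hom S L // ¬ g.range ≤ f.1.range}) = ⟨⟨f, hf⟩, ⟨g, hg⟩⟩ := by
          rintro _ _ _ _ rfl rfl; rfl
        exact key _ _ _ _ h1 h2 }
  have hfib : ∀ f : {φ : Hom M L // φ.Inj},
      (Nat.card {g : Hom S L // ¬ g.range ≤ f.1.range} : ℚ) = numHom S L - numHom S M := by
    intro f
    -- The homomorphisms to be excluded are those that factor, uniquely, through f.
    have e2 : Hom S M ≃ {g : Hom S L // g.range ≤ f.1.range} :=
      Equiv.ofBijective (fun g => ⟨f.1.comp g, fun i => by
        rintro _ ⟨s, rfl⟩; exact ⟨g.1 i s, rfl⟩⟩) ⟨fun a b hab => Hom.ext' fun i v => by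
          have := congrArg (fun z => z.1.1 i v) hab
          exact f.2 i this, fun g => by
          obtain ⟨g', hg'⟩ := f.1.exists_factor f.2 g.1 g.2
          exact ⟨g', Subtype.ext hg'⟩⟩
    have h3 := Nat.card_congr (Equiv.sumCompl fun g : Hom S L => g.range ≤ f.1.range)
    rw [Nat.card_sum, ← Nat.card_congr e2] at h3
    rw [numHom, numHom, ← h3]
    push_cast
    ring
  rw [numInj, Nat.card_congr e, Nat.card_sigma, Nat.cast_sum, Finset.sum_congr rfl fun f _ => hfib f,
    Finset.sum_const, Finset.card_univ, nsmul_eq_mul, numInj, Nat.card_eq_fintype_card]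

omit [Fintype I] [Finite k] in
lemma numInj_zero (L : QRep I k) : numInj (zero I k) L = 1 := by
  rw [numInj, Nat.card_eq_one_iff_unique]
  refine ⟨⟨fun a b => Subtype.ext <| Hom.ext' fun i v => ?_⟩,
    ⟨⟨0, fun i a b _ => rfl⟩⟩⟩
  have : v = 0 := rfl
  rw [this, map_zero, map_zero]

/-- The direct sum of a list of representations. -/
def listSum {ι : Type*} (S : ι → QRep I k) : List ι → QRep I k
  | [] => zero I k
  | j :: l => (S j).prod (listSum S l)

omit [Finite k] in
lemma ss_listSum {c : I → ℚ} {ι : Type*} {S : ι → QRep I k} (hS : ∀ j, (S j).Stable c)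
    (l : List ι) : (listSum S l).SS c := by
  induction l with
  | nil => exact ss_zero c
  | cons j l ih => exact (hS j).ss.prod ih

-- By Schur's lemma only the copies of S j itself contribute.
omit [Finite k] in
lemma numHom_listSum {c : I → ℚ} {ι : Type*} [DecidableEq ι] {S : ι → QRep I k}
    (hS : ∀ j, (S j).Stable c) (hni : ∀ i j, Iso (S i) (S j) → i = j) (l : List ι) (j : ι) :
    numHom (S j) (listSum S l) = numHom (S j) (S j) ^ l.count j := by
  induction l with
  | nil => rw [listSum, numHom_zero, List.count_nil, pow_zero]
  | cons i l ih =>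
    rw [listSum, numHom_prod, ih, List.count_cons]
    by_cases h : i = j
    · subst h; simp [pow_succ, mul_comm]
    · rw [(hS j).numHom_eq_one (hS i) fun h' => h (hni j i h').symm]
      simp [h]

/-- Add the summands one at a time by `Stable.numInj_prod`. When i copies of S j are already
present, the homomorphisms from S j into the previous sum number #End(S j) ^ i. -/
lemma numInj_listSum {c : I → ℚ} {ι : Type*} [DecidableEq ι] [Fintype ι] {S : ι → QRep I k}
    (hS : ∀ j, (S j).Stable c) (hni : ∀ i j, Iso (S i) (S j) → i = j) {L : QRep I k}
    (hL : L.SS c) (l : List ι) :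
    (numInj (listSum S l) L : ℚ) =
      ∏ j, ∏ i ∈ Finset.range (l.count j),
        ((numHom (S j) L : ℚ) - (numHom (S j) (S j) : ℚ) ^ i) := by
  induction l with
  | nil => simp [listSum, numInj_zero]
  | cons a l ih =>
    rw [listSum, (hS a).numInj_prod (ss_listSum hS l) hL, ih, numHom_listSum hS hni,
      ← Finset.mul_prod_erase _ _ (Finset.mem_univ a),
      ← Finset.mul_prod_erase (a := a) _ _ (Finset.mem_univ a), List.count_cons_self,
      Finset.prod_range_succ]
    have : ∏ j ∈ Finset.univ.erase a, ∏ i ∈ Finset.range ((a :: l).count j),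
        ((numHom (S j) L : ℚ) - (numHom (S j) (S j) : ℚ) ^ i) =
        ∏ j ∈ Finset.univ.erase a, ∏ i ∈ Finset.range (l.count j),
        ((numHom (S j) L : ℚ) - (numHom (S j) (S j) : ℚ) ^ i) := by
      refine Finset.prod_congr rfl fun j hj => ?_
      rw [List.count_cons_of_ne (Finset.ne_of_mem_erase hj).symm]
    rw [this]
    push_cast
    ring

omit [Finite k] in
lemma length_le_size_listSum {ι : Type*} {S : ι → QRep I k} (hS : ∀ j, (S j).Nonzero)
    (l : List ι) : l.length ≤ size (⊤ : ∀ i, Submodule k ((listSum S l).V i)) := by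
  induction l with
  | nil => exact Nat.zero_le _
  | cons j l ih =>
    have h1 : size (⊤ : ∀ i, Submodule k ((listSum S (j :: l)).V i)) =
        size (⊤ : ∀ i, Submodule k ((S j).V i)) +
          size (⊤ : ∀ i, Submodule k ((listSum S l).V i)) := by
      simp only [size, Pi.top_apply, finrank_top, ← Finset.sum_add_distrib]
      exact Finset.sum_congr rfl fun i _ => Module.finrank_prod
    have h2 := size_lt_of_lt (bot_lt_iff_ne_bot.2 (hS j))
    rw [h1, List.length_cons]
    omega

omit [Finite k] in
lemma Hom.Inj.size_le {M L : QRep I k} {φ : Hom M L} (h : φ.Inj) :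
    size (⊤ : ∀ i, Submodule k (M.V i)) ≤ size (⊤ : ∀ i, Submodule k (L.V i)) := by
  simp only [size, Pi.top_apply, finrank_top]
  exact Finset.sum_le_sum fun i _ => LinearMap.finrank_le_finrank_of_injective (h i)

/-- The number of homomorphisms from a stable representation is a power of the number of its
endomorphisms. -/
lemma Stable.exists_numHom_eq_pow {c : I → ℚ} {S L : QRep I k} (hS : S.Stable c) (hL : L.SS c)
    {N : ℕ} (hN : size (⊤ : ∀ i, Submodule k (L.V i)) ≤ N) :
    ∃ i ≤ N, (numHom S L : ℚ) = (numHom S S : ℚ) ^ i := by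
  -- For reasons of dimension N + 1 copies of S do not embed into L, so one of the factors of the
  -- product formula for these embeddings is zero.
  have h := numInj_listSum (ι := Unit) (S := fun _ => S) (fun _ => hS) (fun _ _ _ => rfl) hL
    (List.replicate (N + 1) ())
  have h0 : numInj (listSum (fun _ : Unit => S) (List.replicate (N + 1) ())) L = 0 := by
    rw [numInj, Nat.card_eq_zero]
    refine Or.inl ⟨fun φ => ?_⟩
    have h1 := φ.2.size_le
    have h2 := length_le_size_listSum (S := fun _ : Unit => S) (fun _ => hS.1)
      (List.replicate (N + 1) ())
    rw [List.length_replicate] at h2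
    omega
  rw [h0, Nat.cast_zero, Fintype.prod_unique, eq_comm, Finset.prod_eq_zero_iff] at h
  obtain ⟨i, hi, h⟩ := h
  rw [List.count_replicate_self, Finset.mem_range] at hi
  exact ⟨i, by omega, sub_eq_zero.1 h⟩

/-- The list in which each `j` occurs `n j` times. -/
def multList {ι : Type*} [Fintype ι] (n : ι → ℕ) : List ι :=
  Finset.univ.toList.flatMap fun j => List.replicate (n j) j

omit [Quiver.{v} I] [Field k] [Fintype I] [Finite k] in
lemma count_multList {ι : Type*} [Fintype ι] [DecidableEq ι] (n : ι → ℕ) (j : ι) :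
    (multList n).count j = n j := by
  rw [multList, List.count_flatMap]
  have : (List.map (List.count j ∘ fun j => List.replicate (n j) j) Finset.univ.toList).sum =
      ∑ i, (List.replicate (n i) i).count j := by
    rw [← Finset.sum_map_toList]
    rfl
  rw [this]
  simp only [List.count_replicate]
  simp

/-- The alternating count of injections of direct sums of stables into a semistable representation
with a stable subrepresentation vanishes. -/
lemma sum_qExpCoeff_mul_numInj_eq_zero {c : I → ℚ} {ι : Type*} [Fintype ι]
    [DecidableEq ι] {S : ι → QRep I k} (hS : ∀ j, (S j).Stable c)
    (hni : ∀ i j, Iso (S i) (S j) → i = j) {L : QRep I k} (hL : L.SS c) {N : ℕ}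
    (hN : size (⊤ : ∀ i, Submodule k (L.V i)) ≤ N) {j₀ : ι} {φ : Hom (S j₀) L} (hφ : φ ≠ 0) :
    ∑ n ∈ Fintype.piFinset fun _ : ι => Finset.range (N + 1),
      (∏ j, qExpCoeff (numHom (S j) (S j) : ℚ) (n j)) *
        (numInj (listSum S (multList n)) L : ℚ) = 0 := by
  have h1 : ∀ n : ι → ℕ, (∏ j, qExpCoeff (numHom (S j) (S j) : ℚ) (n j)) *
      (numInj (listSum S (multList n)) L : ℚ) = ∏ j, (qExpCoeff (numHom (S j) (S j) : ℚ) (n j) *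
        ∏ i ∈ Finset.range (n j), ((numHom (S j) L : ℚ) - (numHom (S j) (S j) : ℚ) ^ i)) := by
    intro n
    rw [numInj_listSum hS hni hL, ← Finset.prod_mul_distrib]
    simp only [count_multList]
  simp only [h1]
  -- The sum over multiplicities is a product of one sum for each j, so it is enough that the factor
  -- of `j₀` vanishes.
  rw [← Finset.prod_univ_sum (fun _ => Finset.range (N + 1)) (fun j a =>
    qExpCoeff (numHom (S j) (S j) : ℚ) a *
      ∏ i ∈ Finset.range a, ((numHom (S j) L : ℚ) - (numHom (S j) (S j) : ℚ) ^ i))]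
  refine Finset.prod_eq_zero (Finset.mem_univ j₀) ?_
  have hq : (1 : ℚ) < numHom (S j₀) (S j₀) := by exact_mod_cast (hS j₀).one_lt_numHom_self
  rw [sum_qExpCoeff_mul_prod fun n => (one_lt_pow₀ hq (Nat.succ_ne_zero n)).ne']
  obtain ⟨i, hi, h⟩ := (hS j₀).exists_numHom_eq_pow hL hN
  -- The nonzero φ excludes the exponent 0, so #Hom(S j₀, L) is one of the roots of the q-binomial
  -- product.
  have hi0 : i ≠ 0 := by
    rintro rfl
    have := numHom_gt_one hφ
    rw [pow_zero] at h
    have h : numHom (S j₀) L = 1 := by exact_mod_cast h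
    omega
  refine mul_eq_zero_of_right _ (Finset.prod_eq_zero (i := i - 1) ?_ ?_)
  · rw [Finset.mem_range]; omega
  · rw [h, Nat.sub_add_cancel (Nat.pos_of_ne_zero hi0), sub_self]

end Count

end QRep

namespace QRep

/-! ### Matrix representations -/

section OfRep

variable {I : Type u} [Quiver.{v} I] {k : Type} [Field k]

/-- The representation on coordinate spaces given by matrices. -/
abbrev ofRep {α : I → ℕ} (x : Rep k α) : QRep I k where
  V := fun i => Fin (α i) → k
  map := fun _ _ h => (x h).mulVecLin

lemma exists_iso_ofRep (M : QRep I k) {α : I → ℕ}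
    (h : ∀ i, Module.finrank k (M.V i) = α i) : ∃ x : Rep k α, Iso M (ofRep x) := by
  let e : ∀ i, M.V i ≃ₗ[k] (Fin (α i) → k) := fun i =>
    LinearEquiv.ofFinrankEq _ _ (by rw [h, Module.finrank_fin_fun])
  refine ⟨fun i j a => LinearMap.toMatrix' ((e j).toLinearMap ∘ₗ M.map a ∘ₗ (e i).symm.toLinearMap),
    ⟨fun i => (e i).toLinearMap, fun i j a v => ?_⟩, fun i => (e i).injective,
    fun i => (e i).surjective⟩
  change _ = (LinearMap.toMatrix' _).mulVec (e i v)
  rw [LinearMap.toMatrix'_mulVec]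
  simp

lemma smul_apply_rep {α : I → ℕ} (g : GLDim k α) (x : Rep k α) {i j : I} (h : i ⟶ j) :
    (g • x) h = (g j).val * x h * ((g i)⁻¹).val := rfl

lemma orbitRel_iff_iso {α : I → ℕ} (x y : Rep k α) :
    (MulAction.orbitRel (GLDim k α) (Rep k α)) x y ↔ Iso (ofRep x) (ofRep y) := by
  rw [MulAction.orbitRel_apply, MulAction.mem_orbit_iff]
  constructor
  · rintro ⟨g, hg⟩
    refine Iso.symm ⟨⟨fun i => (g i).val.mulVecLin, fun i j h v => ?_⟩, fun i => ?_, fun i => ?_⟩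
    · rw [← hg]
      change (g j).val.mulVec ((y h).mulVec v) = ((g • y) h).mulVec ((g i).val.mulVec v)
      rw [smul_apply_rep, Matrix.mulVec_mulVec, Matrix.mulVec_mulVec, Matrix.mul_assoc _ _ (g i).val,
        Units.inv_mul, Matrix.mul_one]
    · exact Matrix.mulVec_injective_of_isUnit (g i).isUnit
    · exact Matrix.mulVec_surjective_iff_isUnit.2 (g i).isUnit
  · intro hiso
    obtain ⟨φ, h1, h2⟩ := hiso.symm
    have e1 : ∀ i, φ.1 i ∘ₗ (φ.inv h1 h2).1 i = LinearMap.id := fun i =>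
      LinearMap.ext fun v => φ.apply_inv h1 h2 i v
    have e2 : ∀ i, (φ.inv h1 h2).1 i ∘ₗ φ.1 i = LinearMap.id := fun i =>
      LinearMap.ext fun v => φ.inv_apply h1 h2 i v
    refine ⟨fun i => ⟨LinearMap.toMatrix' (φ.1 i), LinearMap.toMatrix' ((φ.inv h1 h2).1 i),
      by rw [← LinearMap.toMatrix'_comp, e1, LinearMap.toMatrix'_id],
      by rw [← LinearMap.toMatrix'_comp, e2, LinearMap.toMatrix'_id]⟩, ?_⟩
    funext i j h
    change LinearMap.toMatrix' (φ.1 j) * y h * LinearMap.toMatrix' ((φ.inv h1 h2).1 i) = x h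
    apply Matrix.toLin'.injective
    refine LinearMap.ext fun v => ?_
    rw [Matrix.toLin'_mul, Matrix.toLin'_mul, Matrix.toLin'_toMatrix', Matrix.toLin'_toMatrix']
    simp only [LinearMap.comp_apply, Matrix.toLin'_apply]
    have := φ.comm h ((φ.inv h1 h2).1 i v)
    rw [φ.apply_inv] at this
    exact this

end OfRep

/-! ### Counting extensions -/

section Extensions

variable {I : Type u} [Quiver.{v} I] {k : Type} [Field k]

/-- The block upper triangular map with diagonal blocks `y` and `w`. -/
def blockMap {a b a' b' : ℕ} (y : Matrix (Fin a') (Fin a) k) (B : (Fin b → k) →ₗ[k] (Fin a' → k))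
    (w : Matrix (Fin b') (Fin b) k) :
    ((Fin a → k) × (Fin b → k)) →ₗ[k] ((Fin a' → k) × (Fin b' → k)) :=
  (y.mulVecLin.coprod B).prod (w.mulVecLin ∘ₗ LinearMap.snd k _ _)

lemma blockMap_apply {a b a' b' : ℕ} (y : Matrix (Fin a') (Fin a) k)
    (B : (Fin b → k) →ₗ[k] (Fin a' → k)) (w : Matrix (Fin b') (Fin b) k)
    (v : (Fin a → k) × (Fin b → k)) :
    blockMap y B w v = (y.mulVec v.1 + B v.2, w.mulVec v.2) := rfl

variable {α β γ : I → ℕ}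

/-- Families of identifications `k ^ γ i × k ^ β i ≃ k ^ α i`. -/
abbrev Splittings (k : Type) [Field k] (α β γ : I → ℕ) : Type u :=
  ∀ i, ((Fin (γ i) → k) × (Fin (β i) → k)) ≃ₗ[k] (Fin (α i) → k)

/-- The first component of a splitting is a homomorphism. -/
def Compatible (y : Rep k γ) (x : Rep k α) (Ψ : Splittings k α β γ) : Prop :=
  ∀ ⦃i j : I⦄ (h : i ⟶ j) (a : Fin (γ i) → k),
    Ψ j ((y h).mulVec a, 0) = (x h).mulVec (Ψ i (a, 0))

/-- The homomorphism given by a compatible splitting. -/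
def Compatible.hom {y : Rep k γ} {x : Rep k α} {Ψ : Splittings k α β γ} (h : Compatible y x Ψ) :
    Hom (ofRep y) (ofRep x) :=
  ⟨fun i => (Ψ i).toLinearMap ∘ₗ LinearMap.inl k _ _, fun _ _ e a => h e a⟩

lemma Compatible.hom_apply {y : Rep k γ} {x : Rep k α} {Ψ : Splittings k α β γ}
    (h : Compatible y x Ψ) (i : I) (a : Fin (γ i) → k) : h.hom.1 i a = Ψ i (a, 0) := rfl

lemma Compatible.hom_inj {y : Rep k γ} {x : Rep k α} {Ψ : Splittings k α β γ}
    (h : Compatible y x Ψ) : h.hom.Inj := fun i =>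
  (Ψ i).injective.comp (LinearMap.inl_injective (R := k))

/-- The block triangular representation, transported along a splitting. -/
def blockRep (y : Rep k γ) (Ψ : Splittings k α β γ)
    (B : ∀ ⦃i j : I⦄, (i ⟶ j) → ((Fin (β i) → k) →ₗ[k] (Fin (γ j) → k))) (w : Rep k β) : Rep k α :=
  fun i j h => LinearMap.toMatrix'
    ((Ψ j).toLinearMap ∘ₗ blockMap (y h) (B h) (w h) ∘ₗ (Ψ i).symm.toLinearMap)

lemma blockRep_mulVec (y : Rep k γ) (Ψ : Splittings k α β γ)
    (B : ∀ ⦃i j : I⦄, (i ⟶ j) → ((Fin (β i) → k) →ₗ[k] (Fin (γ j) → k))) (w : Rep k β)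
    {i j : I} (h : i ⟶ j) (v : (Fin (γ i) → k) × (Fin (β i) → k)) :
    (blockRep y Ψ B w h).mulVec (Ψ i v) = Ψ j ((y h).mulVec v.1 + B h v.2, (w h).mulVec v.2) := by
  rw [blockRep, LinearMap.toMatrix'_mulVec]
  simp [blockMap_apply]

lemma compatible_blockRep (y : Rep k γ) (Ψ : Splittings k α β γ)
    (B : ∀ ⦃i j : I⦄, (i ⟶ j) → ((Fin (β i) → k) →ₗ[k] (Fin (γ j) → k))) (w : Rep k β) :
    Compatible y (blockRep y Ψ B w) Ψ := fun i j h a => by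
  rw [blockRep_mulVec]; simp

/-- The quotient map of the block triangular representation. -/
def blockProj (y : Rep k γ) (Ψ : Splittings k α β γ)
    (B : ∀ ⦃i j : I⦄, (i ⟶ j) → ((Fin (β i) → k) →ₗ[k] (Fin (γ j) → k))) (w : Rep k β) :
    Hom (ofRep (blockRep y Ψ B w)) (ofRep w) :=
  ⟨fun i => LinearMap.snd k _ _ ∘ₗ (Ψ i).symm.toLinearMap, fun i j h v => by
    obtain ⟨v, rfl⟩ := (Ψ i).surjective v
    change ((Ψ j).symm ((blockRep y Ψ B w h).mulVec (Ψ i v))).2 =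
      (w h).mulVec ((Ψ i).symm (Ψ i v)).2
    rw [blockRep_mulVec, LinearEquiv.symm_apply_apply, LinearEquiv.symm_apply_apply]⟩

lemma exact_blockProj (y : Rep k γ) (Ψ : Splittings k α β γ)
    (B : ∀ ⦃i j : I⦄, (i ⟶ j) → ((Fin (β i) → k) →ₗ[k] (Fin (γ j) → k))) (w : Rep k β) :
    Exact (compatible_blockRep y Ψ B w).hom (blockProj y Ψ B w) := by
  refine ⟨Compatible.hom_inj _, fun i => Prod.snd_surjective.comp (Ψ i).symm.surjective,
    funext fun i => le_antisymm ?_ ?_⟩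
  · rintro _ ⟨a, rfl⟩
    change ((Ψ i).symm (Ψ i (a, 0))).2 = 0
    rw [LinearEquiv.symm_apply_apply]
  · intro v hv
    have hv : ((Ψ i).symm v).2 = 0 := hv
    refine ⟨((Ψ i).symm v).1, ?_⟩
    rw [Compatible.hom_apply, ← hv, Prod.mk.eta, LinearEquiv.apply_symm_apply]

/-- Compatible pairs of a representation and a splitting subject to a condition are parametrised by
block triangular data. -/
def blockEquiv (y : Rep k γ) (P : ∀ x : Rep k α, Hom (ofRep y) (ofRep x) → Prop)
    (Q : Rep k β → Prop)
    (hPQ : ∀ (x : Rep k α) (φ : Hom (ofRep y) (ofRep x)) (w : Rep k β)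
      (ψ : Hom (ofRep x) (ofRep w)), Exact φ ψ → (P x φ ↔ Q w)) :
    (Splittings k α β γ ×
        (∀ ⦃i j : I⦄, (i ⟶ j) → ((Fin (β i) → k) →ₗ[k] (Fin (γ j) → k))) × {w : Rep k β // Q w}) ≃
      {t : Rep k α × Splittings k α β γ // ∃ h : Compatible y t.1 t.2, P t.1 h.hom} :=
  Equiv.ofBijective (fun p => ⟨(blockRep y p.1 p.2.1 p.2.2.1, p.1), compatible_blockRep _ _ _ _,
      (hPQ _ _ _ _ (exact_blockProj y p.1 p.2.1 p.2.2.1)).2 p.2.2.2⟩) <| by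
    constructor
    · rintro ⟨Ψ, B, w, hw⟩ ⟨Ψ', B', w', hw'⟩ h
      have h2 : Ψ = Ψ' := congrArg (fun t => t.1.2) h
      subst h2
      have h1 : blockRep y Ψ B w = blockRep y Ψ B' w' := congrArg (fun t => t.1.1) h
      have h3 : ∀ ⦃i j : I⦄ (a : i ⟶ j) (v : Fin (β i) → k),
          B a v = B' a v ∧ (w a).mulVec v = (w' a).mulVec v := fun i j a v => by
        have h4 := blockRep_mulVec y Ψ B w a (0, v)
        rw [h1, blockRep_mulVec] at h4
        have h5 := (Ψ j).injective h4
        simp only [Matrix.mulVec_zero, zero_add, Prod.mk.injEq] at h5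
        exact ⟨h5.1.symm, h5.2.symm⟩
      have h4 : B = B' := by funext i j a; exact LinearMap.ext fun v => (h3 a v).1
      have h5 : w = w' := by
        funext i j a; exact Matrix.mulVec_injective (funext fun v => (h3 a v).2)
      subst h4; subst h5; rfl
    · rintro ⟨⟨x, Ψ⟩, hc, hP⟩
      -- In the coordinates of Ψ, the maps of x preserve the first summand and act there by y; the
      -- other two blocks are read off from the second summand.
      obtain ⟨B, w, hx⟩ : ∃ B w, blockRep y Ψ B w = x := by
        let B : ∀ ⦃i j : I⦄, (i ⟶ j) → ((Fin (β i) → k) →ₗ[k] (Fin (γ j) → k)) := fun i j h =>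
          LinearMap.fst k _ _ ∘ₗ (Ψ j).symm.toLinearMap ∘ₗ (x h).mulVecLin ∘ₗ (Ψ i).toLinearMap ∘ₗ
            LinearMap.inr k _ _
        let w : Rep k β := fun i j h => LinearMap.toMatrix'
          (LinearMap.snd k _ _ ∘ₗ (Ψ j).symm.toLinearMap ∘ₗ (x h).mulVecLin ∘ₗ (Ψ i).toLinearMap ∘ₗ
            LinearMap.inr k _ _)
        refine ⟨B, w, ?_⟩
        funext i j h
        refine Matrix.mulVec_injective (funext fun v => ?_)
        obtain ⟨⟨a, b⟩, rfl⟩ := (Ψ i).surjective v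
        rw [blockRep_mulVec]
        apply (Ψ j).symm.injective
        have h1 : Ψ i (a, b) = Ψ i (a, 0) + Ψ i (0, b) := by rw [← map_add]; simp
        rw [LinearEquiv.symm_apply_apply, h1, Matrix.mulVec_add, map_add, ← hc h a,
          LinearEquiv.symm_apply_apply]
        simp only [w, LinearMap.toMatrix'_mulVec]
        refine Prod.ext rfl ?_
        simp
      subst hx
      exact ⟨(Ψ, B, ⟨w, (hPQ _ _ _ _ (exact_blockProj y Ψ B w)).1 hP⟩), rfl⟩

omit [Quiver.{v} I] in
/-- Every family of injective maps extends to a splitting. -/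
lemma exists_splitting (hα : ∀ i, α i = β i + γ i) (φ : ∀ i, (Fin (γ i) → k) →ₗ[k] (Fin (α i) → k))
    (hφ : ∀ i, Function.Injective (φ i)) :
    ∃ Ψ : Splittings k α β γ, ∀ i a, Ψ i (a, 0) = φ i a := by
  have h : ∀ i, ∃ Ψ : ((Fin (γ i) → k) × (Fin (β i) → k)) ≃ₗ[k] (Fin (α i) → k),
      ∀ a, Ψ (a, 0) = φ i a := fun i => by
    obtain ⟨W, hW⟩ := Submodule.exists_isCompl (LinearMap.range (φ i))
    have hd : Module.finrank k W = β i := by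
      have h1 := Submodule.finrank_add_eq_of_isCompl hW
      rw [LinearMap.finrank_range_of_inj (hφ i), Module.finrank_fin_fun, Module.finrank_fin_fun] at h1
      have := hα i
      omega
    let e : (Fin (β i) → k) ≃ₗ[k] W := LinearEquiv.ofFinrankEq _ _ (by
      rw [hd, Module.finrank_fin_fun])
    refine ⟨((LinearEquiv.ofInjective (φ i) (hφ i)).prodCongr e).trans
      (Submodule.prodEquivOfIsCompl _ _ hW), fun a => ?_⟩
    simp
  choose Ψ hΨ using h
  exact ⟨Ψ, hΨ⟩

/-- The unipotent-by-diagonal automorphism `(a, b) ↦ (a + B b, D b)`. -/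
def shear {a b : ℕ} (B : (Fin b → k) →ₗ[k] (Fin a → k)) (D : (Fin b → k) ≃ₗ[k] (Fin b → k)) :
    ((Fin a → k) × (Fin b → k)) ≃ₗ[k] ((Fin a → k) × (Fin b → k)) :=
  LinearEquiv.ofBijective ((LinearMap.id.coprod B).prod (D.toLinearMap ∘ₗ LinearMap.snd k _ _)) <| by
    constructor
    · rw [← LinearMap.ker_eq_bot, LinearMap.ker_eq_bot']
      rintro ⟨v, w⟩ h
      have h1 : v + B w = 0 := congrArg Prod.fst h
      have h2 : D w = 0 := congrArg Prod.snd h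
      have h3 : w = 0 := D.injective (by rw [h2, map_zero])
      rw [h3, map_zero, add_zero] at h1
      rw [h1, h3]; rfl
    · rintro ⟨v, w⟩
      refine ⟨(v - B (D.symm w), D.symm w), Prod.ext ?_ ?_⟩
      · change v - B (D.symm w) + B (D.symm w) = v
        simp
      · exact D.apply_symm_apply w

lemma shear_apply {a b : ℕ} (B : (Fin b → k) →ₗ[k] (Fin a → k))
    (D : (Fin b → k) ≃ₗ[k] (Fin b → k)) (v : (Fin a → k) × (Fin b → k)) :
    shear B D v = (v.1 + B v.2, D v.2) := rfl

/-- Fixing the first summand makes Θ block triangular with an identity block. The other diagonal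
block is injective because Θ is, hence invertible. -/
lemma exists_shear {a b : ℕ}
    (Θ : ((Fin a → k) × (Fin b → k)) ≃ₗ[k] ((Fin a → k) × (Fin b → k)))
    (h : ∀ v, Θ (v, 0) = (v, 0)) : ∃ B D, shear B D = Θ := by
  have hdec : ∀ v w, Θ (v, w) = (v + (Θ (0, w)).1, (Θ (0, w)).2) := fun v w => by
    have h1 : ((v, w) : (Fin a → k) × (Fin b → k)) = (v, 0) + (0, w) := by simp
    rw [h1, map_add, h]
    exact Prod.ext rfl (zero_add _)
  let D₀ : (Fin b → k) →ₗ[k] (Fin b → k) := LinearMap.snd k _ _ ∘ₗ Θ.toLinearMap ∘ₗ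
    LinearMap.inr k _ _
  have hD : Function.Injective D₀ := by
    rw [← LinearMap.ker_eq_bot, LinearMap.ker_eq_bot']
    intro w hw
    have hw : (Θ (0, w)).2 = 0 := hw
    have h1 : Θ (-(Θ (0, w)).1, w) = 0 := by
      rw [hdec, hw, neg_add_cancel]; rfl
    have h2 := (LinearEquiv.map_eq_zero_iff Θ).1 h1
    exact congrArg Prod.snd h2
  refine ⟨LinearMap.fst k _ _ ∘ₗ Θ.toLinearMap ∘ₗ LinearMap.inr k _ _,
    LinearEquiv.ofInjectiveEndo D₀ hD, LinearEquiv.ext fun ⟨v, w⟩ => ?_⟩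
  rw [shear_apply, hdec]
  rfl

/-- Compatible pairs of a representation and a splitting are parametrised by injective homomorphisms
together with shears. -/
lemma nonempty_splitting_equiv (hα : ∀ i, α i = β i + γ i) (y : Rep k γ)
    (P : ∀ x : Rep k α, Hom (ofRep y) (ofRep x) → Prop) :
    Nonempty (({p : Σ x : Rep k α, Hom (ofRep y) (ofRep x) // p.2.Inj ∧ P p.1 p.2} ×
        ∀ i, ((Fin (β i) → k) →ₗ[k] (Fin (γ i) → k)) × ((Fin (β i) → k) ≃ₗ[k] (Fin (β i) → k))) ≃
      {t : Rep k α × Splittings k α β γ // ∃ h : Compatible y t.1 t.2, P t.1 h.hom}) := by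
  have hex : ∀ p : {p : Σ x : Rep k α, Hom (ofRep y) (ofRep x) // p.2.Inj ∧ P p.1 p.2},
      ∃ Ψ : Splittings k α β γ, ∀ i a, Ψ i (a, 0) = p.1.2.1 i a := fun p =>
    exists_splitting hα p.1.2.1 p.2.1
  -- Fix one splitting that extends each embedding; every other such splitting differs from it by a
  -- unique shear.
  choose Ψ₀ hΨ₀ using hex
  have hval : ∀ (p : {p : Σ x : Rep k α, Hom (ofRep y) (ofRep x) // p.2.Inj ∧ P p.1 p.2})
      (s : ∀ i, ((Fin (β i) → k) →ₗ[k] (Fin (γ i) → k)) × ((Fin (β i) → k) ≃ₗ[k] (Fin (β i) → k)))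
      i a, ((fun i => (shear (s i).1 (s i).2).trans (Ψ₀ p i) :
      Splittings k α β γ) i) (a, 0) = p.1.2.1 i a := fun p s i a => by
    rw [LinearEquiv.trans_apply, shear_apply, map_zero, map_zero, add_zero, hΨ₀]
  have hcomp : ∀ (p : {p : Σ x : Rep k α, Hom (ofRep y) (ofRep x) // p.2.Inj ∧ P p.1 p.2})
      (s : ∀ i, ((Fin (β i) → k) →ₗ[k] (Fin (γ i) → k)) × ((Fin (β i) → k) ≃ₗ[k] (Fin (β i) → k))), Compatible y p.1.1
      (fun i => (shear (s i).1 (s i).2).trans (Ψ₀ p i) : Splittings k α β γ) := fun p s i j h a => by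
    rw [hval p s, hval p s]
    exact p.1.2.comm h a
  have hhom : ∀ p s, (hcomp p s).hom = p.1.2 := fun p s => Hom.ext' fun i a => hval p s i a
  refine ⟨Equiv.ofBijective (fun q => ⟨(q.1.1.1, fun i => (shear (q.2 i).1 (q.2 i).2).trans
    (Ψ₀ q.1 i)), hcomp q.1 q.2, by rw [hhom]; exact q.1.2.2⟩) ⟨?_, ?_⟩⟩
  · rintro ⟨p, s⟩ ⟨p', s'⟩ h
    have h1 : p.1.1 = p'.1.1 := congrArg (fun t => t.1.1) h
    have h2 : (fun i => (shear (s i).1 (s i).2).trans (Ψ₀ p i) : Splittings k α β γ) =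
      fun i => (shear (s' i).1 (s' i).2).trans (Ψ₀ p' i) := congrArg (fun t => t.1.2) h
    have hp : p = p' := by
      obtain ⟨⟨x, φ⟩, hpp⟩ := p
      obtain ⟨⟨x', φ'⟩, hpp'⟩ := p'
      have h1 : x = x' := h1
      subst h1
      have : φ = φ' := Hom.ext' fun i a => by
        rw [← hval ⟨⟨x, φ⟩, hpp⟩ s i a, ← hval ⟨⟨x, φ'⟩, hpp'⟩ s' i a, h2]
      subst this
      rfl
    subst hp
    have hs : s = s' := by
      funext i
      have h3 : shear (s i).1 (s i).2 = shear (s' i).1 (s' i).2 := LinearEquiv.ext fun v =>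
        (Ψ₀ p i).injective (LinearEquiv.congr_fun (congrFun h2 i) v)
      have h4 : ∀ v, (s i).1 v = (s' i).1 v ∧ (s i).2 v = (s' i).2 v := fun v => by
        have h5 := LinearEquiv.congr_fun h3 (0, v)
        simp only [shear_apply, zero_add, Prod.mk.injEq] at h5
        exact h5
      exact Prod.ext (LinearMap.ext fun v => (h4 v).1) (LinearEquiv.ext fun v => (h4 v).2)
    subst hs
    rfl
  · rintro ⟨⟨x, Ψ⟩, hc, hP⟩
    let p : {p : Σ x : Rep k α, Hom (ofRep y) (ofRep x) // p.2.Inj ∧ P p.1 p.2} :=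
      ⟨⟨x, hc.hom⟩, hc.hom_inj, hP⟩
    have h1 : ∀ i, ∃ s : ((Fin (β i) → k) →ₗ[k] (Fin (γ i) → k)) ×
        ((Fin (β i) → k) ≃ₗ[k] (Fin (β i) → k)),
        shear s.1 s.2 = (Ψ i).trans (Ψ₀ p i).symm := fun i => by
      obtain ⟨B, D, h⟩ := exists_shear ((Ψ i).trans (Ψ₀ p i).symm) fun v => by
        rw [LinearEquiv.trans_apply, LinearEquiv.symm_apply_eq, hΨ₀]
        rfl
      exact ⟨(B, D), h⟩
    choose s hs using h1
    refine ⟨(p, s), Subtype.ext (Prod.ext rfl (funext fun i => ?_))⟩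
    change (shear (s i).1 (s i).2).trans (Ψ₀ p i) = Ψ i
    rw [hs]
    ext v
    simp

end Extensions

end QRep

namespace QRep

/-! ### Numbers of extensions over a finite field -/

section ExtensionCount

variable {I : Type u} [Quiver.{v} I] {k : Type} [Field k]

omit [Quiver.{v} I] in
lemma card_linearEquiv_eq_card_GL {V W : Type} [AddCommGroup V] [Module k V] [AddCommGroup W]
    [Module k W] [Module.Finite k V] [Module.Finite k W] {n : ℕ}
    (hV : Module.finrank k V = n) (hW : Module.finrank k W = n) :
    Nat.card (V ≃ₗ[k] W) = Nat.card (GL (Fin n) k) := by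
  have e1 : V ≃ₗ[k] (Fin n → k) := LinearEquiv.ofFinrankEq _ _ (by rw [hV, Module.finrank_fin_fun])
  have e2 : W ≃ₗ[k] (Fin n → k) := LinearEquiv.ofFinrankEq _ _ (by rw [hW, Module.finrank_fin_fun])
  have e3 : (V ≃ₗ[k] W) ≃ ((Fin n → k) ≃ₗ[k] (Fin n → k)) :=
    { toFun := fun f => (e1.symm.trans f).trans e2
      invFun := fun f => (e1.trans f).trans e2.symm
      left_inv := fun f => by ext; simp
      right_inv := fun f => by ext; simp }
  rw [Nat.card_congr e3]
  exact Nat.card_congr ((LinearMap.GeneralLinearGroup.generalLinearEquiv k (Fin n → k)).symm.trans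
    Matrix.GeneralLinearGroup.toLin.symm).toEquiv

variable [Fintype I]

omit [Quiver.{v} I] in
lemma card_splittings {α β γ : I → ℕ} (hα : ∀ i, α i = β i + γ i) :
    Nat.card (Splittings k α β γ) = Nat.card (GLDim k α) := by
  rw [Nat.card_pi, Nat.card_pi]
  refine Finset.prod_congr rfl fun i _ => card_linearEquiv_eq_card_GL ?_ ?_
  · rw [Module.finrank_prod, Module.finrank_fin_fun, Module.finrank_fin_fun, hα, add_comm]
  · rw [Module.finrank_fin_fun]

omit [Fintype I] [Quiver.{v} I] in
lemma card_linearMap (a b : ℕ) :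
    Nat.card ((Fin a → k) →ₗ[k] (Fin b → k)) = Nat.card k ^ (a * b) := by
  rw [Module.natCard_eq_pow_finrank (K := k), Module.finrank_linearMap, Module.finrank_fin_fun,
    Module.finrank_fin_fun]

omit [Quiver.{v} I] in
lemma card_shears (β γ : I → ℕ) :
    Nat.card (∀ i, ((Fin (β i) → k) →ₗ[k] (Fin (γ i) → k)) ×
      ((Fin (β i) → k) ≃ₗ[k] (Fin (β i) → k))) =
      Nat.card k ^ (∑ i, β i * γ i) * Nat.card (GLDim k β) := by
  rw [Nat.card_pi, Nat.card_pi, ← Finset.prod_pow_eq_pow_sum, ← Finset.prod_mul_distrib]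
  refine Finset.prod_congr rfl fun i _ => ?_
  rw [Nat.card_prod, card_linearMap, card_linearEquiv_eq_card_GL (n := β i)] <;>
  rw [Module.finrank_fin_fun]

variable [∀ i j : I, Fintype (i ⟶ j)]

lemma card_blocks (β γ : I → ℕ) :
    Nat.card (∀ ⦃i j : I⦄, (i ⟶ j) → ((Fin (β i) → k) →ₗ[k] (Fin (γ j) → k))) =
      Nat.card k ^ (∑ i, ∑ j, ∑ _h : i ⟶ j, β i * γ j) := by
  have h : Nat.card (∀ i j : I, (i ⟶ j) → ((Fin (β i) → k) →ₗ[k] (Fin (γ j) → k))) =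
      Nat.card k ^ (∑ i, ∑ j, ∑ _h : i ⟶ j, β i * γ j) := by
    rw [Nat.card_pi, ← Finset.prod_pow_eq_pow_sum]
    refine Finset.prod_congr rfl fun i _ => ?_
    rw [Nat.card_pi, ← Finset.prod_pow_eq_pow_sum]
    refine Finset.prod_congr rfl fun j _ => ?_
    rw [Nat.card_pi, ← Finset.prod_pow_eq_pow_sum]
    exact Finset.prod_congr rfl fun h _ => card_linearMap _ _
  exact h

lemma _root_.QuiverCount.card_rep (α : I → ℕ) :
    Nat.card (Rep k α) = Nat.card k ^ (∑ i, ∑ j, ∑ _h : i ⟶ j, α i * α j) := by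
  rw [← card_blocks]
  exact Nat.card_congr ⟨fun x _ _ h => Matrix.toLin' (x h), fun f _ _ h => LinearMap.toMatrix' (f h),
    fun x => by funext i j h; exact LinearMap.toMatrix'_toLin' _,
    fun f => by funext i j h; exact Matrix.toLin'_toMatrix' _⟩

variable [Finite k]

instance _root_.QuiverCount.finite_rep (α : I → ℕ) : Finite (Rep k α) :=
  Nat.finite_of_card_ne_zero (by
    rw [card_rep]
    exact pow_ne_zero _ Nat.card_pos.ne')

omit [Quiver.{v} I] [∀ i j : I, Fintype (i ⟶ j)] in
lemma _root_.QuiverCount.card_GLDim_ne_zero (α : I → ℕ) : (Nat.card (GLDim k α) : ℚ) ≠ 0 := by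
  have : Finite (GLDim k α) := Pi.finite
  exact Nat.cast_ne_zero.2 Nat.card_pos.ne'

/-- The number of representations of dimension vector `α` with an embedding of `y` and a cokernel
of a given kind. -/
lemma card_embeddings [DecidableEq I] {α β γ : I → ℕ} (hα : ∀ i, α i = β i + γ i) (y : Rep k γ)
    (P : ∀ x : Rep k α, Hom (ofRep y) (ofRep x) → Prop) (Q : Rep k β → Prop)
    (hPQ : ∀ (x : Rep k α) (φ : Hom (ofRep y) (ofRep x)) (w : Rep k β)
      (ψ : Hom (ofRep x) (ofRep w)), Exact φ ψ → (P x φ ↔ Q w)) :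
    (Nat.card {p : Σ x : Rep k α, Hom (ofRep y) (ofRep x) // p.2.Inj ∧ P p.1 p.2} : ℚ) /
        Nat.card (GLDim k α) =
      (Nat.card k : ℚ) ^ (-ringelForm (fun i => (β i : ℤ)) (fun i => (γ i : ℤ))) *
        ((Nat.card {w : Rep k β // Q w} : ℚ) / Nat.card (GLDim k β)) := by
  -- Compatible splittings are counted in two ways: as embeddings with a shear, and as block
  -- triangular data. The off-diagonal blocks of the arrows divided by those of the shears give the
  -- power of #k whose exponent is minus the Ringel form.
  obtain ⟨e⟩ := nonempty_splitting_equiv hα y P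
  have h := Nat.card_congr (e.trans (blockEquiv y P Q hPQ).symm)
  rw [Nat.card_prod, Nat.card_prod, Nat.card_prod, card_splittings hα, card_shears,
    card_blocks] at h
  have hq : (Nat.card k : ℚ) ≠ 0 := Nat.cast_ne_zero.2 Nat.card_pos.ne'
  have hr : (Nat.card k : ℚ) ^ (-ringelForm (fun i => (β i : ℤ)) (fun i => (γ i : ℤ))) =
      (Nat.card k : ℚ) ^ (∑ i, ∑ j, ∑ _h : i ⟶ j, β i * γ j) /
        (Nat.card k : ℚ) ^ (∑ i, β i * γ i) := by
    rw [← zpow_natCast, ← zpow_natCast, ← zpow_sub₀ hq]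
    congr 1
    rw [ringelForm]
    push_cast
    ring
  rw [hr]
  have h1 := card_GLDim_ne_zero (k := k) α
  have h2 := card_GLDim_ne_zero (k := k) β
  have h3 := pow_ne_zero (∑ i, β i * γ i) hq
  have h' : (Nat.card {p : Σ x : Rep k α, Hom (ofRep y) (ofRep x) // p.2.Inj ∧ P p.1 p.2} : ℚ) *
      ((Nat.card k : ℚ) ^ (∑ i, β i * γ i) * Nat.card (GLDim k β)) =
      Nat.card (GLDim k α) * ((Nat.card k : ℚ) ^ (∑ i, ∑ j, ∑ _h : i ⟶ j, β i * γ j) *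
        Nat.card {w : Rep k β // Q w}) := by exact_mod_cast h
  field_simp
  linear_combination h'

end ExtensionCount

end QRep

/-! ### Products of series supported on rays -/

section Truncation

variable {σ : Type*} {R : Type*} [CommRing R]

/-- Two series agree in all degrees `≤ N`. -/
def AgreeTo (N : ℕ) (f g : MvPowerSeries σ R) : Prop :=
  ∀ γ : σ →₀ ℕ, γ.degree ≤ N → MvPowerSeries.coeff γ f = MvPowerSeries.coeff γ g

lemma AgreeTo.mul {N : ℕ} {f g f' g' : MvPowerSeries σ R} (h : AgreeTo N f g)
    (h' : AgreeTo N f' g') : AgreeTo N (f * f') (g * g') := fun γ hγ => by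
  classical
  rw [MvPowerSeries.coeff_mul, MvPowerSeries.coeff_mul]
  refine Finset.sum_congr rfl fun p hp => ?_
  rw [Finset.HasAntidiagonal.mem_antidiagonal] at hp
  rw [← hp, map_add] at hγ
  rw [h p.1 (by omega), h' p.2 (by omega)]

lemma AgreeTo.prod {N : ℕ} {ι : Type*} (s : Finset ι) {f g : ι → MvPowerSeries σ R}
    (h : ∀ i ∈ s, AgreeTo N (f i) (g i)) : AgreeTo N (∏ i ∈ s, f i) (∏ i ∈ s, g i) := by
  classical
  induction s using Finset.induction_on with
  | empty => exact fun _ _ => rfl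
  | insert a s ha ih =>
    rw [Finset.prod_insert ha, Finset.prod_insert ha]
    exact (h a (Finset.mem_insert_self a s)).mul (ih fun i hi => h i (Finset.mem_insert_of_mem hi))

lemma prod_monomial {ι : Type*} (s : Finset ι) (δ : ι → σ →₀ ℕ) (u : ι → R) :
    ∏ i ∈ s, MvPowerSeries.monomial (δ i) (u i) =
      MvPowerSeries.monomial (∑ i ∈ s, δ i) (∏ i ∈ s, u i) := by
  classical
  induction s using Finset.induction_on with
  | empty => simp [MvPowerSeries.monomial_zero_one]
  | insert a s ha ih =>
    rw [Finset.prod_insert ha, Finset.prod_insert ha, Finset.sum_insert ha, ih,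
      MvPowerSeries.monomial_mul_monomial]

/-- In degrees up to N, each factor may be replaced by its terms of index at most N, and the finite
product then expands. -/
lemma coeff_prod_ray [DecidableEq σ] {ι : Type*} [Fintype ι] [DecidableEq ι] {δ : ι → σ →₀ ℕ}
    (hδ : ∀ i, δ i ≠ 0) (u : ι → PowerSeries R) {N : ℕ} (γ : σ →₀ ℕ) (hγ : γ.degree ≤ N) :
    MvPowerSeries.coeff γ (∏ i, ray (δ i) (u i)) =
      ∑ n ∈ Fintype.piFinset fun _ : ι => Finset.range (N + 1),
        if ∑ i, n i • δ i = γ then ∏ i, PowerSeries.coeff (n i) (u i) else 0 := by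
  have h1 : AgreeTo N (∏ i, ray (δ i) (u i)) (∏ i, ∑ n ∈ Finset.range (N + 1),
      MvPowerSeries.monomial (n • δ i) (PowerSeries.coeff n (u i))) := by
    refine AgreeTo.prod _ fun i _ β hβ => ?_
    rw [coeff_ray (hδ i) (u i) β (N + 1) (by omega), map_sum]
    refine Finset.sum_congr rfl fun n _ => ?_
    rw [MvPowerSeries.coeff_monomial]
    by_cases h : n • δ i = β
    · rw [if_pos h, if_pos h.symm]
    · rw [if_neg h, if_neg (Ne.symm h)]
  rw [h1 γ hγ, Finset.prod_univ_sum, map_sum]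
  refine Finset.sum_congr rfl fun n _ => ?_
  rw [prod_monomial, MvPowerSeries.coeff_monomial]
  by_cases h : ∑ i, n i • δ i = γ
  · rw [if_pos h, if_pos h.symm]
  · rw [if_neg h, if_neg (Ne.symm h)]

end Truncation

namespace QRep

/-! ### The inverse of the generating function of semistable representations -/

section Inverse

variable {I : Type u} [Quiver.{v} I] {k : Type} [Field k] [Fintype I]

/-- The dimension vector of a representation. -/
def dimv (M : QRep I k) : I →₀ ℕ :=
  Finsupp.equivFunOnFinite.symm fun i => Module.finrank k (M.V i)

lemma dimv_apply (M : QRep I k) (i : I) : M.dimv i = Module.finrank k (M.V i) := rfl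

lemma degree_dimv (M : QRep I k) :
    M.dimv.degree = size (⊤ : ∀ i, Submodule k (M.V i)) := by
  rw [Finsupp.degree_eq_sum]
  simp only [size, Pi.top_apply, finrank_top, dimv_apply]

lemma Nonzero.dimv_ne_zero {M : QRep I k} (h : M.Nonzero) : M.dimv ≠ 0 := fun h0 => by
  have h1 := size_lt_of_lt (bot_lt_iff_ne_bot.2 h)
  rw [← degree_dimv, h0, map_zero] at h1
  omega

lemma nonzero_of_dimv_ne_zero {M : QRep I k} (h : M.dimv ≠ 0) : M.Nonzero := fun h0 => h <| by
  ext i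
  rw [dimv_apply, ← finrank_top k (M.V i)]
  have : (⊤ : Submodule k (M.V i)) = ⊥ := congrFun h0 i
  rw [this, finrank_bot]
  rfl

lemma Iso.dimv_eq {M N : QRep I k} (h : Iso M N) : M.dimv = N.dimv := by
  obtain ⟨φ, h1, h2⟩ := h
  ext i
  exact (LinearEquiv.ofBijective (φ.1 i) ⟨h1 i, h2 i⟩).finrank_eq

lemma dimv_ofRep (α : I →₀ ℕ) (x : Rep k α) : (ofRep x).dimv = α := by
  ext i
  rw [dimv_apply, Module.finrank_fin_fun]

lemma dimv_listSum {ι : Type*} [Fintype ι] [DecidableEq ι] (S : ι → QRep I k) (l : List ι) :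
    (listSum S l).dimv = ∑ j, l.count j • (S j).dimv := by
  induction l with
  | nil =>
    simp only [List.count_nil, zero_smul, Finset.sum_const_zero]
    ext i
    exact Module.finrank_zero_of_subsingleton (M := PUnit)
  | cons a l ih =>
    have h1 : (listSum S (a :: l)).dimv = (S a).dimv + (listSum S l).dimv := by
      ext i
      exact Module.finrank_prod
    rw [h1, ih]
    simp only [List.count_cons, add_smul, Finset.sum_add_distrib]
    rw [add_comm]
    simp

lemma dimv_multList {ι : Type*} [Fintype ι] [DecidableEq ι] (S : ι → QRep I k) (n : ι → ℕ) :
    (listSum S (multList n)).dimv = ∑ j, n j • (S j).dimv := by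
  rw [dimv_listSum]
  simp only [count_multList]

omit [Fintype I] in
lemma numInj_congr {M M' L : QRep I k} (h : Iso M M') : numInj M L = numInj M' L := by
  obtain ⟨φ, h1, h2⟩ := h
  refine Nat.card_congr ⟨fun f => ⟨f.1.comp (φ.inv h1 h2), f.2.comp (φ.inv_inj h1 h2)⟩,
    fun f => ⟨f.1.comp φ, f.2.comp h1⟩, fun f => ?_, fun f => ?_⟩
  · exact Subtype.ext (Hom.ext' fun i v => by simp)
  · exact Subtype.ext (Hom.ext' fun i v => by simp)

/-- The number of matrix representations that are semistable for the weight `c`. -/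
def numSS (c : I → ℚ) (k : Type) [Field k] (α : I → ℕ) : ℕ :=
  Nat.card {x : Rep k α // (ofRep x).SS c}

variable [Finite k] [∀ i j : I, Fintype (i ⟶ j)]

/-- Since M is semistable, an extension by M is semistable exactly if the quotient is, which is the
condition that `card_embeddings` needs. -/
lemma sum_numInj_div [DecidableEq I] {c : I → ℚ} {M : QRep I k} (hM : M.SS c) (β : I →₀ ℕ)
    [Fintype {x : Rep k (β + M.dimv : I →₀ ℕ) // (ofRep x).SS c}] :
    (∑ x : {x : Rep k (β + M.dimv : I →₀ ℕ) // (ofRep x).SS c}, (numInj M (ofRep x.1) : ℚ)) /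
        Nat.card (GLDim k (β + M.dimv : I →₀ ℕ)) =
      (Nat.card k : ℚ) ^ (-ringelForm (fun i => (β i : ℤ)) (fun i => (M.dimv i : ℤ))) *
        ((numSS c k β : ℚ) / Nat.card (GLDim k β)) := by
  obtain ⟨y, hy⟩ := M.exists_iso_ofRep (α := M.dimv) fun i => rfl
  rw [numSS, ← card_embeddings (α := (β + M.dimv : I →₀ ℕ)) (fun i => rfl) y
    (fun x _ => (ofRep x).SS c) (fun w => (ofRep w).SS c)
    (fun x φ w ψ h => h.ss_iff (hy.ss hM))]
  congr 1
  rw [← Nat.cast_sum]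
  congr 1
  have h1 : ∀ x : {x : Rep k (β + M.dimv : I →₀ ℕ) // (ofRep x).SS c},
      numInj M (ofRep x.1) = Nat.card {φ : Hom (ofRep y) (ofRep x.1) // φ.Inj} := fun x =>
    numInj_congr hy
  rw [Finset.sum_congr rfl fun x _ => h1 x, ← Nat.card_sigma]
  exact Nat.card_congr ⟨fun p => ⟨⟨p.1.1, p.2.1⟩, p.2.2, p.1.2⟩,
    fun p => ⟨⟨p.1.1, p.2.2⟩, ⟨p.1.2, p.2.1⟩⟩, fun _ => rfl, fun _ => rfl⟩

/-- The generating function of the direct sums of the given stable representations. -/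
def stableSeries {ι : Type*} [Fintype ι] (S : ι → QRep I k) : MvPowerSeries I ℚ :=
  ∏ j, qExpSeries (numHom (S j) (S j) : ℚ) 1 (S j).dimv

/-- The generating function of semistable representations is inverse to that of direct sums of
stable representations, in the twisted algebra. -/
theorem twisted_inverse [DecidableEq I] {c : I → ℚ} {ι : Type*} [Fintype ι] {S : ι → QRep I k}
    (hS : ∀ j, (S j).Stable c) (hni : ∀ i j, Iso (S i) (S j) → i = j) {N : ℕ}
    (hcomplete : ∀ T : QRep I k, T.Stable c → T.dimv.degree ≤ N → ∃ j, Iso (S j) T)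
    (α : I →₀ ℕ) (hα : α ≠ 0) (hαN : α.degree ≤ N) :
    ∑ p ∈ Finset.HasAntidiagonal.antidiagonal α,
      (Nat.card k : ℚ) ^ (-ringelForm (fun i => (p.1 i : ℤ)) (fun i => (p.2 i : ℤ))) *
        ((numSS c k p.1 : ℚ) / Nat.card (GLDim k p.1) *
          MvPowerSeries.coeff p.2 (stableSeries S)) = 0 := by
  classical
  have := Fintype.ofFinite {x : Rep k α // (ofRep x).SS c}
  -- A nonzero semistable x contains a stable subrepresentation, which is isomorphic to some S j by
  -- completeness, so the alternating sum of embeddings vanishes.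
  have h1 : ∀ x : {x : Rep k α // (ofRep x).SS c},
      ∑ n ∈ Fintype.piFinset fun _ : ι => Finset.range (N + 1),
      (∏ j, qExpCoeff (numHom (S j) (S j) : ℚ) (n j)) *
        (numInj (listSum S (multList n)) (ofRep x.1) : ℚ) = 0 := by
    rintro ⟨x, hx⟩
    have hx0 : (ofRep x).Nonzero := nonzero_of_dimv_ne_zero (by rwa [dimv_ofRep])
    have hsz : size (⊤ : ∀ i, Submodule k ((ofRep x).V i)) ≤ N := by
      rwa [← degree_dimv, dimv_ofRep]
    obtain ⟨W, hW, hst⟩ := hx.exists_stable_hom hx0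
    obtain ⟨j, φ, hφ, -⟩ := hcomplete _ hst (by
      rw [degree_dimv]
      exact ((ofRep x).incl_inj W hW).size_le.trans hsz)
    refine sum_qExpCoeff_mul_numInj_eq_zero hS hni hx hsz (j₀ := j)
      (φ := ((ofRep x).incl W hW).comp φ) fun h0 => (hS j).1 ?_
    have hinj := ((ofRep x).incl_inj W hW).comp hφ
    rw [← (Hom.ker_eq_top_iff _).2 h0]
    exact (Hom.inj_iff _).1 hinj
  -- The vanishing is summed over all semistable points of dimension vector α; it remains to see
  -- that this sum is the twisted convolution.
  have h2 : ∑ n ∈ Fintype.piFinset fun _ : ι => Finset.range (N + 1),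
      (∏ j, qExpCoeff (numHom (S j) (S j) : ℚ) (n j)) *
        ((∑ x : {x : Rep k α // (ofRep x).SS c},
          (numInj (listSum S (multList n)) (ofRep x.1) : ℚ)) / Nat.card (GLDim k α)) = 0 := by
    simp only [← mul_div_assoc, ← Finset.sum_div, Finset.mul_sum]
    rw [Finset.sum_comm, Finset.sum_congr rfl fun x _ => h1 x, Finset.sum_const_zero, zero_div]
  rw [← h2]
  -- Multiplicities n contribute to the term whose second component is the dimension vector of the
  -- corresponding direct sum, and the first component is that of the cokernel.
  have h3 : ∀ p ∈ Finset.HasAntidiagonal.antidiagonal α,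
      (Nat.card k : ℚ) ^ (-ringelForm (fun i => (p.1 i : ℤ)) (fun i => (p.2 i : ℤ))) *
        ((numSS c k p.1 : ℚ) / Nat.card (GLDim k p.1) *
          MvPowerSeries.coeff p.2 (stableSeries S)) =
      ∑ n ∈ Fintype.piFinset fun _ : ι => Finset.range (N + 1),
        if ∑ i, n i • (S i).dimv = p.2 then
          (∏ j, qExpCoeff (numHom (S j) (S j) : ℚ) (n j)) *
        ((∑ x : {x : Rep k α // (ofRep x).SS c},
          (numInj (listSum S (multList n)) (ofRep x.1) : ℚ)) / Nat.card (GLDim k α)) else 0 := by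
    intro p hp
    have hp' := degree_fst_le_of_mem_antidiagonal (Finset.HasAntidiagonal.swap_mem_antidiagonal.2 hp)
    rw [Finset.HasAntidiagonal.mem_antidiagonal] at hp
    rw [stableSeries]
    simp only [qExpSeries]
    rw [coeff_prod_ray (fun j => (hS j).1.dimv_ne_zero) _ (N := N) p.2 (hp'.trans hαN),
      Finset.mul_sum, Finset.mul_sum]
    refine Finset.sum_congr rfl fun n _ => ?_
    split_ifs with hn
    · subst hp
      rw [← dimv_multList] at hn
      obtain ⟨β, γ⟩ := p
      dsimp only at *
      subst hn
      rw [sum_numInj_div (ss_listSum hS _)]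
      simp only [PowerSeries.coeff_mk, one_pow, mul_one]
      ring
    · simp
  rw [Finset.sum_congr rfl h3, Finset.sum_comm]
  refine Finset.sum_congr rfl fun n _ => ?_
  by_cases hle : ∑ i, n i • (S i).dimv ≤ α
  · rw [Finset.sum_eq_single (α - ∑ i, n i • (S i).dimv, ∑ i, n i • (S i).dimv)]
    · rw [if_pos rfl]
    · rintro ⟨β, γ⟩ hp hne
      rw [if_neg]
      rintro rfl
      refine hne (Prod.ext ?_ rfl)
      rw [Finset.HasAntidiagonal.mem_antidiagonal] at hp
      rw [← hp]
      simp
    · intro h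
      refine absurd ?_ h
      rw [Finset.HasAntidiagonal.mem_antidiagonal]
      exact tsub_add_cancel_of_le hle
  · rw [Finset.sum_eq_zero]
    -- If the dimension vector of the direct sum is not at most α, there are no embeddings, and no
    -- term of the convolution corresponds to it.
    · have h4 : ∀ x : {x : Rep k α // (ofRep x).SS c},
          numInj (listSum S (multList n)) (ofRep x.1) = 0 := fun x => by
        rw [numInj, Nat.card_eq_zero]
        refine Or.inl ⟨fun φ => hle fun i => ?_⟩
        rw [← dimv_multList, ← dimv_ofRep α x.1]
        exact LinearMap.finrank_le_finrank_of_injective (φ.2 i)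
      simp [h4]
    · rintro ⟨β, γ⟩ hp
      rw [if_neg]
      rintro rfl
      rw [Finset.HasAntidiagonal.mem_antidiagonal] at hp
      exact hle (by rw [← hp]; exact le_add_self)

end Inverse

end QRep

/-! ### Rational functions without poles at the integers `≥ 2` -/

section Rational

/-- The value of a rational function at an integer. -/
def evAt (n : ℕ) (f : RatFunc ℚ) : ℚ := f.eval (RingHom.id ℚ) (n : ℚ)

lemma evAt_eq (n : ℕ) (f : RatFunc ℚ) : evAt n f = f.num.eval (n : ℚ) / f.denom.eval (n : ℚ) := rfl

lemma evAt_algebraMap (n : ℕ) (p : ℚ[X]) :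
    evAt n (algebraMap ℚ[X] (RatFunc ℚ) p) = p.eval (n : ℚ) := by
  rw [evAt, RatFunc.eval_algebraMap]
  rfl

lemma evAt_zero (n : ℕ) : evAt n 0 = 0 := RatFunc.eval_zero _ _
lemma evAt_one (n : ℕ) : evAt n 1 = 1 := RatFunc.eval_one _ _
lemma evAt_X (n : ℕ) : evAt n RatFunc.X = n := RatFunc.eval_X _ _

/-- Rational functions without poles at the integers `≥ 2`. -/
def regular : Subring (RatFunc ℚ) where
  carrier := {f | ∀ n : ℕ, 2 ≤ n → f.denom.eval (n : ℚ) ≠ 0}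
  mul_mem' := fun {a b} ha hb n hn h => by
    have := Polynomial.eval_eq_zero_of_dvd_of_eval_eq_zero (RatFunc.denom_mul_dvd a b) h
    rw [eval_mul] at this
    exact mul_ne_zero (ha n hn) (hb n hn) this
  one_mem' := fun n _ => by simp
  add_mem' := fun {a b} ha hb n hn h => by
    have := Polynomial.eval_eq_zero_of_dvd_of_eval_eq_zero (RatFunc.denom_add_dvd a b) h
    rw [eval_mul] at this
    exact mul_ne_zero (ha n hn) (hb n hn) this
  zero_mem' := fun n _ => by simp
  neg_mem' := fun {a} ha n hn h => ha n hn <| by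
    have h1 : (-a).denom ∣ a.denom := by
      have h2 := RatFunc.denom_mul_dvd (-1 : RatFunc ℚ) a
      have h3 : (-1 : RatFunc ℚ).denom = 1 := by
        have : (-1 : RatFunc ℚ) = RatFunc.C (-1) := by simp
        rw [this, RatFunc.denom_C]
      rwa [h3, one_mul, neg_one_mul] at h2
    have h4 : a.denom ∣ (-a).denom := by
      have h2 := RatFunc.denom_mul_dvd (-1 : RatFunc ℚ) (-a)
      have h3 : (-1 : RatFunc ℚ).denom = 1 := by
        have : (-1 : RatFunc ℚ) = RatFunc.C (-1) := by simp
        rw [this, RatFunc.denom_C]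
      rwa [h3, one_mul, neg_one_mul, neg_neg] at h2
    exact Polynomial.eval_eq_zero_of_dvd_of_eval_eq_zero h1 h

/-- Evaluation at an integer `≥ 2` as a ring homomorphism. -/
def evHom (n : ℕ) (hn : 2 ≤ n) : regular →+* ℚ where
  toFun := fun f => evAt n f.1
  map_one' := (evAt_one _)
  map_zero' := (evAt_zero _)
  map_mul' := fun f g => RatFunc.eval_mul _ _ (f.2 n hn) (g.2 n hn)
  map_add' := fun f g => RatFunc.eval_add _ _ (f.2 n hn) (g.2 n hn)

lemma evAt_add {n : ℕ} (hn : 2 ≤ n) {f g : RatFunc ℚ} (hf : f ∈ regular) (hg : g ∈ regular) :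
    evAt n (f + g) = evAt n f + evAt n g := map_add (evHom n hn) ⟨f, hf⟩ ⟨g, hg⟩

lemma evAt_mul {n : ℕ} (hn : 2 ≤ n) {f g : RatFunc ℚ} (hf : f ∈ regular) (hg : g ∈ regular) :
    evAt n (f * g) = evAt n f * evAt n g := map_mul (evHom n hn) ⟨f, hf⟩ ⟨g, hg⟩

lemma evAt_neg {n : ℕ} (hn : 2 ≤ n) {f : RatFunc ℚ} (hf : f ∈ regular) :
    evAt n (-f) = -evAt n f := map_neg (evHom n hn) ⟨f, hf⟩

lemma evAt_sub {n : ℕ} (hn : 2 ≤ n) {f g : RatFunc ℚ} (hf : f ∈ regular) (hg : g ∈ regular) :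
    evAt n (f - g) = evAt n f - evAt n g := map_sub (evHom n hn) ⟨f, hf⟩ ⟨g, hg⟩

lemma evAt_sum {n : ℕ} (hn : 2 ≤ n) {ι : Type*} (s : Finset ι) {f : ι → RatFunc ℚ}
    (hf : ∀ i ∈ s, f i ∈ regular) : evAt n (∑ i ∈ s, f i) = ∑ i ∈ s, evAt n (f i) := by
  classical
  induction s using Finset.induction_on with
  | empty => exact (evAt_zero _)
  | insert a s ha ih =>
    rw [Finset.sum_insert ha, Finset.sum_insert ha,
      evAt_add hn (hf a (Finset.mem_insert_self a s))
        (regular.sum_mem fun i hi => hf i (Finset.mem_insert_of_mem hi)),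
      ih fun i hi => hf i (Finset.mem_insert_of_mem hi)]

/-- The reduced denominator divides every denominator, so a fraction need not be in lowest terms to
be tested. -/
lemma regular_of_mul_eq {f : RatFunc ℚ} {p q : ℚ[X]} (hq : ∀ n : ℕ, 2 ≤ n → q.eval (n : ℚ) ≠ 0)
    (h : f * algebraMap ℚ[X] (RatFunc ℚ) q = algebraMap ℚ[X] (RatFunc ℚ) p) : f ∈ regular := by
  intro n hn h0
  have hq0 : q ≠ 0 := by rintro rfl; exact hq 2 le_rfl (by simp)
  have hq1 : algebraMap ℚ[X] (RatFunc ℚ) q ≠ 0 := RatFunc.algebraMap_ne_zero hq0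
  rw [eq_div_of_mul_eq hq1 h] at h0
  exact hq n hn (Polynomial.eval_eq_zero_of_dvd_of_eval_eq_zero (RatFunc.denom_div_dvd p q) h0)

lemma algebraMap_mem_regular (p : ℚ[X]) : algebraMap ℚ[X] (RatFunc ℚ) p ∈ regular :=
  regular_of_mul_eq (p := p) (q := 1) (fun _ _ => by simp) (by rw [map_one, mul_one])

lemma C_mem_regular (a : ℚ) : RatFunc.C a ∈ regular := by
  rw [← RatFunc.algebraMap_C]; exact algebraMap_mem_regular _

lemma evAt_C (n : ℕ) (a : ℚ) : evAt n (RatFunc.C a) = a := by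
  rw [← RatFunc.algebraMap_C, evAt_algebraMap, eval_C]

lemma inv_mem_regular {f : RatFunc ℚ} (hf : f ∈ regular) (h : ∀ n : ℕ, 2 ≤ n → evAt n f ≠ 0) :
    f⁻¹ ∈ regular := by
  have h1 : ∀ n : ℕ, 2 ≤ n → f.num.eval (n : ℚ) ≠ 0 := fun n hn h0 => h n hn (by
    rw [evAt_eq, h0, zero_div])
  have h2 : f ≠ 0 := by rintro rfl; exact h 2 le_rfl (evAt_zero _)
  refine regular_of_mul_eq (p := f.denom) h1 ?_
  have h3 := RatFunc.num_div_denom f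
  have h4 : algebraMap ℚ[X] (RatFunc ℚ) f.denom ≠ 0 := RatFunc.algebraMap_ne_zero f.denom_ne_zero
  rw [div_eq_iff h4] at h3
  rw [h3, inv_mul_cancel_left₀ h2]

lemma evAt_inv {n : ℕ} (hn : 2 ≤ n) {f : RatFunc ℚ} (hf : f ∈ regular)
    (h : ∀ n : ℕ, 2 ≤ n → evAt n f ≠ 0) : evAt n f⁻¹ = (evAt n f)⁻¹ := by
  have h2 : f ≠ 0 := by rintro rfl; exact h 2 le_rfl (evAt_zero _)
  refine eq_inv_of_mul_eq_one_left ?_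
  rw [← evAt_mul hn (inv_mem_regular hf h) hf, inv_mul_cancel₀ h2]
  exact (evAt_one _)

/-- A rational function is determined by its values at the primes. -/
lemma eq_of_evAt_eq {f g : RatFunc ℚ} (hf : ∀ p : ℕ, p.Prime → f.denom.eval (p : ℚ) ≠ 0)
    (hg : ∀ p : ℕ, p.Prime → g.denom.eval (p : ℚ) ≠ 0)
    (h : ∀ p : ℕ, p.Prime → evAt p f = evAt p g) : f = g := by
  have h0 : f.num * g.denom - g.num * f.denom = 0 := by
    refine Polynomial.eq_zero_of_infinite_isRoot _ ?_
    refine Set.Infinite.mono ?_ (Nat.infinite_setOfPred_prime.image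
      (Nat.cast_injective (R := ℚ)).injOn)
    rintro _ ⟨p, hp, rfl⟩
    have h1 := h p hp
    rw [evAt_eq, evAt_eq, div_eq_div_iff (hf p hp) (hg p hp)] at h1
    simp only [Set.mem_ofPred_eq, IsRoot.def, eval_sub, eval_mul]
    rw [h1, sub_self]
  have h3 : algebraMap ℚ[X] (RatFunc ℚ) f.denom ≠ 0 := RatFunc.algebraMap_ne_zero f.denom_ne_zero
  have h4 : algebraMap ℚ[X] (RatFunc ℚ) g.denom ≠ 0 := RatFunc.algebraMap_ne_zero g.denom_ne_zero
  rw [← RatFunc.num_div_denom f, ← RatFunc.num_div_denom g, div_eq_div_iff h3 h4, ← map_mul,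
    ← map_mul, sub_eq_zero.1 h0]

/-- An integral polynomial as a rational function. -/
def ofInt (P : ℤ[X]) : RatFunc ℚ := algebraMap ℚ[X] (RatFunc ℚ) (P.map (Int.castRingHom ℚ))

lemma ofInt_mul (P Q : ℤ[X]) : ofInt (P * Q) = ofInt P * ofInt Q := by simp [ofInt]
lemma ofInt_add (P Q : ℤ[X]) : ofInt (P + Q) = ofInt P + ofInt Q := by simp [ofInt]
lemma ofInt_neg (P : ℤ[X]) : ofInt (-P) = -ofInt P := by simp [ofInt]
lemma ofInt_one : ofInt 1 = 1 := by simp [ofInt]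
lemma ofInt_zero : ofInt 0 = 0 := by simp [ofInt]
lemma ofInt_X : ofInt X = RatFunc.X := by simp [ofInt]

lemma ofInt_injective : Function.Injective ofInt := fun _ _ h =>
  Polynomial.map_injective _ (RingHom.injective_int (Int.castRingHom ℚ))
    (RatFunc.algebraMap_injective ℚ h)

lemma evAt_ofInt (n : ℕ) (P : ℤ[X]) : evAt n (ofInt P) = ((P.eval (n : ℤ) : ℤ) : ℚ) := by
  rw [ofInt, evAt_algebraMap]
  have := Polynomial.eval_map_apply (Int.castRingHom ℚ) (p := P) (n : ℤ)
  simp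

/-- Rational functions with an integral numerator and a monic integral denominator without zeros at
the integers `≥ 2`. -/
def monicRegular : Subring (RatFunc ℚ) where
  carrier := {f | ∃ P Q : ℤ[X], Q.Monic ∧ (∀ n : ℕ, 2 ≤ n → Q.eval (n : ℤ) ≠ 0) ∧
    f * ofInt Q = ofInt P}
  mul_mem' := by
    rintro a b ⟨P, Q, hQ, h0, h⟩ ⟨P', Q', hQ', h0', h'⟩
    refine ⟨P * P', Q * Q', hQ.mul hQ', fun n hn => ?_, ?_⟩
    · rw [eval_mul]; exact mul_ne_zero (h0 n hn) (h0' n hn)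
    · rw [ofInt_mul, ofInt_mul, ← h, ← h']; ring
  one_mem' := ⟨1, 1, monic_one, fun _ _ => by simp, by rw [ofInt_one, one_mul]⟩
  add_mem' := by
    rintro a b ⟨P, Q, hQ, h0, h⟩ ⟨P', Q', hQ', h0', h'⟩
    refine ⟨P * Q' + P' * Q, Q * Q', hQ.mul hQ', fun n hn => ?_, ?_⟩
    · rw [eval_mul]; exact mul_ne_zero (h0 n hn) (h0' n hn)
    · rw [ofInt_mul, ofInt_add, ofInt_mul, ofInt_mul, ← h, ← h']; ring
  zero_mem' := ⟨0, 1, monic_one, fun _ _ => by simp, by rw [ofInt_zero, zero_mul]⟩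
  neg_mem' := by
    rintro a ⟨P, Q, hQ, h0, h⟩
    exact ⟨-P, Q, hQ, h0, by rw [ofInt_neg, ← h, neg_mul]⟩

lemma monicRegular_le_regular : monicRegular ≤ regular := by
  rintro f ⟨P, Q, -, h0, h⟩
  refine regular_of_mul_eq (q := Q.map (Int.castRingHom ℚ)) (fun n hn hz => h0 n hn ?_) h
  have h1 := evAt_ofInt n Q
  rw [ofInt, evAt_algebraMap, hz] at h1
  exact_mod_cast h1.symm

lemma ofInt_mem (P : ℤ[X]) : ofInt P ∈ monicRegular :=
  ⟨P, 1, monic_one, fun _ _ => by simp, by rw [ofInt_one, mul_one]⟩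

lemma ofInt_ne_zero {Q : ℤ[X]} (hQ : Q.Monic) : ofInt Q ≠ 0 := fun h =>
  hQ.ne_zero (ofInt_injective (h.trans ofInt_zero.symm))

lemma ofInt_inv_mem {Q : ℤ[X]} (hQ : Q.Monic) (h0 : ∀ n : ℕ, 2 ≤ n → Q.eval (n : ℤ) ≠ 0) :
    (ofInt Q)⁻¹ ∈ monicRegular :=
  ⟨1, Q, hQ, h0, by rw [ofInt_one, inv_mul_cancel₀ (ofInt_ne_zero hQ)]⟩

lemma X_mem : RatFunc.X ∈ monicRegular := ofInt_X ▸ ofInt_mem X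

lemma X_inv_mem : (RatFunc.X : RatFunc ℚ)⁻¹ ∈ monicRegular := by
  rw [← ofInt_X]
  refine ofInt_inv_mem monic_X fun n hn => ?_
  rw [eval_X]
  exact_mod_cast (by omega : n ≠ 0)

lemma X_zpow_mem (m : ℤ) : (RatFunc.X : RatFunc ℚ) ^ m ∈ monicRegular := by
  cases m with
  | ofNat m => rw [Int.ofNat_eq_natCast, zpow_natCast]; exact monicRegular.pow_mem X_mem m
  | negSucc m =>
    rw [zpow_negSucc, ← inv_pow]; exact monicRegular.pow_mem X_inv_mem (m + 1)

lemma evAt_pow {n : ℕ} (hn : 2 ≤ n) {f : RatFunc ℚ} (hf : f ∈ regular) (m : ℕ) :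
    evAt n (f ^ m) = evAt n f ^ m := map_pow (evHom n hn) ⟨f, hf⟩ m

lemma evAt_X_zpow {n : ℕ} (hn : 2 ≤ n) (m : ℤ) : evAt n (RatFunc.X ^ m) = (n : ℚ) ^ m := by
  have hX : (RatFunc.X : RatFunc ℚ) ∈ regular := monicRegular_le_regular X_mem
  have hX0 : ∀ n : ℕ, 2 ≤ n → evAt n RatFunc.X ≠ 0 := fun n hn => by
    rw [evAt_X]; exact_mod_cast (by omega : n ≠ 0)
  cases m with
  | ofNat m => rw [Int.ofNat_eq_natCast, zpow_natCast, zpow_natCast, evAt_pow hn hX, evAt_X]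
  | negSucc m =>
    rw [zpow_negSucc, zpow_negSucc, ← inv_pow, evAt_pow hn (inv_mem_regular hX hX0),
      evAt_inv hn hX hX0, evAt_X, inv_pow]

/-- A rational function with monic denominator that takes integral values at all primes is an
integral polynomial. -/
lemma exists_ofInt_of_integral_values {f : RatFunc ℚ} (hf : f ∈ monicRegular)
    (h : ∀ p : ℕ, p.Prime → ∃ z : ℤ, evAt p f = z) : ∃ P : ℤ[X], f = ofInt P := by
  have hfr := monicRegular_le_regular hf
  obtain ⟨P, Q, hQ, h0, hPQ⟩ := hf
  -- Monicity of Q permits division with remainder over ℤ; the aim is that the remainder is zero.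
  have hdeg : (P %ₘ Q).degree < Q.degree := degree_modByMonic_lt P hQ
  have hQR : (Q.map (Int.castRingHom ℝ)).degree = Q.degree :=
    degree_map_eq_of_injective (RingHom.injective_int _) Q
  have hRR : ((P %ₘ Q).map (Int.castRingHom ℝ)).degree = (P %ₘ Q).degree :=
    degree_map_eq_of_injective (RingHom.injective_int _) _
  have ht := Polynomial.div_tendsto_atTop_zero_of_degree_lt ((P %ₘ Q).map (Int.castRingHom ℝ))
    (Q.map (Int.castRingHom ℝ)) (by rw [hQR, hRR]; exact hdeg)
  have ht' := ht.comp tendsto_natCast_atTop_atTop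
  obtain ⟨N, hN⟩ := Filter.eventually_atTop.1 (ht'.eventually
    (Metric.ball_mem_nhds (0 : ℝ) one_pos))
  -- For a large prime p the remainder at p is smaller in absolute value than Q(p), yet divisible by
  -- Q(p) because P(p)/Q(p) is an integer; so it vanishes.
  have hroot : ∀ p : ℕ, p.Prime → N ≤ p → (P %ₘ Q).eval (p : ℤ) = 0 := by
    intro p hp hNp
    obtain ⟨z, hz⟩ := h p hp
    have h1 := congrArg (evAt p) hPQ
    rw [evAt_mul hp.two_le hfr (monicRegular_le_regular (ofInt_mem Q)), evAt_ofInt, evAt_ofInt,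
      hz] at h1
    have h2 : z * Q.eval (p : ℤ) = P.eval (p : ℤ) := by exact_mod_cast h1
    have h3 := congrArg (eval (p : ℤ)) (modByMonic_add_div P Q)
    rw [eval_add, eval_mul, ← h2] at h3
    have h4 := hN p hNp
    simp only [Function.comp_apply, dist_zero_right] at h4
    have hev : ∀ T : ℤ[X], (T.map (Int.castRingHom ℝ)).eval (p : ℝ) = ((T.eval (p : ℤ) : ℤ) : ℝ) :=
      fun T => by
        have := Polynomial.eval_map_apply (Int.castRingHom ℝ) (p := T) (p : ℤ)
        simp
    rw [hev, hev, norm_div] at h4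
    have hq0 : 0 < ‖((Q.eval (p : ℤ) : ℤ) : ℝ)‖ :=
      norm_pos_iff.2 (Int.cast_ne_zero.2 (h0 p hp.two_le))
    rw [div_lt_one hq0] at h4
    have h5 : |(P %ₘ Q).eval (p : ℤ)| < |Q.eval (p : ℤ)| := by
      rw [Real.norm_eq_abs, Real.norm_eq_abs] at h4
      exact_mod_cast h4
    have h6 : Q.eval (p : ℤ) ∣ (P %ₘ Q).eval (p : ℤ) :=
      ⟨z - (P /ₘ Q).eval (p : ℤ), by linear_combination h3⟩
    exact Int.eq_zero_of_abs_lt_dvd ((abs_dvd _ _).2 h6) h5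
  have hR : P %ₘ Q = 0 := by
    refine Polynomial.eq_zero_of_infinite_isRoot _ ?_
    refine Set.Infinite.mono ?_ ((Nat.infinite_setOfPred_prime.sdiff (Set.finite_lt_nat N)).image
      (Nat.cast_injective (R := ℤ)).injOn)
    rintro _ ⟨p, ⟨hp, hNp⟩, rfl⟩
    exact hroot p hp (not_lt.1 hNp)
  refine ⟨P /ₘ Q, ?_⟩
  have h1 := modByMonic_add_div P Q
  rw [hR, zero_add] at h1
  refine mul_right_cancel₀ (ofInt_ne_zero hQ) ?_
  rw [hPQ, ← ofInt_mul, mul_comm, h1]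

/-! ### The substitution `q ↦ q ^ n` -/

/-- The substitution `q ↦ q ^ n` in rational functions. -/
def psi (n : ℕ) (f : RatFunc ℚ) : RatFunc ℚ := f.eval (algebraMap ℚ (RatFunc ℚ)) (RatFunc.X ^ n)

/-- On polynomials the substitution is `expand`, which is injective for n ≠ 0; hence no denominator
becomes zero under `psi`. -/
lemma eval₂_X_pow (n : ℕ) (p : ℚ[X]) :
    p.eval₂ (algebraMap ℚ (RatFunc ℚ)) (RatFunc.X ^ n) =
      algebraMap ℚ[X] (RatFunc ℚ) (expand ℚ n p) := by
  induction p using Polynomial.induction_on' with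
  | add p q hp hq => rw [eval₂_add, hp, hq, map_add, map_add]
  | monomial m a =>
    rw [eval₂_monomial, expand_monomial, ← C_mul_X_pow_eq_monomial, map_mul, map_pow,
      RatFunc.algebraMap_X, RatFunc.algebraMap_C, ← pow_mul, mul_comm n m]
    exact congrArg (· * _) (RingHom.congr_fun (Subsingleton.elim _ _) a)

lemma eval₂_X_pow_ne_zero {n : ℕ} (hn : n ≠ 0) {p : ℚ[X]} (hp : p ≠ 0) :
    p.eval₂ (algebraMap ℚ (RatFunc ℚ)) (RatFunc.X ^ n) ≠ 0 := by
  rw [eval₂_X_pow]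
  exact RatFunc.algebraMap_ne_zero ((expand_ne_zero (Nat.pos_of_ne_zero hn)).2 hp)

lemma psi_eq (n : ℕ) (f : RatFunc ℚ) :
    psi n f = algebraMap ℚ[X] (RatFunc ℚ) (expand ℚ n f.num) /
      algebraMap ℚ[X] (RatFunc ℚ) (expand ℚ n f.denom) := by
  rw [← eval₂_X_pow, ← eval₂_X_pow]
  rfl

lemma psi_add {n : ℕ} (hn : n ≠ 0) (f g : RatFunc ℚ) : psi n (f + g) = psi n f + psi n g :=
  RatFunc.eval_add _ _ (eval₂_X_pow_ne_zero hn f.denom_ne_zero)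
    (eval₂_X_pow_ne_zero hn g.denom_ne_zero)

lemma psi_mul {n : ℕ} (hn : n ≠ 0) (f g : RatFunc ℚ) : psi n (f * g) = psi n f * psi n g :=
  RatFunc.eval_mul _ _ (eval₂_X_pow_ne_zero hn f.denom_ne_zero)
    (eval₂_X_pow_ne_zero hn g.denom_ne_zero)

lemma psi_zero (n : ℕ) : psi n 0 = 0 := RatFunc.eval_zero _ _
lemma psi_one (n : ℕ) : psi n 1 = 1 := RatFunc.eval_one _ _
lemma psi_X (n : ℕ) : psi n RatFunc.X = RatFunc.X ^ n := RatFunc.eval_X _ _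

lemma psi_neg {n : ℕ} (hn : n ≠ 0) (f : RatFunc ℚ) : psi n (-f) = -psi n f := by
  refine eq_neg_of_add_eq_zero_left ?_
  rw [← psi_add hn, neg_add_cancel, psi_zero]

lemma psi_pow {n : ℕ} (hn : n ≠ 0) (f : RatFunc ℚ) (m : ℕ) : psi n (f ^ m) = psi n f ^ m := by
  induction m with
  | zero => rw [pow_zero, pow_zero, psi_one]
  | succ m ih => rw [pow_succ, pow_succ, psi_mul hn, ih]

lemma psi_inv {n : ℕ} (hn : n ≠ 0) (f : RatFunc ℚ) : psi n f⁻¹ = (psi n f)⁻¹ := by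
  by_cases hf : f = 0
  · rw [hf, inv_zero, psi_zero, inv_zero]
  · refine eq_inv_of_mul_eq_one_left ?_
    rw [← psi_mul hn, inv_mul_cancel₀ hf, psi_one]

lemma expand_eval_natCast (n m : ℕ) (p : ℚ[X]) :
    (expand ℚ n p).eval (m : ℚ) = p.eval ((m ^ n : ℕ) : ℚ) := by
  rw [expand_eval, Nat.cast_pow]

lemma two_le_pow {n m : ℕ} (hn : n ≠ 0) (hm : 2 ≤ m) : 2 ≤ m ^ n :=
  hm.trans (Nat.le_self_pow hn m)

lemma psi_mem_regular {n : ℕ} (hn : n ≠ 0) {f : RatFunc ℚ} (hf : f ∈ regular) :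
    psi n f ∈ regular := by
  refine regular_of_mul_eq (p := expand ℚ n f.num) (q := expand ℚ n f.denom) (fun m hm => ?_) ?_
  · rw [expand_eval_natCast]
    exact hf _ (two_le_pow hn hm)
  · rw [psi_eq, div_mul_cancel₀]
    exact RatFunc.algebraMap_ne_zero
      ((expand_ne_zero (Nat.pos_of_ne_zero hn)).2 f.denom_ne_zero)

/-- This is how Adams operations enter: the value of `psi n f` at #k is the value of f at the
cardinality of the extension of degree n. -/
lemma evAt_psi {n m : ℕ} (hn : n ≠ 0) (hm : 2 ≤ m) {f : RatFunc ℚ} (hf : f ∈ regular) :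
    evAt m (psi n f) = evAt (m ^ n) f := by
  have h0 : algebraMap ℚ[X] (RatFunc ℚ) (expand ℚ n f.denom) ≠ 0 :=
    RatFunc.algebraMap_ne_zero ((expand_ne_zero (Nat.pos_of_ne_zero hn)).2 f.denom_ne_zero)
  have h1 : psi n f * algebraMap ℚ[X] (RatFunc ℚ) (expand ℚ n f.denom) =
      algebraMap ℚ[X] (RatFunc ℚ) (expand ℚ n f.num) := by
    rw [psi_eq, div_mul_cancel₀ _ h0]
  have h2 := congrArg (evAt m) h1
  rw [evAt_mul hm (psi_mem_regular hn hf) (algebraMap_mem_regular _), evAt_algebraMap,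
    evAt_algebraMap, expand_eval_natCast, expand_eval_natCast] at h2
  rw [evAt_eq (m ^ n), eq_div_iff (hf _ (two_le_pow hn hm)), h2]

/-! ### Counting functions given by rational functions -/

/-- A function of finite fields given by a rational function of the cardinality, with integral
numerator and monic denominator. -/
def IsCount (F : ∀ (k : Type) [Field k] [Finite k], ℚ) : Prop :=
  ∃ f ∈ monicRegular, ∀ (k : Type) [Field k] [Finite k], evAt (Nat.card k) f = F k

lemma two_le_card (k : Type) [Field k] [Finite k] : 2 ≤ Nat.card k := Finite.one_lt_card

lemma IsCount.mul {F G : ∀ (k : Type) [Field k] [Finite k], ℚ} (hF : IsCount F) (hG : IsCount G) :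
    IsCount fun k _ _ => F k * G k := by
  obtain ⟨f, hf, h⟩ := hF
  obtain ⟨g, hg, h'⟩ := hG
  refine ⟨f * g, monicRegular.mul_mem hf hg, fun k _ _ => ?_⟩
  rw [evAt_mul (two_le_card k) (monicRegular_le_regular hf) (monicRegular_le_regular hg), h, h']

lemma IsCount.add {F G : ∀ (k : Type) [Field k] [Finite k], ℚ} (hF : IsCount F) (hG : IsCount G) :
    IsCount fun k _ _ => F k + G k := by
  obtain ⟨f, hf, h⟩ := hF
  obtain ⟨g, hg, h'⟩ := hG
  refine ⟨f + g, monicRegular.add_mem hf hg, fun k _ _ => ?_⟩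
  rw [evAt_add (two_le_card k) (monicRegular_le_regular hf) (monicRegular_le_regular hg), h, h']

lemma IsCount.neg {F : ∀ (k : Type) [Field k] [Finite k], ℚ} (hF : IsCount F) :
    IsCount fun k _ _ => -F k := by
  obtain ⟨f, hf, h⟩ := hF
  exact ⟨-f, monicRegular.neg_mem hf, fun k _ _ => by
    rw [evAt_neg (two_le_card k) (monicRegular_le_regular hf), h]⟩

lemma IsCount.sub {F G : ∀ (k : Type) [Field k] [Finite k], ℚ} (hF : IsCount F) (hG : IsCount G) :
    IsCount fun k _ _ => F k - G k := by
  simp only [sub_eq_add_neg]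
  exact hF.add hG.neg

lemma isCount_zero : IsCount fun _ _ _ => 0 :=
  ⟨0, monicRegular.zero_mem, fun _ _ _ => (evAt_zero _)⟩

lemma isCount_one : IsCount fun _ _ _ => 1 :=
  ⟨1, monicRegular.one_mem, fun _ _ _ => (evAt_one _)⟩

lemma IsCount.sum {ι : Type*} (s : Finset ι) {F : ι → ∀ (k : Type) [Field k] [Finite k], ℚ}
    (h : ∀ i ∈ s, IsCount (F i)) : IsCount fun k _ _ => ∑ i ∈ s, F i k := by
  classical
  induction s using Finset.induction_on with
  | empty => simpa using isCount_zero
  | insert a s ha ih =>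
    simp only [Finset.sum_insert ha]
    exact (h a (Finset.mem_insert_self a s)).add (ih fun i hi => h i (Finset.mem_insert_of_mem hi))

lemma IsCount.prod {ι : Type*} (s : Finset ι) {F : ι → ∀ (k : Type) [Field k] [Finite k], ℚ}
    (h : ∀ i ∈ s, IsCount (F i)) : IsCount fun k _ _ => ∏ i ∈ s, F i k := by
  classical
  induction s using Finset.induction_on with
  | empty => simpa using isCount_one
  | insert a s ha ih =>
    simp only [Finset.prod_insert ha]
    exact (h a (Finset.mem_insert_self a s)).mul (ih fun i hi => h i (Finset.mem_insert_of_mem hi))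

lemma isCount_zpow (m : ℤ) : IsCount fun k _ _ => (Nat.card k : ℚ) ^ m :=
  ⟨RatFunc.X ^ m, X_zpow_mem m, fun k _ _ => evAt_X_zpow (two_le_card k) m⟩

/-- The order of GL_n is ∏_{i<n} (q^n - q^i), a monic integral polynomial in q without zeros at
integers q ≥ 2. -/
lemma isCount_inv_card_GL (n : ℕ) : IsCount fun k _ _ => ((Nat.card (GL (Fin n) k) : ℚ))⁻¹ := by
  let Q : ℤ[X] := ∏ i : Fin n, (X ^ n - X ^ (i : ℕ))
  have hQ : Q.Monic := by
    refine monic_prod_of_monic _ _ fun i _ => ?_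
    refine monic_X_pow_sub ?_
    rw [degree_X_pow]
    exact_mod_cast i.2
  have hev : ∀ m : ℕ, (Q.eval (m : ℤ)) = ∏ i : Fin n, ((m : ℤ) ^ n - (m : ℤ) ^ (i : ℕ)) := fun m => by
    simp [Q, eval_prod]
  have h0 : ∀ m : ℕ, 2 ≤ m → Q.eval (m : ℤ) ≠ 0 := fun m hm => by
    rw [hev, Finset.prod_ne_zero_iff]
    intro i _
    refine sub_ne_zero.2 (ne_of_gt ?_)
    exact_mod_cast Nat.pow_lt_pow_right (by omega) i.2
  refine ⟨(ofInt Q)⁻¹, ofInt_inv_mem hQ h0, fun k _ _ => ?_⟩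
  have := Fintype.ofFinite k
  rw [evAt_inv (two_le_card k) (monicRegular_le_regular (ofInt_mem Q)), evAt_ofInt, hev]
  · congr 1
    rw [Matrix.card_GL_field, Fintype.card_eq_nat_card]
    push_cast
    refine Finset.prod_congr rfl fun i _ => ?_
    rw [Nat.cast_sub (Nat.pow_le_pow_right Nat.card_pos i.2.le)]
    push_cast
    rfl
  · intro m hm
    rw [evAt_ofInt]
    exact_mod_cast h0 m hm

end Rational

namespace QRep

/-! ### The maximal destabilizing subrepresentation -/

section HarderNarasimhan

variable {I : Type u} [Quiver.{v} I] {k : Type} [Field k] [Fintype I]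

/-- The weight that vanishes exactly on the dimension vectors of slope `μ`. -/
def cw (θ : I → ℤ) (μ : ℚ) : I → ℚ := fun i => (θ i : ℚ) - μ

omit [Quiver.{v} I] in
lemma sum_cw (θ : I → ℤ) (μ : ℚ) (a : I → ℕ) :
    ∑ i, cw θ μ i * a i = ((∑ i, θ i * (a i : ℤ) : ℤ) : ℚ) - μ * ((∑ i, a i : ℕ) : ℚ) := by
  push_cast
  rw [Finset.mul_sum, ← Finset.sum_sub_distrib]
  exact Finset.sum_congr rfl fun i _ => by rw [cw]; ring

lemma wt_cw {M : QRep I k} (θ : I → ℤ) (μ : ℚ) (U : ∀ i, Submodule k (M.V i)) :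
    wt (cw θ μ) U =
      ((∑ i, θ i * (Module.finrank k (U i) : ℤ) : ℤ) : ℚ) - μ * (size U : ℚ) :=
  sum_cw θ μ fun i => Module.finrank k (U i)

omit [Quiver.{v} I] in
lemma sum_cw_eq_zero_iff (θ : I → ℤ) (μ : ℚ) (a : I → ℕ) (ha : ∑ i, a i ≠ 0) :
    ∑ i, cw θ μ i * a i = 0 ↔ slope θ a = μ := by
  rw [sum_cw, slope, div_eq_iff (Nat.cast_ne_zero.2 ha), sub_eq_zero]

lemma size_pos {M : QRep I k} {U : ∀ i, Submodule k (M.V i)} (h : U ≠ ⊥) : 0 < size U :=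
  (Nat.zero_le _).trans_lt (size_lt_of_lt (bot_lt_iff_ne_bot.2 h))

/-- Changing the reference slope changes the weight by a multiple of the total dimension, so
comparisons of slopes become linear inequalities between weights. -/
lemma wt_cw_shift {M : QRep I k} (θ : I → ℤ) (μ μ' : ℚ) (U : ∀ i, Submodule k (M.V i)) :
    wt (cw θ μ) U = wt (cw θ μ') U - (μ - μ') * (size U : ℚ) := by
  rw [wt_cw, wt_cw]; ring

/-- `U` is the largest subrepresentation of maximal slope, and `μ` is its slope. -/
structure IsMaxDestab (M : QRep I k) (θ : I → ℤ) (μ : ℚ) (U : ∀ i, Submodule k (M.V i)) : Prop where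
  isSub : M.IsSub U
  ne_bot : U ≠ ⊥
  wt_eq : wt (cw θ μ) U = 0
  wt_le : ∀ W, M.IsSub W → wt (cw θ μ) W ≤ 0
  le : ∀ W, M.IsSub W → wt (cw θ μ) W = 0 → W ≤ U

/-- Only finitely many slopes occur, so there is a maximal one μ. By modularity of the weight, sums
of subrepresentations of slope μ have slope μ again, so one of largest total dimension contains all
others. -/
lemma exists_isMaxDestab {M : QRep I k} (hM : M.Nonzero) (θ : I → ℤ) :
    ∃ μ U, M.IsMaxDestab θ μ U := by
  classical
  let sl : (∀ i, Submodule k (M.V i)) → ℚ := fun U => slope θ fun i => Module.finrank k (U i)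
  have hfin : (Set.range fun U : {U : ∀ i, Submodule k (M.V i) // M.IsSub U ∧ U ≠ ⊥} =>
      sl U.1).Finite := by
    have h1 : (Set.range fun f : ∀ i, Fin (Module.finrank k (M.V i) + 1) =>
      slope θ fun i => (f i : ℕ)).Finite := Set.finite_range _
    refine h1.subset ?_
    rintro _ ⟨U, rfl⟩
    exact ⟨fun i => ⟨_, Nat.lt_succ_of_le (Submodule.finrank_le (U.1 i))⟩, rfl⟩
  obtain ⟨_, ⟨U₀, rfl⟩, hmax⟩ := hfin.exists_maximal
    ⟨_, ⟨⟨⊤, isSub_top M, hM⟩, rfl⟩⟩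
  have hmax' : ∀ W, M.IsSub W → W ≠ ⊥ → sl W ≤ sl U₀.1 := fun W hW hne => by
    by_contra hlt
    exact hlt (hmax ⟨⟨W, hW, hne⟩, rfl⟩ (not_le.1 hlt).le)
  set μ := sl U₀.1 with hμ
  have hle : ∀ W, M.IsSub W → wt (cw θ μ) W ≤ 0 := fun W hW => by
    by_cases hne : W = ⊥
    · rw [hne, wt_bot]
    have h1 := hmax' W hW hne
    have h2 : (0 : ℚ) < size W := by exact_mod_cast size_pos hne
    simp only [sl, slope] at h1
    rw [wt_cw]
    have h3 := (div_le_iff₀ h2).1 h1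
    linarith
  have h0 : wt (cw θ μ) U₀.1 = 0 := by
    refine (sum_cw_eq_zero_iff θ μ _ ?_).2 rfl
    exact (size_pos U₀.2.2).ne'
  let p : ℕ → Prop := fun n => ∃ W, M.IsSub W ∧ wt (cw θ μ) W = 0 ∧ size W = n
  have hp : p (size U₀.1) := ⟨U₀.1, U₀.2.1, h0, rfl⟩
  have hbd : ∀ n, p n → n ≤ size (⊤ : ∀ i, Submodule k (M.V i)) := by
    rintro n ⟨W, -, -, rfl⟩; exact size_mono le_top
  obtain ⟨U, hU, hU0, hUs⟩ := Nat.findGreatest_spec (P := p) (hbd _ hp) hp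
  have hUmax : ∀ W, M.IsSub W → wt (cw θ μ) W = 0 → size W ≤ size U := fun W hW hW0 => by
    rw [hUs]
    exact Nat.le_findGreatest (hbd _ ⟨W, hW, hW0, rfl⟩) ⟨W, hW, hW0, rfl⟩
  refine ⟨μ, U, hU, fun hb => ?_, hU0, hle, fun W hW hW0 => ?_⟩
  · have h1 := hUmax _ U₀.2.1 h0
    have h2 := size_pos U₀.2.2
    rw [hb] at h1
    have : size (⊥ : ∀ i, Submodule k (M.V i)) = 0 := by simp [size]
    omega
  · have h1 := wt_sup_add_inf (cw θ μ) U W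
    have h2 := hle _ (hU.inf hW)
    have h3 := hle _ (hU.sup hW)
    have h4 := hUmax (U ⊔ W) (hU.sup hW) (by linarith)
    rw [eq_of_le_of_size_le (le_sup_left : U ≤ U ⊔ W) h4]
    exact le_sup_right

lemma IsMaxDestab.slope_le {M : QRep I k} {θ : I → ℤ} {μ μ' : ℚ}
    {U U' : ∀ i, Submodule k (M.V i)} (h : M.IsMaxDestab θ μ U) (h' : M.IsMaxDestab θ μ' U') :
    μ ≤ μ' := by
  have h1 := h'.wt_le U h.isSub
  rw [wt_cw_shift θ μ' μ, h.wt_eq] at h1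
  have h2 : (0 : ℚ) < size U := by exact_mod_cast size_pos h.ne_bot
  by_contra hlt
  nlinarith [mul_pos (sub_pos.2 (not_le.1 hlt)) h2]

lemma IsMaxDestab.unique {M : QRep I k} {θ : I → ℤ} {μ μ' : ℚ}
    {U U' : ∀ i, Submodule k (M.V i)} (h : M.IsMaxDestab θ μ U) (h' : M.IsMaxDestab θ μ' U') :
    μ = μ' ∧ U = U' := by
  have hμ : μ = μ' := le_antisymm (h.slope_le h') (h'.slope_le h)
  subst hμ
  exact ⟨rfl, le_antisymm (h'.le U h.isSub h.wt_eq) (h.le U' h'.isSub h'.wt_eq)⟩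

/-- All nonzero subrepresentations have slope less than `μ`. -/
def SlopesLT (θ : I → ℤ) (μ : ℚ) (M : QRep I k) : Prop :=
  ∀ W, M.IsSub W → W ≠ ⊥ → wt (cw θ μ) W < 0

lemma IsMaxDestab.slopesLT_iff {M : QRep I k} {θ : I → ℤ} {μ' : ℚ}
    {U : ∀ i, Submodule k (M.V i)} (h : M.IsMaxDestab θ μ' U) (μ : ℚ) :
    M.SlopesLT θ μ ↔ μ' < μ := by
  constructor
  · intro h1
    have h2 := h1 U h.isSub h.ne_bot
    rw [wt_cw_shift θ μ μ', h.wt_eq] at h2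
    have h3 : (0 : ℚ) < size U := by exact_mod_cast size_pos h.ne_bot
    by_contra hlt
    nlinarith [mul_nonneg (sub_nonneg.2 (not_lt.1 hlt)) h3.le]
  · intro hlt W hW hne
    have h2 := h.wt_le W hW
    have h3 : (0 : ℚ) < size W := by exact_mod_cast size_pos hne
    rw [wt_cw_shift θ μ μ']
    nlinarith [mul_pos (sub_pos.2 hlt) h3]

lemma ss_cw_iff {M : QRep I k} (hM : M.Nonzero) (θ : I → ℤ) (μ : ℚ) :
    M.SS (cw θ μ) ↔ M.IsMaxDestab θ μ ⊤ :=
  ⟨fun h => ⟨isSub_top M, hM, h.1, h.2, fun _ _ _ => le_top⟩, fun h => ⟨h.wt_eq, h.wt_le⟩⟩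

/-- By additivity of weights, being maximal destabilizing splits into independent conditions on the
sub and on the quotient, the form needed to count extensions. -/
lemma Exact.isMaxDestab_range {M L C : QRep I k} {φ : Hom M L} {ψ : Hom L C} (h : Exact φ ψ)
    (hM : M.Nonzero) (θ : I → ℤ) (μ : ℚ) :
    L.IsMaxDestab θ μ φ.range ↔ M.SS (cw θ μ) ∧ C.SlopesLT θ μ := by
  constructor
  · intro hd
    have hMss : M.SS (cw θ μ) := by
      refine ⟨?_, fun U hU => ?_⟩
      · rw [← wt_image_of_inj _ h.1, φ.image_top, hd.wt_eq]
      · rw [← wt_image_of_inj _ h.1]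
        exact hd.wt_le _ (hU.image φ)
    refine ⟨hMss, fun W hW hne => ?_⟩
    have h1 := h.wt_comap (cw θ μ) W
    rw [hMss.1, add_zero] at h1
    rw [← h1]
    refine lt_of_le_of_ne (hd.wt_le _ (hW.comap ψ)) fun h0 => hne ?_
    have h2 := hd.le _ (hW.comap ψ) h0
    rw [h.2.2] at h2
    funext i
    refine (Submodule.eq_bot_iff _).2 fun w hw => ?_
    obtain ⟨v, rfl⟩ := h.2.1 i w
    exact h2 i hw
  · rintro ⟨hMss, hC⟩
    have hne : φ.range ≠ ⊥ := fun h0 => hM <| by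
      rw [← (φ.ker_eq_top_iff).2 (φ.range_eq_bot_iff.1 h0)]
      exact φ.inj_iff.1 h.1
    have hC' : ∀ W, C.IsSub W → wt (cw θ μ) W ≤ 0 := fun W hW => by
      by_cases hb : W = ⊥
      · rw [hb, wt_bot]
      · exact (hC W hW hb).le
    refine ⟨φ.isSub_range, hne, ?_, fun W hW => ?_, fun W hW h0 => ?_⟩
    · rw [← φ.image_top, wt_image_of_inj _ h.1, hMss.1]
    · rw [h.wt_eq]
      exact add_nonpos (hC' _ (hW.image ψ)) (hMss.2 _ (hW.comap φ))
    · rw [h.wt_eq] at h0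
      have h1 := hC' _ (hW.image ψ)
      have h2 := hMss.2 _ (hW.comap φ)
      have h3 : ψ.image W = ⊥ := by
        by_contra hb
        have := hC _ (hW.image ψ) hb
        linarith
      rw [h.2.2]
      intro i v hv
      have : ψ.1 i v ∈ ψ.image W i := ⟨v, hv, rfl⟩
      rw [h3] at this
      exact this

/-- The dimension vector of a family of subspaces. -/
def dimU {M : QRep I k} (U : ∀ i, Submodule k (M.V i)) : I →₀ ℕ :=
  Finsupp.equivFunOnFinite.symm fun i => Module.finrank k (U i)

lemma degree_dimU {M : QRep I k} (U : ∀ i, Submodule k (M.V i)) : (dimU U).degree = size U := by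
  rw [Finsupp.degree_eq_sum]
  rfl

/-- The maximal destabilizing subrepresentation has dimension vector `γ`. -/
def HasType (θ : I → ℤ) (γ : I →₀ ℕ) (M : QRep I k) : Prop :=
  ∃ U, M.IsMaxDestab θ (slope θ γ) U ∧ dimU U = γ

lemma IsMaxDestab.slope_dimU {M : QRep I k} {θ : I → ℤ} {μ : ℚ}
    {U : ∀ i, Submodule k (M.V i)} (h : M.IsMaxDestab θ μ U) : slope θ (dimU U) = μ :=
  (sum_cw_eq_zero_iff θ μ (dimU U) (size_pos h.ne_bot).ne').1 h.wt_eq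

lemma existsUnique_hasType {M : QRep I k} (hM : M.Nonzero) (θ : I → ℤ) :
    ∃! γ, M.HasType θ γ := by
  obtain ⟨μ, U, h⟩ := exists_isMaxDestab hM θ
  refine ⟨dimU U, ⟨U, by rwa [h.slope_dimU], rfl⟩, ?_⟩
  rintro γ ⟨U', h', rfl⟩
  rw [(h'.unique h).2]

lemma HasType.ne_zero {M : QRep I k} {θ : I → ℤ} {γ : I →₀ ℕ} (h : M.HasType θ γ) : γ ≠ 0 := by
  obtain ⟨U, h, rfl⟩ := h
  intro h0
  have := size_pos h.ne_bot
  rw [← degree_dimU, h0, map_zero] at this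
  omega

lemma HasType.le {M : QRep I k} {θ : I → ℤ} {γ : I →₀ ℕ} (h : M.HasType θ γ) : γ ≤ M.dimv := by
  obtain ⟨U, -, rfl⟩ := h
  exact fun i => Submodule.finrank_le (U i)

lemma HasType.slopesLT_iff {M : QRep I k} {θ : I → ℤ} {γ : I →₀ ℕ} (h : M.HasType θ γ) (μ : ℚ) :
    M.SlopesLT θ μ ↔ slope θ γ < μ := by
  obtain ⟨U, h, -⟩ := h
  exact h.slopesLT_iff μ

lemma hasType_dimv_iff {M : QRep I k} (hM : M.Nonzero) {θ : I → ℤ} :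
    M.HasType θ M.dimv ↔ M.SS (cw θ (slope θ M.dimv)) := by
  rw [ss_cw_iff hM]
  constructor
  · rintro ⟨U, h, hd⟩
    have : U = ⊤ := eq_of_le_of_size_le le_top (by
      rw [← degree_dimU U, hd, degree_dimv])
    rwa [this] at h
  · intro h
    exact ⟨⊤, h, by ext i; exact finrank_top k (M.V i)⟩

variable [Finite k] [∀ i j : I, Fintype (i ⟶ j)]

/-- The number of matrix representations all of whose nonzero subrepresentations have slope less
than `μ`. -/
def numLT (θ : I → ℤ) (μ : ℚ) (k : Type) [Field k] (α : I → ℕ) : ℕ :=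
  Nat.card {x : Rep k α // (ofRep x).SlopesLT θ μ}

/-- Embeddings onto the maximal destabilizing subrepresentation form a torsor over `GL_γ`. -/
lemma card_hasType_mul (θ : I → ℤ) (α γ : I →₀ ℕ) :
    Nat.card {x : Rep k α // (ofRep x).HasType θ γ} * Nat.card (GLDim k γ) =
      Nat.card (Σ y : Rep k γ, {p : Σ x : Rep k α, Hom (ofRep y) (ofRep x) //
        p.2.Inj ∧ (ofRep p.1).IsMaxDestab θ (slope θ γ) p.2.range}) := by
  classical
  have e1 : (Σ y : Rep k γ, {p : Σ x : Rep k α, Hom (ofRep y) (ofRep x) //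
        p.2.Inj ∧ (ofRep p.1).IsMaxDestab θ (slope θ γ) p.2.range}) ≃
      Σ x : {x : Rep k α // (ofRep x).HasType θ γ}, {p : Σ y : Rep k γ, Hom (ofRep y) (ofRep x.1) //
        p.2.Inj ∧ (ofRep x.1).IsMaxDestab θ (slope θ γ) p.2.range} :=
    { toFun := fun t => ⟨⟨t.2.1.1, t.2.1.2.range, t.2.2.2, by
          ext i
          exact (LinearMap.finrank_range_of_inj (t.2.2.1 i)).trans (Module.finrank_fin_fun k)⟩,
        ⟨t.1, t.2.1.2⟩, t.2.2⟩
      invFun := fun t => ⟨t.2.1.1, ⟨t.1.1, t.2.1.2⟩, t.2.2⟩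
      left_inv := fun _ => rfl
      right_inv := fun _ => rfl }
  have := Fintype.ofFinite {x : Rep k α // (ofRep x).HasType θ γ}
  have hfin : ∀ x : {x : Rep k α // (ofRep x).HasType θ γ},
      Finite {p : Σ y : Rep k γ, Hom (ofRep y) (ofRep x.1) //
        p.2.Inj ∧ (ofRep x.1).IsMaxDestab θ (slope θ γ) p.2.range} := fun x => inferInstance
  rw [Nat.card_congr e1, Nat.card_sigma]
  have hcard : ∀ x : {x : Rep k α // (ofRep x).HasType θ γ},
      Nat.card {p : Σ y : Rep k γ, Hom (ofRep y) (ofRep x.1) //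
        p.2.Inj ∧ (ofRep x.1).IsMaxDestab θ (slope θ γ) p.2.range} = Nat.card (GLDim k γ) := by
    rintro ⟨x, U, hU, hd⟩
    have hrange : ∀ (y : Rep k γ) (φ : Hom (ofRep y) (ofRep x)),
        (ofRep x).IsMaxDestab θ (slope θ γ) φ.range → φ.range = U := fun y φ h => (h.unique hU).2
    -- For fixed x the maximal destabilizing U is unique. An embedding onto U is a family of linear
    -- isomorphisms k^(γ i) → U i, along which the structure y is transported from U.
    let F : {p : Σ y : Rep k γ, Hom (ofRep y) (ofRep x) //
        p.2.Inj ∧ (ofRep x).IsMaxDestab θ (slope θ γ) p.2.range} →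
        ∀ i, (Fin (γ i) → k) ≃ₗ[k] U i := fun p i =>
      (LinearEquiv.ofInjective (p.1.2.1 i) (p.2.1 i)).trans
        (LinearEquiv.ofEq _ _ (congrFun (hrange _ _ p.2.2) i))
    have hF : ∀ p i v, (F p i v : Fin (α i) → k) = p.1.2.1 i v := fun p i v => rfl
    have hbij : Function.Bijective F := by
      constructor
      · rintro ⟨⟨y, φ⟩, h1, h2⟩ ⟨⟨y', φ'⟩, h1', h2'⟩ h
        have h3 : ∀ i v, φ.1 i v = φ'.1 i v := fun i v => by
          have := congrArg (fun f => ((f i v : U i) : Fin (α i) → k)) h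
          exact this
        have h4 : y = y' := by
          funext i j a
          refine Matrix.mulVec_injective (funext fun v => h1 j ?_)
          have h5 := φ.comm a v
          have h6 := φ'.comm a v
          change φ.1 j ((y a).mulVec v) = φ.1 j ((y' a).mulVec v)
          rw [h3 j ((y' a).mulVec v)]
          exact h5.trans ((congrArg ((ofRep x).map a) (h3 i v)).trans h6.symm)
        subst h4
        have h5 : φ = φ' := Hom.ext' h3
        subst h5
        rfl
      · intro e
        let y : Rep k γ := fun i j a => LinearMap.toMatrix'
          ((e j).symm.toLinearMap ∘ₗ ((ofRep x).map a).restrict (hU.isSub a) ∘ₗ (e i).toLinearMap)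
        let φ : Hom (ofRep y) (ofRep x) := ⟨fun i => (U i).subtype ∘ₗ (e i).toLinearMap, by
          intro i j a v
          change ((e j ((y a).mulVec v) : U j) : Fin (α j) → k) = _
          simp only [y, LinearMap.toMatrix'_mulVec, LinearMap.comp_apply, LinearEquiv.coe_coe,
            LinearEquiv.apply_symm_apply]
          rfl⟩
        have hr : φ.range = U := funext fun i => by
          change LinearMap.range ((U i).subtype ∘ₗ (e i).toLinearMap) = U i
          rw [LinearMap.range_comp, LinearEquiv.range, Submodule.map_top, Submodule.range_subtype]
        refine ⟨⟨⟨y, φ⟩, fun i => (Submodule.injective_subtype _).comp (e i).injective, by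
          rw [hr]; exact hU⟩, ?_⟩
        funext i
        exact LinearEquiv.ext fun v => Subtype.ext rfl
    rw [Nat.card_congr (Equiv.ofBijective F hbij), Nat.card_pi, Nat.card_pi]
    refine Finset.prod_congr rfl fun i _ => card_linearEquiv_eq_card_GL (Module.finrank_fin_fun k) ?_
    rw [← hd]; rfl
  rw [Finset.sum_congr rfl fun x _ => hcard x, Finset.sum_const, Finset.card_univ, smul_eq_mul,
    Nat.card_eq_fintype_card]

/-- Sum `card_embeddings` over all y of dimension vector γ: only semistable y contribute, and all of
them contribute equally. The torsor of `card_hasType_mul` accounts for the division by #GL_γ. -/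
lemma card_hasType_div [DecidableEq I] (θ : I → ℤ) (β γ : I →₀ ℕ) (hγ : γ ≠ 0) :
    (Nat.card {x : Rep k (β + γ : I →₀ ℕ) // (ofRep x).HasType θ γ} : ℚ) /
        Nat.card (GLDim k (β + γ : I →₀ ℕ)) =
      (Nat.card k : ℚ) ^ (-ringelForm (fun i => (β i : ℤ)) (fun i => (γ i : ℤ))) *
        ((numLT θ (slope θ γ) k β : ℚ) / Nat.card (GLDim k β) *
          ((numSS (cw θ (slope θ γ)) k γ : ℚ) / Nat.card (GLDim k γ))) := by
  classical
  have hG := card_GLDim_ne_zero (k := k) γ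
  have hy0 : ∀ y : Rep k γ, (ofRep y).Nonzero := fun y =>
    nonzero_of_dimv_ne_zero (by rwa [dimv_ofRep])
  have := Fintype.ofFinite (Rep k γ)
  have h1 := card_hasType_mul (k := k) θ (β + γ) γ
  rw [Nat.card_sigma] at h1
  have h2 : ∀ y : Rep k γ, (Nat.card {p : Σ x : Rep k (β + γ : I →₀ ℕ), Hom (ofRep y) (ofRep x) //
        p.2.Inj ∧ (ofRep p.1).IsMaxDestab θ (slope θ γ) p.2.range} : ℚ) /
          Nat.card (GLDim k (β + γ : I →₀ ℕ)) =
      if (ofRep y).SS (cw θ (slope θ γ)) then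
        (Nat.card k : ℚ) ^ (-ringelForm (fun i => (β i : ℤ)) (fun i => (γ i : ℤ))) *
          ((numLT θ (slope θ γ) k β : ℚ) / Nat.card (GLDim k β)) else 0 := by
    intro y
    have h3 := card_embeddings (α := (β + γ : I →₀ ℕ)) (β := β) (γ := γ) (fun i => rfl) y
      (fun x φ => (ofRep x).IsMaxDestab θ (slope θ γ) φ.range)
      (fun w => (ofRep y).SS (cw θ (slope θ γ)) ∧ (ofRep w).SlopesLT θ (slope θ γ))
      (fun x φ w ψ h => h.isMaxDestab_range (hy0 y) θ _)
    rw [h3]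
    split_ifs with hss
    · simp only [hss, true_and]
      rfl
    · simp [hss]
  have h3 : (Nat.card {x : Rep k (β + γ : I →₀ ℕ) // (ofRep x).HasType θ γ} : ℚ) /
        Nat.card (GLDim k (β + γ : I →₀ ℕ)) * Nat.card (GLDim k γ) =
      ∑ y : Rep k γ, (Nat.card {p : Σ x : Rep k (β + γ : I →₀ ℕ), Hom (ofRep y) (ofRep x) //
        p.2.Inj ∧ (ofRep p.1).IsMaxDestab θ (slope θ γ) p.2.range} : ℚ) /
          Nat.card (GLDim k (β + γ : I →₀ ℕ)) := by
    rw [← Finset.sum_div, div_mul_eq_mul_div]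
    congr 1
    exact_mod_cast h1
  rw [Finset.sum_congr rfl fun y _ => h2 y, ← Finset.sum_filter, Finset.sum_const,
    nsmul_eq_mul] at h3
  have h4 : (Finset.univ.filter fun y : Rep k γ => (ofRep y).SS (cw θ (slope θ γ))).card =
      numSS (cw θ (slope θ γ)) k γ := by
    rw [numSS, Nat.card_eq_fintype_card, Fintype.card_subtype]
  rw [h4] at h3
  rw [← mul_right_cancel_iff_of_pos (lt_of_le_of_ne (Nat.cast_nonneg _) hG.symm), h3]
  field_simp

/-- Every nonzero representation has exactly one type, so the points are partitioned by it; the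
index records (α - type, type). -/
lemma card_eq_sum_hasType [DecidableEq I] (θ : I → ℤ) {α : I →₀ ℕ} (hα : α ≠ 0) (P : Rep k α → Prop)
    (Q : (I →₀ ℕ) → Prop) [DecidablePred Q]
    (hPQ : ∀ x γ, (ofRep x).HasType θ γ → (P x ↔ Q γ)) :
    (Nat.card {x // P x} : ℚ) =
      ∑ p ∈ Finset.HasAntidiagonal.antidiagonal α, if Q p.2 then
        (Nat.card {x : Rep k α // (ofRep x).HasType θ p.2} : ℚ) else 0 := by
  classical
  have hx0 : ∀ x : Rep k α, (ofRep x).Nonzero := fun x =>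
    nonzero_of_dimv_ne_zero (by rwa [dimv_ofRep])
  have := Fintype.ofFinite (Rep k α)
  choose t ht htu using fun x : Rep k α => existsUnique_hasType (hx0 x) θ
  have htα : ∀ x, t x ≤ α := fun x => by
    have := (ht x).le
    rwa [dimv_ofRep] at this
  have ht_iff : ∀ x γ, (ofRep x).HasType θ γ ↔ t x = γ := fun x γ =>
    ⟨fun h => (htu x γ h).symm, fun h => h ▸ ht x⟩
  have hc : ∀ R : Rep k α → Prop, Nat.card {x // R x} = (Finset.univ.filter R).card := fun R => by
    rw [Nat.card_eq_fintype_card, Fintype.card_subtype]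
  rw [hc, Finset.card_eq_sum_card_fiberwise (f := fun x => (α - t x, t x))
    (t := Finset.HasAntidiagonal.antidiagonal α)]
  · push_cast
    refine Finset.sum_congr rfl fun p hp => ?_
    rw [Finset.HasAntidiagonal.mem_antidiagonal] at hp
    split_ifs with hQ
    · rw [hc]
      congr 2
      ext x
      simp only [Finset.mem_filter, Finset.mem_univ, true_and]
      rw [ht_iff]
      constructor
      · rintro ⟨-, h⟩; exact congrArg Prod.snd h
      · intro h
        refine ⟨(hPQ x p.2 ((ht_iff x p.2).2 h)).2 hQ, Prod.ext ?_ h⟩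
        change α - t x = p.1
        rw [h, ← hp, add_tsub_cancel_right]
    · rw [Nat.cast_eq_zero, Finset.card_eq_zero, Finset.filter_eq_empty_iff]
      intro x hx h
      rw [Finset.mem_filter] at hx
      have : t x = p.2 := congrArg Prod.snd h
      exact hQ ((hPQ x p.2 ((ht_iff x p.2).2 this)).1 hx.2)
  · intro x _
    rw [Finset.mem_coe, Finset.HasAntidiagonal.mem_antidiagonal]
    exact tsub_add_cancel_of_le (htα x)

end HarderNarasimhan

end QRep

/-! ### Rationality of the semistable counting function -/

lemma IsCount.congr {F G : ∀ (k : Type) [Field k] [Finite k], ℚ} (hF : IsCount F)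
    (h : ∀ (k : Type) [Field k] [Finite k], G k = F k) : IsCount G := by
  obtain ⟨f, hf, h'⟩ := hF
  exact ⟨f, hf, fun k _ _ => by rw [h', h]⟩

section Semistable

variable {I : Type u} [Quiver.{v} I] [Fintype I]

omit [Quiver.{v} I] in
lemma slope_le_iff (θ : I → ℤ) (μ : ℚ) (a : I → ℕ) (ha : ∑ i, a i ≠ 0) :
    slope θ a ≤ μ ↔ ∑ i, QRep.cw θ μ i * a i ≤ 0 := by
  have h : (0 : ℚ) < ((∑ i, a i : ℕ) : ℚ) := by exact_mod_cast Nat.pos_of_ne_zero ha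
  rw [QRep.sum_cw, slope, div_le_iff₀ h, sub_nonpos]

omit [Quiver.{v} I] in
lemma slope_lt_iff (θ : I → ℤ) (μ : ℚ) (a : I → ℕ) (ha : ∑ i, a i ≠ 0) :
    slope θ a < μ ↔ ∑ i, QRep.cw θ μ i * a i < 0 := by
  have h : (0 : ℚ) < ((∑ i, a i : ℕ) : ℚ) := by exact_mod_cast Nat.pos_of_ne_zero ha
  rw [QRep.sum_cw, slope, div_lt_iff₀ h, sub_neg]

omit [Quiver.{v} I] in
lemma sum_ne_zero_of_ne_zero {α : I → ℕ} (hα : α ≠ 0) : ∑ i, α i ≠ 0 := fun h =>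
  hα (funext fun i => Finset.sum_eq_zero_iff.1 h i (Finset.mem_univ i))

section

variable {k : Type} [Field k]

lemma wt_top_ofRep {α : I → ℕ} (c : I → ℚ) (x : Rep k α) :
    QRep.wt c (⊤ : ∀ i, Submodule k ((QRep.ofRep x).V i)) = ∑ i, c i * α i := by
  rw [QRep.wt_top]
  exact Finset.sum_congr rfl fun i _ => by rw [Module.finrank_fin_fun]

lemma wt_top_ofRep_slope {α : I → ℕ} (hα : α ≠ 0) (θ : I → ℤ) (x : Rep k α) :
    QRep.wt (QRep.cw θ (slope θ α)) (⊤ : ∀ i, Submodule k ((QRep.ofRep x).V i)) = 0 := by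
  rw [wt_top_ofRep]
  exact (QRep.sum_cw_eq_zero_iff θ _ α (sum_ne_zero_of_ne_zero hα)).2 rfl

lemma Subrep.sum_dim_ne_zero {α : I → ℕ} {x : Rep k α} (N : Subrep x)
    (h : ∃ i, N.space i ≠ ⊥) : ∑ i, N.dim i ≠ 0 := by
  obtain ⟨i, hi⟩ := h
  intro h0
  exact hi (Submodule.finrank_eq_zero.1 (Finset.sum_eq_zero_iff.1 h0 i (Finset.mem_univ i)))

/-- For a nonzero subrepresentation the slope inequality is a sign condition on the weight. The zero
and the full subrepresentation, excluded in `IsSemistable`, have weight 0. -/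
lemma isSemistable_iff {α : I → ℕ} (hα : α ≠ 0) (θ : I → ℤ) (x : Rep k α) :
    IsSemistable θ x ↔ (QRep.ofRep x).SS (QRep.cw θ (slope θ α)) := by
  constructor
  · intro h
    refine ⟨wt_top_ofRep_slope hα θ x, fun U hU => ?_⟩
    by_cases h1 : U = ⊥
    · rw [h1, QRep.wt_bot]
    by_cases h2 : U = ⊤
    · rw [h2, wt_top_ofRep_slope hα]
    let N : Subrep x := ⟨U, hU⟩
    have h3 := Function.ne_iff.1 h1
    exact (slope_le_iff θ _ _ (N.sum_dim_ne_zero h3)).1 (h N h3 (Function.ne_iff.1 h2))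
  · intro h N h1 _
    exact (slope_le_iff θ _ _ (N.sum_dim_ne_zero h1)).2 (h.2 N.space N.map_mem)

lemma isStable_iff {α : I → ℕ} (θ : I → ℤ) (x : Rep k α) :
    IsStable θ x ↔ α ≠ 0 ∧ (QRep.ofRep x).Stable (QRep.cw θ (slope θ α)) := by
  refine and_congr_right fun hα => ⟨fun h => ?_, fun h N h1 h2 => ?_⟩
  · refine ⟨fun h0 => hα (funext fun i => ?_), wt_top_ofRep_slope hα θ x, fun U hU h1 h2 => ?_⟩
    · have h1 := congrFun h0 i
      have h2 := finrank_top k (Fin (α i) → k)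
      rw [Module.finrank_fin_fun] at h2
      rw [← h2]
      exact (congrArg (fun W : Submodule k (Fin (α i) → k) => Module.finrank k W) h1).trans
        (finrank_bot k _)
    · let N : Subrep x := ⟨U, hU⟩
      have h3 := Function.ne_iff.1 h1
      exact (slope_lt_iff θ _ _ (N.sum_dim_ne_zero h3)).1 (h N h3 (Function.ne_iff.1 h2))
  · exact (slope_lt_iff θ _ _ (N.sum_dim_ne_zero h1)).2
      (h.2.2 N.space N.map_mem (Function.ne_iff.2 h1) (Function.ne_iff.2 h2))

lemma numSemistable_eq_numSS {α : I → ℕ} (hα : α ≠ 0) (θ : I → ℤ) :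
    numSemistable θ k α = QRep.numSS (QRep.cw θ (slope θ α)) k α :=
  Nat.card_congr (Equiv.subtypeEquivRight fun x => isSemistable_iff hα θ x)

omit [Fintype I] [Field k] in
lemma subsingleton_rep_zero : Subsingleton (Rep k (0 : I → ℕ)) :=
  ⟨fun x y => by funext i j h; ext a; exact a.elim0⟩

lemma numSemistable_zero (θ : I → ℤ) : numSemistable θ k (0 : I → ℕ) = 1 := by
  have : Subsingleton (Rep k (0 : I → ℕ)) := subsingleton_rep_zero
  let x₀ : Rep k (0 : I → ℕ) := fun _ _ _ => 0
  have h : {x : Rep k (0 : I → ℕ) | IsSemistable θ x} = {x₀} := by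
    ext x
    refine ⟨fun _ => Subsingleton.elim _ _, fun _ N ⟨i, hi⟩ _ => (hi ?_).elim⟩
    exact (Submodule.eq_bot_iff _).2 fun v _ => funext fun a => a.elim0
  rw [numSemistable, h, Set.ncard_singleton]

omit [Quiver.{v} I] [Fintype I] in
lemma card_GLDim_zero : Nat.card (GLDim k (0 : I → ℕ)) = 1 := by
  have : Subsingleton (GLDim k (0 : I → ℕ)) := ⟨fun g h => by
    funext i; ext a; exact a.elim0⟩
  exact Nat.card_of_subsingleton 1

lemma numLT_zero (θ : I → ℤ) (μ : ℚ) : QRep.numLT θ μ k (0 : I → ℕ) = 1 := by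
  have : Subsingleton (Rep k (0 : I → ℕ)) := subsingleton_rep_zero
  refine (Nat.card_eq_one_iff_unique).2 ⟨⟨fun a b => Subtype.ext (Subsingleton.elim _ _)⟩,
    ⟨⟨fun _ _ _ => 0, fun W _ hne => (hne (funext fun i => ?_)).elim⟩⟩⟩
  exact (Submodule.eq_bot_iff _).2 fun v _ => funext fun a => a.elim0

end

omit [Quiver.{v} I] in
lemma isCount_inv_card_GLDim (α : I → ℕ) :
    IsCount fun k _ _ => ((Nat.card (GLDim k α) : ℚ))⁻¹ := by
  have h := IsCount.prod Finset.univ fun i _ => isCount_inv_card_GL (α i)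
  simpa only [GLDim, Nat.card_pi, Nat.cast_prod, Finset.prod_inv_distrib] using h

variable [∀ i j : I, Fintype (i ⟶ j)]

lemma isCount_card_rep_div (α : I → ℕ) :
    IsCount fun k _ _ => (Nat.card (Rep k α) : ℚ) / Nat.card (GLDim k α) := by
  have h := (isCount_zpow ((∑ i, ∑ j, ∑ _h : i ⟶ j, α i * α j : ℕ) : ℤ)).mul
    (isCount_inv_card_GLDim α)
  simpa only [card_rep, zpow_natCast, Nat.cast_pow, ← div_eq_mul_inv] using h

/-- The Harder-Narasimhan recursion. A stratum of type γ with quotient of dimension β involves the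
semistable count of γ and the bounded slope count of β, so the two statements are proved together.
The semistable count of α is then what remains of #R_α, and the bounded slope count of α is a sum of
strata. -/
theorem isCount_numSS_and_numLT [DecidableEq I] (θ : I → ℤ) (n : ℕ) (α : I →₀ ℕ)
    (hn : α.degree = n) :
    (α ≠ 0 → IsCount fun k _ _ =>
      (QRep.numSS (QRep.cw θ (slope θ α)) k α : ℚ) / Nat.card (GLDim k α)) ∧
    ∀ μ : ℚ, IsCount fun k _ _ => (QRep.numLT θ μ k α : ℚ) / Nat.card (GLDim k α) := by
  classical
  induction n using Nat.strong_induction_on generalizing α with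
  | _ n ih =>
  by_cases hα : α = 0
  · subst hα
    refine ⟨fun h => (h rfl).elim, fun μ => ?_⟩
    have h : ∀ (k : Type) [Field k] [Finite k],
        (QRep.numLT θ μ k (0 : I →₀ ℕ) : ℚ) / Nat.card (GLDim k (0 : I →₀ ℕ)) = 1 := fun k _ _ => by
      rw [Finsupp.coe_zero, numLT_zero, card_GLDim_zero, Nat.cast_one, div_one]
    simpa only [h] using isCount_one
  let H : (I →₀ ℕ) → ∀ (k : Type) [Field k] [Finite k], ℚ := fun γ k _ _ =>
    (Nat.card {x : Rep k α // (QRep.ofRep x).HasType θ γ} : ℚ) / Nat.card (GLDim k α)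
  have hx0 : ∀ (k : Type) [Field k] (x : Rep k α), (QRep.ofRep x).Nonzero := fun k _ x =>
    QRep.nonzero_of_dimv_ne_zero (by rwa [QRep.dimv_ofRep])
  have hmain : ∀ (P : ∀ (k : Type) [Field k] [Finite k], Rep k α → Prop) (Q : (I →₀ ℕ) → Prop),
      (∀ (k : Type) [Field k] [Finite k] x γ, (QRep.ofRep x).HasType θ γ → (P k x ↔ Q γ)) →
      ∀ (k : Type) [Field k] [Finite k], (Nat.card {x // P k x} : ℚ) / Nat.card (GLDim k α) =
        ∑ p ∈ Finset.HasAntidiagonal.antidiagonal α, if Q p.2 then H p.2 k else 0 := by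
    intro P Q hPQ k _ _
    rw [QRep.card_eq_sum_hasType θ hα (P k) Q (hPQ k), Finset.sum_div]
    exact Finset.sum_congr rfl fun p _ => by split_ifs <;> simp [H]
  -- Type 0 never occurs; in all other terms both components are nonzero and so have degree below n.
  have hsmall : ∀ p ∈ (Finset.HasAntidiagonal.antidiagonal α).erase (0, α), IsCount (H p.2) := by
    rintro ⟨β, γ⟩ hp
    obtain ⟨hne, hp⟩ := Finset.mem_erase.1 hp
    rw [Finset.HasAntidiagonal.mem_antidiagonal] at hp
    simp only at hp
    by_cases hγ : γ = 0
    · have h0 : ∀ (k : Type) [Field k] [Finite k], H γ k = 0 := fun k _ _ => by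
        have : IsEmpty {x : Rep k α // (QRep.ofRep x).HasType θ γ} := ⟨fun x => x.2.ne_zero hγ⟩
        simp [H]
      exact isCount_zero.congr h0
    have hβ : β ≠ 0 := fun h => hne (by rw [h, zero_add] at hp; rw [h, hp])
    have hd : β.degree + γ.degree = n := by rw [← hn, ← hp, map_add]
    have hβ' : 0 < β.degree := Nat.pos_of_ne_zero fun h => hβ ((Finsupp.degree_eq_zero_iff β).1 h)
    have hγ' : 0 < γ.degree := Nat.pos_of_ne_zero fun h => hγ ((Finsupp.degree_eq_zero_iff γ).1 h)
    have h1 := (ih β.degree (by omega) β rfl).2 (slope θ γ)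
    have h2 := (ih γ.degree (by omega) γ rfl).1 hγ
    have h3 := (isCount_zpow (-ringelForm (fun i => (β i : ℤ)) (fun i => (γ i : ℤ)))).mul
      (h1.mul h2)
    subst hp
    exact h3.congr fun k _ _ => QRep.card_hasType_div θ β γ hγ
  have hmem : ((0 : I →₀ ℕ), α) ∈ Finset.HasAntidiagonal.antidiagonal α := by
    rw [Finset.HasAntidiagonal.mem_antidiagonal, zero_add]
  have hHα : ∀ (k : Type) [Field k] [Finite k],
      (QRep.numSS (QRep.cw θ (slope θ α)) k α : ℚ) / Nat.card (GLDim k α) = H α k := by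
    intro k _ _
    have h1 : ∀ x : Rep k α, (QRep.ofRep x).SS (QRep.cw θ (slope θ α)) ↔
        (QRep.ofRep x).HasType θ α := fun x => by
      have := QRep.hasType_dimv_iff (hx0 k x) (θ := θ)
      rw [QRep.dimv_ofRep] at this
      exact this.symm
    simp only [H, QRep.numSS, h1]
  -- The semistable stratum is the whole of R_α minus the strata already known.
  have hα' : IsCount (H α) := by
    have h1 := hmain (fun _ _ _ _ => True) (fun _ => True) fun _ _ _ _ _ _ => Iff.rfl
    refine ((isCount_card_rep_div α).sub (IsCount.sum _ hsmall)).congr fun k _ _ => ?_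
    have h3 := h1 k
    rw [← Finset.add_sum_erase _ _ hmem] at h3
    simp only [if_true] at h3
    rw [Nat.card_congr (Equiv.subtypeUnivEquiv fun _ : Rep k α => trivial)] at h3
    rw [h3, add_sub_cancel_right]
  refine ⟨fun _ => hα'.congr hHα, fun μ => ?_⟩
  have h1 := hmain (fun k _ _ x => (QRep.ofRep x).SlopesLT θ μ) (fun γ => slope θ γ < μ)
    fun k _ _ x γ h => h.slopesLT_iff μ
  refine (IsCount.sum (F := fun p => if slope θ p.2 < μ then H p.2 else fun _ _ _ => 0)
    (Finset.HasAntidiagonal.antidiagonal α) fun p hp => ?_).congr fun k _ _ => (h1 k).trans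
      (Finset.sum_congr rfl fun p _ => by split_ifs <;> rfl)
  by_cases hs : slope θ p.2 < μ
  · simp only [hs, if_true]
    by_cases hp0 : p = (0, α)
    · rw [hp0]; exact hα'
    · exact hsmall p (Finset.mem_erase.2 ⟨hp0, hp⟩)
  · simp only [hs, if_false]
    exact isCount_zero

theorem isCount_numSemistable [DecidableEq I] (θ : I → ℤ) (α : I →₀ ℕ) :
    IsCount fun k _ _ => (numSemistable θ k α : ℚ) / Nat.card (GLDim k α) := by
  by_cases hα : α = 0
  · subst hα
    simpa only [Finsupp.coe_zero, numSemistable_zero, card_GLDim_zero, Nat.cast_one, div_one]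
      using isCount_one
  · have h : (α : I → ℕ) ≠ 0 := fun h => hα (DFunLike.coe_injective h)
    simpa only [numSemistable_eq_numSS h] using (isCount_numSS_and_numLT θ _ α rfl).1 hα

end Semistable

namespace QRep

/-! ### Restriction and extension of scalars -/

section Scalars

variable {I : Type u} [Quiver.{v} I]

/-- Restriction of scalars of a matrix representation. -/
abbrev resRep (k : Type) {K : Type} [Field k] [Field K] [Algebra k K] [Module.Finite k K]
    {β : I → ℕ} (t : Rep K β) : QRep I k where
  V := fun i => Fin (β i) → K
  map := fun _ _ h => (t h).mulVecLin.restrictScalars k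

/-- All endomorphisms are scalars. -/
def ScalarEnd {k : Type} [Field k] (M : QRep I k) : Prop :=
  ∀ φ : Hom M M, ∃ a : k, ∀ i v, φ.1 i v = a • v

lemma Iso.scalarEnd {k : Type} [Field k] {M N : QRep I k} (h : Iso M N) (hM : M.ScalarEnd) :
    N.ScalarEnd := by
  obtain ⟨f, hi, hs⟩ := h
  intro φ
  obtain ⟨a, ha⟩ := hM ((f.inv hi hs).comp (φ.comp f))
  refine ⟨a, fun i v => ?_⟩
  obtain ⟨w, rfl⟩ := hs i v
  have h1 := congrArg (f.1 i) (ha i w)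
  rw [map_smul] at h1
  rw [← h1]
  exact (f.apply_inv hi hs i _).symm

section Tower

variable {k F K : Type} [Field k] [Field F] [Field K] [Algebra k F] [Algebra F K] [Algebra k K]
  [IsScalarTower k F K] [Module.Finite k F] [Module.Finite F K] [Module.Finite k K] {β : I → ℕ}

omit [Algebra F K] [Algebra k F] [Module.Finite k F] [Field F] [IsScalarTower k F K]
  [Module.Finite F K] in
lemma wt_restrictScalars [Fintype I] (c : I → ℚ) (t : Rep K β)
    (U : ∀ i, Submodule K (Fin (β i) → K)) :
    wt (M := resRep k t) c (fun i => (U i).restrictScalars k) =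
      Module.finrank k K * wt (M := ofRep t) c U := by
  simp only [wt, Finset.mul_sum]
  refine Finset.sum_congr rfl fun i _ => ?_
  have h : Module.finrank k ((U i).restrictScalars k) =
      Module.finrank k K * Module.finrank K (U i) := (Module.finrank_mul_finrank k K (U i)).symm
  rw [h]
  push_cast
  ring

/-- A linear form on the larger field, applied coordinatewise. -/
def coordHom (y : Rep F β) (f : K →ₗ[F] F) : Hom (resRep k (y.baseChange K)) (resRep k y) :=
  ⟨fun i => (f.restrictScalars k).compLeft (Fin (β i)), fun i j h v => by
    funext r
    change f (∑ s, algebraMap F K (y h r s) * v s) = ∑ s, y h r s * f (v s)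
    rw [map_sum]
    refine Finset.sum_congr rfl fun s _ => ?_
    rw [← Algebra.smul_def, map_smul, smul_eq_mul]⟩

/-- The inclusion of a representation into its extension of scalars. -/
def extHom (y : Rep F β) : Hom (resRep k y) (resRep k (y.baseChange K)) :=
  ⟨fun i => ((Algebra.linearMap F K).restrictScalars k).compLeft (Fin (β i)), fun i j h v => by
    funext r
    change algebraMap F K (∑ s, y h r s * v s) = ∑ s, algebraMap F K (y h r s) * algebraMap F K (v s)
    rw [map_sum]
    exact Finset.sum_congr rfl fun s _ => map_mul _ _ _⟩

omit [Module.Finite F K] in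
lemma extHom_apply (y : Rep F β) (i : I) (v : Fin (β i) → F) (r : Fin (β i)) :
    (extHom (k := k) (K := K) y).1 i v r = algebraMap F K (v r) := rfl

/-- Over k the extension of y to K behaves like a sum of copies of y, one for each element of an
F-basis of K, and these are its projections. -/
lemma eq_zero_of_coordHom (y : Rep F β) (i : I) (v : Fin (β i) → K)
    (h : ∀ j, (coordHom (k := k) y ((Module.finBasis F K).coord j)).1 i v = 0) : v = 0 := by
  funext r
  refine (Module.finBasis F K).ext_elem fun j => ?_
  have h1 : (Module.finBasis F K).repr (v r) j = 0 := congrFun (h j) r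
  rw [h1, Pi.zero_apply, map_zero, Finsupp.zero_apply]

/-- Each coordinate of φ in an F-basis of K is a k-endomorphism of y, hence a scalar in F; the
scalars are the coordinates of the factor l. -/
lemma exists_eq_mul_extHom (y : Rep F β)
    (hy : ∀ φ : Hom (resRep k y) (resRep k y), ∃ a : F, ∀ i v, φ.1 i v = a • v)
    (φ : Hom (resRep k y) (resRep k (y.baseChange K))) :
    ∃ l : K, ∀ i v r, φ.1 i v r = l * algebraMap F K (v r) := by
  let b := Module.finBasis F K
  choose a ha using fun j => hy ((coordHom y (b.coord j)).comp φ)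
  refine ⟨∑ j, a j • b j, fun i v r => ?_⟩
  rw [← b.sum_repr (φ.1 i v r), Finset.sum_mul]
  refine Finset.sum_congr rfl fun j _ => ?_
  have h : b.repr (φ.1 i v r) j = a j * v r := congrFun (ha j i v) r
  rw [h, Algebra.smul_def, Algebra.smul_def, map_mul]
  ring

variable [Fintype I]

/-- The coordinate maps to the semistable y are jointly injective, which bounds all weights. -/
lemma ss_resRep_baseChange {c : I → ℚ} (y : Rep F β) (hy : (resRep k y).SS c) :
    (resRep k (y.baseChange K)).SS c := by
  let π : Fin (Module.finrank F K) → Hom (resRep k (y.baseChange K)) (resRep k y) := fun j =>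
    coordHom y ((Module.finBasis F K).coord j)
  refine ⟨?_, fun U hU => wt_nonpos_of_jointly_injective hy Finset.univ π hU fun i v _ h =>
    eq_zero_of_coordHom (k := k) (K := K) y i v fun j => h j (Finset.mem_univ j)⟩
  have h1 := hy.1
  rw [wt_top] at h1 ⊢
  have h2 : ∀ i, Module.finrank k (Fin (β i) → K) =
      Module.finrank k (Fin (β i) → F) * Module.finrank F K := fun i => by
    rw [Module.finrank_pi_fintype, Module.finrank_pi_fintype, Finset.sum_const, Finset.sum_const,
      smul_eq_mul, smul_eq_mul, mul_assoc, Module.finrank_mul_finrank]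
  have h3 : ∀ i, c i * (Module.finrank k (Fin (β i) → K) : ℚ) =
      c i * Module.finrank k (Fin (β i) → F) * Module.finrank F K := fun i => by
    rw [h2]; push_cast; ring
  rw [Finset.sum_congr rfl fun i _ => h3 i, ← Finset.sum_mul, h1, zero_mul]

lemma Stable.iso_of_hom_baseChange {c : I → ℚ} {M : QRep I k} (hM : M.Stable c) (y : Rep F β)
    (hy : (resRep k y).Stable c) {φ : Hom M (resRep k (y.baseChange K))} (h : φ ≠ 0) :
    Iso M (resRep k y) := by
  have h1 : ∃ j, (coordHom (K := K) y ((Module.finBasis F K).coord j)).comp φ ≠ 0 := by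
    by_contra hne
    push Not at hne
    refine h (Hom.ext' fun i v => eq_zero_of_coordHom (k := k) (K := K) y i _ fun j => ?_)
    exact congrArg (fun f : Hom M (resRep k y) => f.1 i v) (hne j)
  obtain ⟨j, hj⟩ := h1
  exact hM.iso_of_ne_zero hy hj

end Tower

/-! ### Absolute stability -/

variable [Fintype I]

/-- Stability together with the absence of nonscalar endomorphisms. -/
structure AbsStable {k : Type} [Field k] (c : I → ℚ) (M : QRep I k) : Prop where
  stable : M.Stable c
  scalar : M.ScalarEnd

lemma Iso.absStable {k : Type} [Field k] {c : I → ℚ} {M N : QRep I k} (h : Iso M N)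
    (hM : M.AbsStable c) : N.AbsStable c := ⟨h.stable hM.stable, h.scalarEnd hM.scalar⟩

variable {F K : Type} [Field F] [Field K] [Algebra F K] {β : I → ℕ} {c : I → ℚ}

/-- Let U be a nonzero K-subrepresentation of weight 0. Over F it contains a stable
subrepresentation, which has a nonzero coordinate map to y and is therefore a copy of y. Its
embedding is a multiple l ≠ 0 of the canonical inclusion of y. So U contains all multiples l e_r of
standard basis vectors, hence everything. -/
lemma AbsStable.stable_baseChange [Module.Finite F K] {y : Rep F β} (hy : (ofRep y).AbsStable c) :
    (ofRep (y.baseChange K)).Stable c := by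
  have hyS : (resRep F y).Stable c := hy.stable
  have hR : (resRep F (y.baseChange K)).SS c := ss_resRep_baseChange y hyS.ss
  have hn : (0 : ℚ) < Module.finrank F K := by exact_mod_cast Module.finrank_pos
  have hwt := fun U => wt_restrictScalars (k := F) c (y.baseChange K) U
  refine ⟨fun h0 => hy.stable.1 ?_, ?_, fun U hU h1 h2 => ?_⟩
  · funext i
    refine (Submodule.eq_bot_iff _).2 fun v _ => ?_
    have h1 : (extHom (k := F) (K := K) y).1 i v ∈
        (⊤ : ∀ i, Submodule K ((ofRep (y.baseChange K)).V i)) i := trivial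
    rw [h0] at h1
    have h1 : (extHom (k := F) (K := K) y).1 i v = 0 := h1
    funext r
    have h2 := congrFun h1 r
    rw [extHom_apply] at h2
    exact (map_eq_zero _).1 h2
  · have h1 := hwt ⊤
    have h2 : wt (M := resRep F (y.baseChange K)) c
      (fun i => (⊤ : Submodule K (Fin (β i) → K)).restrictScalars F) = 0 := hR.1
    have h3 := h1.symm.trans h2
    exact (mul_eq_zero.1 h3).resolve_left hn.ne'
  · let U' : ∀ i, Submodule F ((resRep F (y.baseChange K)).V i) :=
      fun i => (U i).restrictScalars F
    have hU' : (resRep F (y.baseChange K)).IsSub U' := fun i j h v hv => hU h v hv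
    have h3 := hR.2 U' hU'
    rw [hwt U] at h3
    refine lt_of_le_of_ne (by by_contra hp; nlinarith [mul_pos hn (not_le.1 hp)]) fun h0 => h2 ?_
    have h4 : wt c U' = 0 := by rw [hwt U, h0, mul_zero]
    have h5 : U' ≠ ⊥ := fun hb => h1 <| funext fun i => by
      have := congrFun hb i
      exact (Submodule.restrictScalars_eq_bot_iff F K (Fin (β i) → K)).1 this
    obtain ⟨W, hW, hWU, hWs⟩ := hR.exists_stable_sub hU' h4 h5
    have h6 : (resRep F (y.baseChange K)).incl W hW ≠ 0 := fun h0 => hWs.1 <| by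
      rw [← (Hom.inj_iff _).1 (incl_inj _ W hW), (Hom.ker_eq_top_iff _).2 h0]
    obtain ⟨f, hf, -⟩ := (hWs.iso_of_hom_baseChange y hyS h6).symm
    obtain ⟨l, hl⟩ := exists_eq_mul_extHom y hy.scalar (((resRep F (y.baseChange K)).incl W hW).comp f)
    have hl0 : l ≠ 0 := fun h0 => hyS.1 <| by
      funext i
      refine (Submodule.eq_bot_iff _).2 fun v _ => hf i ?_
      rw [map_zero]
      refine incl_inj _ W hW i ?_
      funext r
      rw [map_zero]
      refine (hl i v r).trans ?_
      rw [h0, zero_mul]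
      rfl
    funext i
    refine eq_top_iff.2 fun v _ => ?_
    have h7 : ∀ r : Fin (β i), (Pi.single r 1 : Fin (β i) → K) ∈ U i := fun r => by
      let w : W i := f.1 i (Pi.single r 1)
      have h8 : (w : Fin (β i) → K) ∈ U i := hWU i w.2
      have h9 : (w : Fin (β i) → K) = l • (Pi.single r 1 : Fin (β i) → K) := by
        funext s
        refine (hl i (Pi.single r 1) s).trans ?_
        rw [Pi.smul_apply, smul_eq_mul, Pi.single_apply, Pi.single_apply]
        split_ifs <;> simp
      rw [h9] at h8
      exact ((U i).smul_mem_iff hl0).1 h8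
    rw [← Finset.univ_sum_single v]
    refine Submodule.sum_mem _ fun r _ => ?_
    have : (Pi.single r (v r) : Fin (β i) → K) = v r • Pi.single r 1 := by
      rw [← Pi.single_smul, smul_eq_mul, mul_one]
    rw [this]
    exact Submodule.smul_mem _ _ (h7 r)

/-- At a vertex where β does not vanish, φ acquires an eigenvalue l over the splitting field of its
characteristic polynomial. There φ - l is not injective, so it is zero by Schur's lemma. The
matrices of φ have entries in F, so l lies in F. -/
lemma scalarEnd_of_stable_baseChange {y : Rep F β} (hβ : β ≠ 0)
    (h : ∀ (L : Type) [Field L] [Algebra F L] [FiniteDimensional F L],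
      (ofRep (y.baseChange L)).Stable c) : (ofRep y).ScalarEnd := by
  intro φ
  obtain ⟨i₀, hi₀⟩ := Function.ne_iff.1 hβ
  have hne : Nonempty (Fin (β i₀)) := ⟨⟨0, Nat.pos_of_ne_zero hi₀⟩⟩
  let A : ∀ i, Matrix (Fin (β i)) (Fin (β i)) F := fun i => LinearMap.toMatrix' (φ.1 i)
  have hA : ∀ i v, φ.1 i v = (A i).mulVec v := fun i v => (LinearMap.toMatrix'_mulVec _ _).symm
  let p := (A i₀).charpoly
  let L := p.SplittingField
  have hdeg : (p.map (algebraMap F L)).degree ≠ 0 := by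
    rw [degree_map, Matrix.charpoly_degree_eq_dim, Fintype.card_fin]
    exact_mod_cast hi₀
  obtain ⟨l, hl⟩ := (SplittingField.splits p).exists_eval_eq_zero hdeg
  let ψ : Hom (ofRep (y.baseChange L)) (ofRep (y.baseChange L)) :=
    ⟨fun i => ((A i).map (algebraMap F L)).mulVecLin, fun i j h v => by
      have h1 : A j * y h = y h * A i := by
        apply Matrix.toLin'.injective
        refine LinearMap.ext fun w => ?_
        rw [Matrix.toLin'_apply, Matrix.toLin'_apply, ← Matrix.mulVec_mulVec, ← Matrix.mulVec_mulVec,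
          ← hA, ← hA]
        exact φ.comm h w
      change ((A j).map _).mulVec (((y h).map _).mulVec v) = ((y h).map _).mulVec (((A i).map _).mulVec v)
      rw [Matrix.mulVec_mulVec, Matrix.mulVec_mulVec, ← Matrix.map_mul, ← Matrix.map_mul, h1]⟩
  have hst := h L
  have h0 : ψ - l • Hom.id _ = 0 := by
    by_contra hne0
    have hinj := hst.inj_of_ne_zero hst.ss hne0 i₀
    have hdet : (l • (1 : Matrix (Fin (β i₀)) (Fin (β i₀)) L) - (A i₀).map (algebraMap F L)).det = 0 := by
      have h1 := Matrix.charpoly_map (A i₀) (algebraMap F L)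
      rw [← h1, Matrix.eval_charpoly] at hl
      rw [← hl, Matrix.smul_one_eq_diagonal]
      rfl
    obtain ⟨v, hv, hv0⟩ := Matrix.exists_mulVec_eq_zero_iff.2 hdet
    refine hv (hinj ?_)
    rw [map_zero]
    rw [Matrix.sub_mulVec, Matrix.smul_mulVec, Matrix.one_mulVec, sub_eq_zero] at hv0
    change ((A i₀).map (algebraMap F L)).mulVec v - l • v = 0
    rw [hv0, sub_self]
  have h1 : ∀ i r s, algebraMap F L (A i r s) = if r = s then l else 0 := fun i r s => by
    have h2 : ((A i).map (algebraMap F L)).mulVec (Pi.single s 1) - l • Pi.single s 1 = 0 :=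
      congrArg (fun f : Hom _ _ => f.1 i (Pi.single s 1)) h0
    have h3 := congrFun h2 r
    rw [Pi.sub_apply, Matrix.mulVec_single_one, Pi.smul_apply, Pi.single_apply, Pi.zero_apply,
      sub_eq_zero] at h3
    refine Eq.trans h3 ?_
    split_ifs <;> simp
  obtain ⟨r₀⟩ := hne
  refine ⟨A i₀ r₀ r₀, fun i v => ?_⟩
  have hl : algebraMap F L (A i₀ r₀ r₀) = l := by rw [h1, if_pos rfl]
  have h2 : A i = (A i₀ r₀ r₀) • 1 := by
    ext r s
    apply (algebraMap F L).injective
    rw [h1, Matrix.smul_apply, Matrix.one_apply, smul_eq_mul, map_mul, hl]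
    split_ifs <;> simp
  rw [hA, h2, Matrix.smul_mulVec, Matrix.one_mulVec]

lemma Stable.ne_zero_of_ofRep {y : Rep F β} (h : (ofRep y).Stable c) : β ≠ 0 := by
  rintro rfl
  exact h.1 (funext fun i => (Submodule.eq_bot_iff _).2 fun v _ => funext fun a => a.elim0)

/-- A finite extension of K is one of F, so stability persists over it, and stability over all of
them forces the endomorphisms over K to be scalars. -/
lemma AbsStable.baseChange [Module.Finite F K] {y : Rep F β} (hy : (ofRep y).AbsStable c) :
    (ofRep (y.baseChange K)).AbsStable c := by
  refine ⟨hy.stable_baseChange, scalarEnd_of_stable_baseChange (c := c)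
    hy.stable.ne_zero_of_ofRep fun L _ _ _ => ?_⟩
  let _ : Algebra F L := Algebra.compHom L (algebraMap F K)
  have : IsScalarTower F K L := IsScalarTower.of_algebraMap_eq fun _ => rfl
  have : Module.Finite F L := Module.Finite.trans K L
  have h := hy.stable_baseChange (K := L)
  have h1 : (y.baseChange K).baseChange L = y.baseChange L := by
    funext i j e
    exact Matrix.ext fun r s => rfl
  rwa [h1]

-- This replaces the quantification over all finite extensions by a condition on endomorphisms over
-- the given field.
omit [Algebra F K] [Field K] in
theorem _root_.QuiverCount.isAbsolutelyStable_iff (θ : I → ℤ) (y : Rep F β) :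
    IsAbsolutelyStable θ y ↔ β ≠ 0 ∧ (ofRep y).AbsStable (cw θ (slope θ β)) := by
  constructor
  · rintro ⟨h1, h2⟩
    obtain ⟨hβ, h1⟩ := (isStable_iff θ y).1 h1
    exact ⟨hβ, h1, scalarEnd_of_stable_baseChange hβ fun L _ _ _ =>
      ((isStable_iff θ _).1 (h2 L)).2⟩
  · rintro ⟨hβ, h⟩
    exact ⟨(isStable_iff θ y).2 ⟨hβ, h.stable⟩, fun L _ _ _ =>
      (isStable_iff θ _).2 ⟨hβ, h.stable_baseChange⟩⟩

end Scalars

end QRep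

namespace QRep

/-! ### Stable representations as absolutely stable ones over the endomorphism field -/

section EndField

variable {I : Type u} [Quiver.{v} I] {k : Type} [Field k]

/-- The endomorphism algebra. -/
def endAlg (S : QRep I k) : Subalgebra k (∀ i, Module.End k (S.V i)) where
  carrier := {φ | ∀ ⦃i j : I⦄ (h : i ⟶ j) (v : S.V i), φ j (S.map h v) = S.map h (φ i v)}
  mul_mem' := fun {a b} ha hb i j h v => by
    change a j (b j _) = S.map h (a i (b i v))
    rw [hb, ha]
  add_mem' := fun ha hb => (homs S S).add_mem ha hb
  algebraMap_mem' := fun a i j h v => ((S.map h).map_smul a v).symm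

variable [Fintype I]

lemma Stable.isDomain_endAlg {c : I → ℚ} {S : QRep I k} (hS : S.Stable c) :
    IsDomain S.endAlg := by
  have hne : Nontrivial S.endAlg := by
    refine ⟨⟨0, 1, fun h => hS.1 ?_⟩⟩
    funext i
    refine (Submodule.eq_bot_iff _).2 fun v _ => ?_
    have := congrArg (fun f : S.endAlg => f.1 i v) h
    exact this.symm
  have : NoZeroDivisors S.endAlg := by
    refine ⟨fun {a b} hab => ?_⟩
    by_contra hne
    push Not at hne
    let φ : Hom S S := ⟨a.1, a.2⟩
    have hφ : φ ≠ 0 := fun h => hne.1 (Subtype.ext (congrArg Subtype.val h))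
    have hi := hS.inj_of_ne_zero hS.ss hφ
    refine hne.2 (Subtype.ext (funext fun i => LinearMap.ext fun v => hi i ?_))
    have := congrArg (fun f : S.endAlg => f.1 i v) hab
    refine Eq.trans this ?_
    exact (map_zero (φ.1 i)).symm
  exact NoZeroDivisors.to_isDomain _

/-- An F-subrepresentation is also a k-subrepresentation, and its weight over k is [F : k] times
that over F. -/
lemma absStable_of_resRep {c : I → ℚ} {F : Type} [Field F] [Algebra k F] [Module.Finite k F]
    {B : I → ℕ} (y : Rep F B) (hst : (resRep k y).Stable c)
    (hscal : ∀ φ : Hom (resRep k y) (resRep k y), ∃ a : F, ∀ i v, φ.1 i v = a • v) :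
    (ofRep y).AbsStable c := by
  have hpos : (0 : ℚ) < Module.finrank k F := by exact_mod_cast Module.finrank_pos
  refine ⟨⟨fun h0 => hst.1 ?_, ?_, ?_⟩, fun φ => ?_⟩
  · funext i
    exact (Submodule.eq_bot_iff _).2 fun v _ => (Submodule.eq_bot_iff _).1 (congrFun h0 i) v trivial
  · have h1 := wt_restrictScalars (k := k) c y ⊤
    exact (mul_eq_zero.1 (h1.symm.trans hst.2.1)).resolve_left hpos.ne'
  · intro U hU h1 h2
    have h3 := hst.2.2 (fun i => (U i).restrictScalars k) (fun i j h v hv => hU h v hv)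
      (fun hb => h1 (funext fun i =>
        (Submodule.restrictScalars_eq_bot_iff k F _).1 (congrFun hb i)))
      (fun hb => h2 (funext fun i =>
        (Submodule.restrictScalars_eq_top_iff k F _).1 (congrFun hb i)))
    rw [wt_restrictScalars] at h3
    by_contra hp
    nlinarith [mul_nonneg hpos.le (not_lt.1 hp)]
  · let φ' : Hom (resRep k y) (resRep k y) :=
      ⟨fun i => (φ.1 i).restrictScalars k, fun i j h v => φ.2 h v⟩
    exact hscal φ'

variable [Finite k]

/-- By Schur's lemma End S is a finite domain, hence a field F by Wedderburn's theorem. The arrows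
act F-linearly, so S is a representation over F, and there its endomorphisms are the scalars. -/
theorem Stable.exists_descent {c : I → ℚ} {S : QRep I k} (hS : S.Stable c) :
    ∃ (F : Type) (_ : Field F) (_ : Algebra k F) (_ : Module.Finite k F) (B : I → ℕ) (y : Rep F B),
      (ofRep y).AbsStable c ∧ Iso S (resRep k y) ∧
      (∀ φ : Hom (resRep k y) (resRep k y), ∃ a : F, ∀ i v, φ.1 i v = a • v) ∧
      numHom S S = Nat.card k ^ Module.finrank k F := by
  have hd := hS.isDomain_endAlg
  have hcard : Nat.card S.endAlg = numHom S S := rfl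
  have hfin : Finite S.endAlg := finite_hom S S
  let _ : Field S.endAlg := (Finite.isDomain_to_isField S.endAlg).toField
  -- The endomorphism algebra lives in the universe of the vertex set; being finite, it has a copy
  -- in `Type`.
  let F := Shrink.{0} S.endAlg
  let e : F ≃ₐ[k] S.endAlg := Shrink.algEquiv.{0} k S.endAlg
  have hFfin : Finite F := Finite.of_equiv _ e.symm.toEquiv
  let ρ : ∀ i, F →+* Module.End k (S.V i) := fun i =>
    (Pi.evalRingHom _ i).comp (S.endAlg.val.toRingHom.comp e.toAlgHom.toRingHom)
  let _ : ∀ i, Module F (S.V i) := fun i => Module.compHom (S.V i) (ρ i)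
  have hsmul : ∀ i (a : F) (v : S.V i), a • v = (e a).1 i v := fun i a v => rfl
  have htower : ∀ i, IsScalarTower k F (S.V i) := fun i => ⟨fun a b v => by
    rw [hsmul, hsmul, map_smul]
    rfl⟩
  have : Module.Finite k F := Module.Finite.of_finite
  have : ∀ i, Module.Finite F (S.V i) := fun i => Module.Finite.of_restrictScalars_finite k F _
  let E : ∀ i, S.V i ≃ₗ[F] (Fin (Module.finrank F (S.V i)) → F) := fun i =>
    (Module.finBasis F (S.V i)).equivFun
  let g : ∀ ⦃i j : I⦄, (i ⟶ j) → S.V i →ₗ[F] S.V j := fun i j h =>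
    { toFun := S.map h
      map_add' := map_add _
      map_smul' := fun a v => ((e a).2 h v).symm }
  let y : Rep F (fun i => Module.finrank F (S.V i)) := fun i j h =>
    LinearMap.toMatrix' ((E j).toLinearMap ∘ₗ g h ∘ₗ (E i).symm.toLinearMap)
  have hy : ∀ ⦃i j : I⦄ (h : i ⟶ j) v, (y h).mulVec (E i v) = E j (S.map h v) := fun i j h v => by
    change (LinearMap.toMatrix' _).mulVec _ = _
    rw [LinearMap.toMatrix'_mulVec]
    simp only [LinearMap.comp_apply, LinearEquiv.coe_coe, LinearEquiv.symm_apply_apply]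
    rfl
  let f : Hom S (resRep k y) := ⟨fun i => (E i).toLinearMap.restrictScalars k, fun i j h v =>
    (hy h v).symm⟩
  have hfi : f.Inj := fun i => (E i).injective
  have hfs : f.Surj := fun i => (E i).surjective
  have hiso : Iso S (resRep k y) := ⟨f, hfi, hfs⟩
  have hscal : ∀ φ : Hom (resRep k y) (resRep k y), ∃ a : F, ∀ i v, φ.1 i v = a • v := by
    intro φ
    let δ : Hom S S := (f.inv hfi hfs).comp (φ.comp f)
    let δ' : S.endAlg := ⟨δ.1, δ.2⟩
    refine ⟨e.symm δ', fun i v => ?_⟩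
    obtain ⟨w, rfl⟩ := hfs i v
    have h1 : f.1 i (δ.1 i w) = φ.1 i (f.1 i w) := f.apply_inv hfi hfs i _
    rw [← h1]
    have h2 : f.1 i (e.symm δ' • w) = e.symm δ' • f.1 i w := (E i).map_smul _ _
    rw [← h2, hsmul, AlgEquiv.apply_symm_apply]
  have hst := hiso.stable hS
  refine ⟨F, inferInstance, inferInstance, inferInstance, _, y, absStable_of_resRep y hst hscal,
    hiso, hscal, ?_⟩
  rw [← hcard, Nat.card_congr e.symm.toEquiv]
  exact Module.natCard_eq_pow_finrank

end EndField

end QRep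

/-- Extension of scalars along a homomorphism. -/
def Rep.mapRep {I : Type u} [Quiver.{v} I] {F K : Type} [Field F] [Field K] {B : I → ℕ}
    (y : Rep F B) (τ : F →+* K) : Rep K B := fun _ _ h => (y h).map τ

namespace QRep

/-! ### Absolutely stable representations of an extension field -/

section Descent

variable {I : Type u} [Quiver.{v} I] {k F K : Type} [Field k] [Field F] [Field K] [Algebra k F]
  [Algebra k K] [Module.Finite k F] [Module.Finite k K] {β : I → ℕ}

lemma exists_hom_mapRep (y : Rep F β) (τ : F →ₐ[k] K) :
    ∃ f : Hom (resRep k y) (resRep k (y.mapRep τ.toRingHom)), ∀ i v r, f.1 i v r = τ (v r) := by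
  let _ : Algebra F K := τ.toRingHom.toAlgebra
  have : IsScalarTower k F K := IsScalarTower.of_algebraMap_eq fun x => (τ.commutes x).symm
  have : Module.Finite F K := Module.Finite.of_restrictScalars_finite k F K
  exact ⟨extHom (k := k) (K := K) y, fun _ _ _ => rfl⟩

lemma exists_eq_mul_map (y : Rep F β) (τ : F →ₐ[k] K)
    (hy : ∀ φ : Hom (resRep k y) (resRep k y), ∃ a : F, ∀ i v, φ.1 i v = a • v)
    (φ : Hom (resRep k y) (resRep k (y.mapRep τ.toRingHom))) :
    ∃ l : K, ∀ i v r, φ.1 i v r = l * τ (v r) := by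
  let _ : Algebra F K := τ.toRingHom.toAlgebra
  have : IsScalarTower k F K := IsScalarTower.of_algebraMap_eq fun x => (τ.commutes x).symm
  have : Module.Finite F K := Module.Finite.of_restrictScalars_finite k F K
  exact exists_eq_mul_extHom (k := k) (K := K) y hy φ

/-- A homomorphism over the larger field, considered over the smaller one. -/
def resHom (k : Type) [Field k] [Algebra k K] [Module.Finite k K] {β' : I → ℕ} {t : Rep K β}
    {t' : Rep K β'} (f : Hom (ofRep t) (ofRep t')) : Hom (resRep k t) (resRep k t') :=
  ⟨fun i => (f.1 i).restrictScalars k, fun _ _ h v => f.2 h v⟩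

/-- Multiplication by an element of the larger field. -/
def scaleHom (k : Type) [Field k] [Algebra k K] [Module.Finite k K] (t : Rep K β) (l : K) :
    Hom (resRep k t) (resRep k t) := resHom k (l • Hom.id (ofRep t))

omit [Quiver.{v} I] [Module.Finite k K] in
lemma exists_restrictScalars_eq (U : ∀ i, Submodule k (Fin (β i) → K))
    (h : ∀ i (l : K), ∀ v ∈ U i, l • v ∈ U i) :
    ∃ U' : ∀ i, Submodule K (Fin (β i) → K), (fun i => (U' i).restrictScalars k) = U :=
  ⟨fun i => { (U i).toAddSubmonoid with smul_mem' := fun l v hv => h i l v hv }, rfl⟩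

/-- Composing the isomorphism with the inclusion of y along τ' gives a multiple of the inclusion
along τ. On it x ∈ F acts as τ' x when read at the source and as τ x when read at the target. -/
lemma algHom_eq_of_iso {B : I → ℕ} (hB : B ≠ 0) (y : Rep F B)
    (hy : ∀ φ : Hom (resRep k y) (resRep k y), ∃ a : F, ∀ i v, φ.1 i v = a • v)
    (τ τ' : F →ₐ[k] K) (h : Iso (ofRep (y.mapRep τ'.toRingHom)) (ofRep (y.mapRep τ.toRingHom))) :
    τ = τ' := by
  obtain ⟨f, hf, -⟩ := h
  obtain ⟨e, he⟩ := exists_hom_mapRep y τ'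
  obtain ⟨l, hl⟩ := exists_eq_mul_map y τ hy ((resHom k f).comp e)
  have hl : ∀ i v r, f.1 i (e.1 i v) r = l * τ (v r) := hl
  obtain ⟨i, hi⟩ := Function.ne_iff.1 hB
  let r : Fin (B i) := ⟨0, Nat.pos_of_ne_zero hi⟩
  have hl0 : l ≠ 0 := fun h0 => by
    have h1 : f.1 i (e.1 i 1) = f.1 i 0 := by
      funext s
      rw [hl, h0, zero_mul, map_zero]
      rfl
    have h2 := congrFun (hf i h1) r
    rw [he] at h2
    exact one_ne_zero ((map_one τ').symm.trans h2)
  refine AlgHom.ext fun x => ?_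
  have h1 : e.1 i (x • 1) = τ' x • e.1 i 1 := by
    funext s
    rw [he, Pi.smul_apply, Pi.smul_apply, he, smul_eq_mul, smul_eq_mul, map_mul]
  have h2 := hl i (x • 1) r
  rw [h1, map_smul, Pi.smul_apply, hl, smul_eq_mul, Pi.smul_apply, smul_eq_mul, Pi.one_apply,
    map_one, mul_one, mul_one, mul_comm] at h2
  exact (mul_left_cancel₀ hl0 h2).symm

variable [Fintype I]

omit [Module.Finite k F] in
lemma AbsStable.mapRep {c : I → ℚ} {y : Rep F β} (hy : (ofRep y).AbsStable c) (τ : F →ₐ[k] K) :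
    (ofRep (y.mapRep τ.toRingHom)).AbsStable c := by
  let _ : Algebra F K := τ.toRingHom.toAlgebra
  have : IsScalarTower k F K := IsScalarTower.of_algebraMap_eq fun x => (τ.commutes x).symm
  have : Module.Finite F K := Module.Finite.of_restrictScalars_finite k F K
  exact hy.baseChange (K := K)

lemma Stable.iso_of_hom_mapRep {c : I → ℚ} {M : QRep I k} (hM : M.Stable c) (y : Rep F β)
    (hy : (resRep k y).Stable c) (τ : F →ₐ[k] K)
    {φ : Hom M (resRep k (y.mapRep τ.toRingHom))} (h : φ ≠ 0) : Iso M (resRep k y) := by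
  let _ : Algebra F K := τ.toRingHom.toAlgebra
  have : IsScalarTower k F K := IsScalarTower.of_algebraMap_eq fun x => (τ.commutes x).symm
  have : Module.Finite F K := Module.Finite.of_restrictScalars_finite k F K
  exact hM.iso_of_hom_baseChange (K := K) y hy h

/-- Over k the stable y embeds into the extension of y', and a nonzero coordinate of this embedding
is an isomorphism from y to y'. -/
lemma iso_resRep_of_iso_mapRep {c : I → ℚ} {F' : Type} [Field F'] [Algebra k F']
    [Module.Finite k F'] {β' : I → ℕ} (y : Rep F β) (hy : (resRep k y).Stable c) (y' : Rep F' β')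
    (hy' : (resRep k y').Stable c) (τ : F →ₐ[k] K) (τ' : F' →ₐ[k] K)
    (h : Iso (ofRep (y.mapRep τ.toRingHom)) (ofRep (y'.mapRep τ'.toRingHom))) :
    Iso (resRep k y) (resRep k y') := by
  obtain ⟨f, hf, -⟩ := h
  obtain ⟨e, he⟩ := exists_hom_mapRep y τ
  refine hy.iso_of_hom_mapRep y' hy' τ' (φ := (resHom k f).comp e) fun h0 => hy.1 ?_
  funext i
  refine (Submodule.eq_bot_iff _).2 fun v _ => ?_
  have h1 : f.1 i (e.1 i v) = f.1 i 0 := by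
    rw [map_zero]
    exact congrArg (fun φ : Hom (resRep k y) (resRep k (y'.mapRep τ'.toRingHom)) => φ.1 i v) h0
  funext r
  have h2 := congrFun (hf i h1) r
  rw [he] at h2
  exact (map_eq_zero τ).1 h2

/-- The maximal destabilizing k-subrepresentation contains its images under multiplication by K, so
it is a K-subrepresentation and stability over K bounds its slope by m. -/
lemma ss_resRep {θ : I → ℤ} {m : ℚ} {t : Rep K β} (ht : (ofRep t).Stable (cw θ m)) :
    (resRep k t).SS (cw θ m) := by
  have hn : (0 : ℚ) < Module.finrank k K := by exact_mod_cast Module.finrank_pos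
  have hne : (resRep k t).Nonzero := fun h0 => ht.1 (funext fun i =>
    (Submodule.eq_bot_iff _).2 fun v _ => (Submodule.eq_bot_iff _).1 (congrFun h0 i) v trivial)
  have htop : wt (cw θ m) (⊤ : ∀ i, Submodule k ((resRep k t).V i)) = 0 := by
    refine (wt_restrictScalars (k := k) (cw θ m) t ⊤).trans ?_
    rw [ht.2.1, mul_zero]
  obtain ⟨μ, U, hU⟩ := exists_isMaxDestab hne θ
  obtain ⟨U', rfl⟩ := exists_restrictScalars_eq (k := k) (K := K) U fun i l v hv => by
    by_cases hl : l = 0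
    · rw [hl, zero_smul]
      exact Submodule.zero_mem _
    have hinj : (scaleHom k t l).Inj := fun j a b hab => smul_right_injective _ hl hab
    refine hU.le _ (hU.isSub.image (scaleHom k t l)) ?_ i ⟨v, hv, rfl⟩
    rw [wt_image_of_inj _ hinj, hU.wt_eq]
  have h1 := ht.ss.2 U' fun i j h v hv => hU.isSub h v hv
  have h2 := wt_restrictScalars (k := k) (cw θ m) t U'
  have h3 := wt_cw_shift (M := resRep k t) θ m μ fun i => (U' i).restrictScalars k
  rw [hU.wt_eq, h2] at h3
  have h4 : (0 : ℚ) < size (M := resRep k t) fun i => (U' i).restrictScalars k := by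
    exact_mod_cast size_pos hU.ne_bot
  have h5 : μ ≤ m := by
    by_contra hlt
    nlinarith [mul_pos (sub_pos.2 (not_le.1 hlt)) h4, mul_nonpos_of_nonneg_of_nonpos hn.le h1]
  refine ⟨htop, fun W hW => ?_⟩
  rw [wt_cw_shift θ m μ]
  have h6 := hU.wt_le W hW
  nlinarith [mul_nonneg (sub_nonneg.2 h5) (Nat.cast_nonneg (α := ℚ) (size W))]

/-- An endomorphism of a stable representation acts on the part generated by its images. -/
lemma Stable.exists_generated {c : I → ℚ} {S R : QRep I k} (hS : S.Stable c) (hR : R.SS c)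
    (δ : Hom S S) (hcomm : ∀ a : Hom S S, δ.comp a = a.comp δ) :
    ∃ (M : QRep I k) (f : Hom M R) (δM : Hom M M), M.SS c ∧ f.Inj ∧
      (∀ ψ : Hom S M, δM.comp ψ = ψ.comp δ) ∧
      (∀ U, M.IsSub U → (∀ ψ : Hom S M, ψ.range ≤ U) → U = ⊤) ∧
      ∀ ψ : Hom S R, ψ.range ≤ f.range := by
  classical
  let P : ℕ → Prop := fun n => ∃ (M : QRep I k) (f : Hom M R) (δM : Hom M M), M.SS c ∧ f.Inj ∧
      (∀ ψ : Hom S M, δM.comp ψ = ψ.comp δ) ∧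
      (∀ U, M.IsSub U → (∀ ψ : Hom S M, ψ.range ≤ U) → U = ⊤) ∧
      size (⊤ : ∀ i, Submodule k (M.V i)) = n
  have hbd : ∀ n, P n → n ≤ size (⊤ : ∀ i, Submodule k (R.V i)) := by
    rintro n ⟨M, f, -, -, hf, -, -, rfl⟩
    exact hf.size_le
  have h0 : P (size (⊤ : ∀ i, Submodule k ((zero I k).V i))) :=
    ⟨zero I k, 0, 0, ss_zero c, fun i a b _ => rfl, fun ψ => Hom.ext' fun i v => rfl,
      fun U _ _ => funext fun i => eq_top_iff.2 fun v _ => by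
        have : v = 0 := rfl
        rw [this]; exact Submodule.zero_mem _, rfl⟩
  obtain ⟨M, f, δM, hM, hf, hδ, hgen, hsz⟩ := Nat.findGreatest_spec (P := P) (hbd _ h0) h0
  refine ⟨M, f, δM, hM, hf, hδ, hgen, fun g => ?_⟩
  -- M was chosen with maximal total dimension. If g left the image of f, then S ⊕ M with δ acting
  -- on the new summand would be larger; this action is compatible with all homomorphisms from S
  -- because δ is central.
  by_contra hg
  have hinj := hS.coprod_inj hM hR hf hg
  have hP : P (size (⊤ : ∀ i, Submodule k ((S.prod M).V i))) := by
    refine ⟨S.prod M, coprod g f, lift (δ.comp (fst S M)) (δM.comp (snd S M)), hS.ss.prod hM, hinj,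
      fun ψ => ?_, fun U hU hψ => ?_, rfl⟩
    · refine Hom.ext' fun i v => Prod.ext ?_ ?_
      · rw [Hom.comp_apply, lift_apply]
        exact congrArg (fun a : Hom S S => a.1 i v) (hcomm ((fst S M).comp ψ))
      · rw [Hom.comp_apply, lift_apply]
        exact congrArg (fun a : Hom S M => a.1 i v) (hδ ((snd S M).comp ψ))
    · have h1 : (inr S M).comap U = ⊤ := hgen _ (hU.comap _) fun ψ => by
        rintro i _ ⟨v, rfl⟩
        exact hψ ((inr S M).comp ψ) i ⟨v, rfl⟩
      funext i
      refine eq_top_iff.2 fun v _ => ?_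
      have h2 : ((inl S M).1 i v.1 : (S.prod M).V i) ∈ U i := hψ (inl S M) i ⟨v.1, rfl⟩
      have h3 : v.2 ∈ (inr S M).comap U i := by rw [h1]; trivial
      have h4 : v = (inl S M).1 i v.1 + (inr S M).1 i v.2 := by
        rw [inl_apply, inr_apply, Prod.mk_add_mk, add_zero, zero_add]
      rw [h4]
      exact (U i).add_mem h2 h3
  have h1 := Nat.le_findGreatest (hbd _ hP) hP
  rw [← hsz] at h1
  have h2 : size (⊤ : ∀ i, Submodule k ((S.prod M).V i)) =
      size (⊤ : ∀ i, Submodule k (S.V i)) + size (⊤ : ∀ i, Submodule k (M.V i)) := by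
    simp only [size, Pi.top_apply, finrank_top, ← Finset.sum_add_distrib]
    exact Finset.sum_congr rfl fun i _ => Module.finrank_prod
  have h3 := size_pos hS.1
  omega

/-- The part of t generated over k by the images of S has weight 0 and is stable under K, so it is
all of t. The central δ induces an endomorphism D of it. Multiplication by K permutes the
homomorphisms from S, so D is K-linear, hence a scalar by absolute stability. -/
lemma AbsStable.exists_scalar {θ : I → ℤ} {m : ℚ} {t : Rep K β} (ht : (ofRep t).AbsStable (cw θ m))
    {S : QRep I k} (hS : S.Stable (cw θ m)) {ψ₀ : Hom S (resRep k t)} (hψ₀ : ψ₀ ≠ 0)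
    (δ : Hom S S) (hcomm : ∀ a : Hom S S, δ.comp a = a.comp δ) :
    ∃ a : K, ∀ (ψ : Hom S (resRep k t)) i v, ψ.1 i (δ.1 i v) = a • ψ.1 i v := by
  have hR := ss_resRep (k := k) ht.stable
  have hn : (Module.finrank k K : ℚ) ≠ 0 := by exact_mod_cast Module.finrank_pos.ne'
  obtain ⟨M, f, δM, hM, hf, hδ, hgen, hran⟩ := hS.exists_generated hR δ hcomm
  have hscale : ∀ i (l : K), ∀ v ∈ f.range i, l • v ∈ f.range i := by
    intro i l v hv
    have h1 : ((scaleHom k t l).comp f).comap f.range = ⊤ := by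
      refine hgen _ (f.isSub_range.comap _) fun ψ => ?_
      rintro j _ ⟨w, rfl⟩
      exact hran (((scaleHom k t l).comp f).comp ψ) j ⟨w, rfl⟩
    obtain ⟨w, rfl⟩ := hv
    have h2 : w ∈ ((scaleHom k t l).comp f).comap f.range i := by rw [h1]; trivial
    exact h2
  obtain ⟨U', hU'⟩ := exists_restrictScalars_eq (k := k) (K := K) f.range hscale
  have hU's : (ofRep t).IsSub U' := fun i j h v hv => by
    have h1 := f.isSub_range
    rw [← hU'] at h1
    exact h1 h v hv
  have hwt : wt (M := ofRep t) (cw θ m) U' = 0 := by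
    have h1 := hM.wt_range hR f
    rw [← hU', wt_restrictScalars] at h1
    exact (mul_eq_zero.1 h1).resolve_left hn
  have htop : U' = ⊤ := by
    refine (ht.stable.eq_bot_or_top hU's hwt).resolve_left fun hb => hψ₀ ?_
    rw [← Hom.range_eq_bot_iff, eq_bot_iff]
    refine (hran ψ₀).trans ?_
    rw [← hU', hb]
    intro i v hv
    exact hv
  have hfs : f.Surj := by
    rw [f.surj_iff, ← hU', htop]
    rfl
  have hgenR : ∀ U, (resRep k t).IsSub U → (∀ ψ : Hom S (resRep k t), ψ.range ≤ U) → U = ⊤ := by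
    intro U hU hψ
    have h1 := hgen _ (hU.comap f) fun ψ => by
      rintro j _ ⟨w, rfl⟩
      exact hψ (f.comp ψ) j ⟨w, rfl⟩
    funext i
    refine eq_top_iff.2 fun v _ => ?_
    obtain ⟨w, rfl⟩ := hfs i v
    have h2 : w ∈ f.comap U i := by rw [h1]; trivial
    exact h2
  let D : Hom (resRep k t) (resRep k t) := f.comp (δM.comp (f.inv hf hfs))
  have hD : ∀ (ψ : Hom S (resRep k t)) i v, D.1 i (ψ.1 i v) = ψ.1 i (δ.1 i v) := by
    intro ψ i v
    obtain ⟨ψ', rfl⟩ := Hom.exists_factor f hf ψ (hran ψ)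
    have h1 : (f.inv hf hfs).1 i (f.1 i (ψ'.1 i v)) = ψ'.1 i v := f.inv_apply hf hfs i _
    have h2 := congrArg (fun a : Hom S M => a.1 i v) (hδ ψ')
    change f.1 i (δM.1 i ((f.inv hf hfs).1 i (f.1 i (ψ'.1 i v)))) = f.1 i (ψ'.1 i (δ.1 i v))
    rw [h1]
    exact congrArg (f.1 i) h2
  have hlin : ∀ (l : K) i v, D.1 i (l • v) = l • D.1 i v := by
    intro l i v
    have h1 := hgenR _ (Hom.isSub_ker (D.comp (scaleHom k t l) - (scaleHom k t l).comp D))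
      fun ψ => by
        rintro j _ ⟨w, rfl⟩
        change D.1 j (l • ψ.1 j w) - l • D.1 j (ψ.1 j w) = 0
        have h2 : D.1 j (l • ψ.1 j w) = l • ψ.1 j (δ.1 j w) := hD ((scaleHom k t l).comp ψ) j w
        rw [h2, hD, sub_self]
    have h2 : v ∈ (D.comp (scaleHom k t l) - (scaleHom k t l).comp D).ker i := by rw [h1]; trivial
    exact sub_eq_zero.1 h2
  let D' : Hom (ofRep t) (ofRep t) :=
    ⟨fun i => { toFun := D.1 i, map_add' := map_add _, map_smul' := fun l v => hlin l i v },
      fun i j h v => D.2 h v⟩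
  obtain ⟨a, ha⟩ := ht.scalar D'
  exact ⟨a, fun ψ i v => (hD ψ i v).symm.trans (ha i _)⟩

/-- Each x ∈ F acts on the image of ψ through a scalar of K by `AbsStable.exists_scalar`. This
defines an embedding τ of F into K. The map ψ is τ-semilinear and extends to a nonzero K-linear
homomorphism between stable representations. -/
theorem AbsStable.exists_iso_mapRep {θ : I → ℤ} {m : ℚ} {t : Rep K β}
    (ht : (ofRep t).AbsStable (cw θ m)) {B : I → ℕ} {y : Rep F B}
    (hy : (ofRep y).AbsStable (cw θ m)) (hyS : (resRep k y).Stable (cw θ m))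
    (hyc : ∀ φ : Hom (resRep k y) (resRep k y), ∃ a : F, ∀ i v, φ.1 i v = a • v)
    {ψ : Hom (resRep k y) (resRep k t)} (hψ : ψ ≠ 0) :
    ∃ τ : F →ₐ[k] K, Iso (ofRep (y.mapRep τ.toRingHom)) (ofRep t) := by
  have h1 : ∀ x : F, ∃ a : K, ∀ i v, ψ.1 i (x • v) = a • ψ.1 i v := by
    intro x
    obtain ⟨a, ha⟩ := ht.exists_scalar hyS hψ (scaleHom k y x) fun φ => by
      obtain ⟨b, hb⟩ := hyc φ
      refine Hom.ext' fun i v => ?_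
      change x • φ.1 i v = φ.1 i (x • v)
      rw [hb, hb, smul_comm]
    exact ⟨a, fun i v => ha ψ i v⟩
  choose σ hσ using h1
  obtain ⟨i₀, v₀, hv₀⟩ : ∃ i v, ψ.1 i v ≠ 0 := by
    by_contra hne
    push Not at hne
    exact hψ (Hom.ext' hne)
  have hinj : ∀ a b : K, a • ψ.1 i₀ v₀ = b • ψ.1 i₀ v₀ → a = b := fun a b hab =>
    smul_left_injective K hv₀ hab
  let τ : F →ₐ[k] K :=
    { toFun := σ
      map_one' := hinj _ _ (by rw [← hσ, one_smul, one_smul])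
      map_mul' := fun a b => hinj _ _ (by rw [← hσ, mul_smul, mul_smul, hσ, hσ])
      map_zero' := hinj _ _ (by rw [← hσ, zero_smul, zero_smul, map_zero])
      map_add' := fun a b => hinj _ _ (by rw [← hσ, add_smul, map_add, add_smul, hσ, hσ])
      commutes' := fun a => hinj _ _ (by rw [← hσ, algebraMap_smul, algebraMap_smul, map_smul]) }
  have hτ : ∀ x i v, ψ.1 i (x • v) = τ x • ψ.1 i v := hσ
  -- The matrix of the K-linear extension of ψ: its columns are the images of the standard basis
  -- vectors.
  let P : ∀ i, Matrix (Fin (β i)) (Fin (B i)) K := fun i =>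
    Matrix.of fun r s => ψ.1 i (Pi.single s 1) r
  have hP : ∀ i v, (P i).mulVec (fun s => τ (v s)) = ψ.1 i v := by
    intro i v
    have h2 : v = ∑ s, v s • (Pi.single s 1 : Fin (B i) → F) := by
      conv_lhs => rw [← Finset.univ_sum_single v]
      exact Finset.sum_congr rfl fun s _ => by rw [← Pi.single_smul, smul_eq_mul, mul_one]
    conv_rhs => rw [h2]
    rw [map_sum]
    simp only [hτ]
    funext r
    rw [Finset.sum_apply]
    change ∑ s, ψ.1 i (Pi.single s 1) r * τ (v s) = ∑ s, τ (v s) * ψ.1 i (Pi.single s 1) r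
    exact Finset.sum_congr rfl fun s _ => mul_comm (ψ.1 i (Pi.single s 1) r) (τ (v s))
  have hcomm : ∀ ⦃i j : I⦄ (h : i ⟶ j), P j * (y.mapRep τ.toRingHom) h = t h * P i := by
    intro i j h
    ext r s
    have h2 := congrFun (ψ.2 h (Pi.single s 1)) r
    have h3 := congrFun (hP j ((y h).mulVec (Pi.single s 1))) r
    refine Eq.trans ?_ (h3.trans (h2.trans ?_))
    · change ∑ l, P j r l * τ (y h l s) = ∑ l, P j r l * τ ((y h).mulVec (Pi.single s 1) l)
      rw [Matrix.mulVec_single_one]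
      rfl
    · rfl
  let Ψ : Hom (ofRep (y.mapRep τ.toRingHom)) (ofRep t) :=
    ⟨fun i => (P i).mulVecLin, fun i j h v => by
      change (P j).mulVec (((y.mapRep τ.toRingHom) h).mulVec v) = (t h).mulVec ((P i).mulVec v)
      rw [Matrix.mulVec_mulVec, Matrix.mulVec_mulVec, hcomm]⟩
  refine ⟨τ, (hy.mapRep τ).stable.iso_of_ne_zero ht.stable (φ := Ψ) fun h0 => hv₀ ?_⟩
  rw [← hP]
  exact congrArg (fun φ : Hom (ofRep (y.mapRep τ.toRingHom)) (ofRep t) =>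
    φ.1 i₀ fun s => τ (v₀ s)) h0

end Descent

end QRep

namespace QRep

/-! ### Counting absolutely stable representations over extension fields -/

section Count

variable {I : Type u} [Quiver.{v} I] [Fintype I] {k : Type} [Field k]

/-- Absolutely stable representations over K correspond to pairs of an index j with B j = b and a
k-embedding of the endomorphism field of S j into K. There are d j such embeddings if d j divides [K
: k], and none otherwise. -/
theorem exists_descent_data [Finite k] {θ : I → ℤ} {m : ℚ} {ι : Type*} [Fintype ι]
    {S : ι → QRep I k} (hS : ∀ j, (S j).Stable (cw θ m))
    (hni : ∀ i j, Iso (S i) (S j) → i = j) {N : ℕ}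
    (hcomplete : ∀ T : QRep I k, T.Stable (cw θ m) → T.dimv.degree ≤ N → ∃ j, Iso (S j) T) :
    ∃ (d : ι → ℕ) (B : ι → I →₀ ℕ),
      (∀ j, d j ≠ 0 ∧ (S j).dimv = d j • B j ∧ numHom (S j) (S j) = Nat.card k ^ d j) ∧
      ∀ (K : Type) [Field K] [Algebra k K] [Module.Finite k K] (b : I →₀ ℕ), b ≠ 0 →
        slope θ b = m → Module.finrank k K * b.degree ≤ N →
        numAbsolutelyStable θ K b =
          ∑ j, if B j = b ∧ d j ∣ Module.finrank k K then d j else 0 := by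
  classical
  choose F iF iA iM B y hyA hyI hyE hyN using fun j => (hS j).exists_descent
  have hyS : ∀ j, (resRep k (y j)).Stable (cw θ m) := fun j => (hyI j).stable (hS j)
  let B' : ι → I →₀ ℕ := fun j => Finsupp.equivFunOnFinite.symm (B j)
  have hB' : ∀ j i, B' j i = B j i := fun _ _ => rfl
  refine ⟨fun j => Module.finrank k (F j), B', fun j =>
    ⟨Module.finrank_pos.ne', ?_, hyN j⟩, ?_⟩
  · rw [(hyI j).dimv_eq]
    ext i
    rw [dimv_apply, Finsupp.smul_apply, hB', smul_eq_mul]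
    rw [Module.finrank_pi_fintype, Finset.sum_const, Finset.card_univ, Fintype.card_fin,
      smul_eq_mul, mul_comm]
  intro K _ _ _ b hb hslope hN
  have hKfin : Finite K := Module.finite_of_finite k
  have hb' : (b : I → ℕ) ≠ 0 := fun h => hb (DFunLike.coe_injective h)
  let q : Rep K b → Quotient (MulAction.orbitRel (GLDim K b) (Rep K b)) := fun x => Quotient.mk _ x
  have hq : ∀ x x' : Rep K b, q x = q x' ↔ Iso (ofRep x) (ofRep x') := fun x x' =>
    Quotient.eq.trans (orbitRel_iff_iso x x')
  have habs : ∀ x : Rep K b, IsAbsolutelyStable θ x ↔ (ofRep x).AbsStable (cw θ m) := fun x => by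
    rw [isAbsolutelyStable_iff, hslope]
    exact and_iff_right hb'
  have hexists : ∀ x : q '' {x : Rep K b | IsAbsolutelyStable θ x},
      ∃ (x' : Rep K b) (p : Σ j, F j →ₐ[k] K), q x' = x.1 ∧
        Iso (ofRep ((y p.1).mapRep p.2.toRingHom)) (ofRep x') := by
    rintro ⟨_, x, hx, rfl⟩
    have hx' := (habs x).1 hx
    have hR := ss_resRep (k := k) hx'.stable
    have hdeg : size (⊤ : ∀ i, Submodule k ((resRep k x).V i)) ≤ N := by
      refine le_trans (le_of_eq ?_) hN
      rw [Finsupp.degree_eq_sum, Finset.mul_sum]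
      refine Finset.sum_congr rfl fun i _ => ?_
      rw [Pi.top_apply, finrank_top, Module.finrank_pi_fintype, Finset.sum_const, Finset.card_univ,
        Fintype.card_fin, smul_eq_mul, mul_comm]
    have hne : (resRep k x).Nonzero := fun h0 => hx'.stable.1 (funext fun i =>
      (Submodule.eq_bot_iff _).2 fun v _ => (Submodule.eq_bot_iff _).1 (congrFun h0 i) v trivial)
    obtain ⟨W, hW, hst⟩ := hR.exists_stable_hom hne
    obtain ⟨j, hj⟩ := hcomplete _ hst (by
      rw [degree_dimv]
      exact ((resRep k x).incl_inj W hW).size_le.trans hdeg)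
    obtain ⟨f, hf, -⟩ := (hyI j).symm.trans hj
    obtain ⟨τ, hτ⟩ := hx'.exists_iso_mapRep (hyA j) (hyS j) (hyE j)
      (ψ := ((resRep k x).incl W hW).comp f) fun h0 => (hyS j).1 (by
        have h1 := ((resRep k x).incl_inj W hW).comp hf
        rw [← (Hom.ker_eq_top_iff _).2 h0]
        exact (Hom.inj_iff _).1 h1)
    exact ⟨x, ⟨j, τ⟩, rfl, hτ⟩
  choose rep g hrep hg using hexists
  have hgB : ∀ x, B' (g x).1 = b := fun x => by
    have := (hg x).dimv_eq
    rw [dimv_ofRep] at this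
    rw [← this]
    ext i
    rw [dimv_apply, Module.finrank_fin_fun]
    rfl
  let G : q '' {x : Rep K b | IsAbsolutelyStable θ x} → Σ j, {_τ : F j →ₐ[k] K // B' j = b} :=
    fun x => ⟨(g x).1, (g x).2, hgB x⟩
  have hG : Function.Bijective G := by
    constructor
    · intro x x' h
      have h1 : g x = g x' := congrArg
        (fun p : Σ j, {_τ : F j →ₐ[k] K // B' j = b} => (⟨p.1, p.2.1⟩ : Σ j, F j →ₐ[k] K)) h
      have h2 := hg x'
      rw [← h1] at h2
      have h3 := (hq _ _).2 ((hg x).symm.trans h2)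
      exact Subtype.ext ((hrep x).symm.trans (h3.trans (hrep x')))
    · rintro ⟨j, τ, hj⟩
      obtain ⟨x, hx⟩ := exists_iso_ofRep (ofRep ((y j).mapRep τ.toRingHom)) (α := b) fun i => by
        rw [Module.finrank_fin_fun, ← hj]
        rfl
      have hxA : IsAbsolutelyStable θ x := (habs x).2 (hx.absStable ((hyA j).mapRep τ))
      let X : q '' {x : Rep K b | IsAbsolutelyStable θ x} := ⟨q x, x, hxA, rfl⟩
      refine ⟨X, ?_⟩
      have h1 : Iso (ofRep (rep X)) (ofRep x) := (hq _ _).1 (hrep X)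
      have h2 := ((hg X).trans h1).trans hx.symm
      -- The pair chosen for the class of this extension must be the given one: the index is
      -- recovered by comparison over k, and the embedding by `algHom_eq_of_iso`.
      generalize hp : g X = p at h2
      obtain ⟨j', τ'⟩ := p
      have h3 : j' = j := by
        refine hni _ _ ?_
        exact ((hyI j').trans (iso_resRep_of_iso_mapRep (y j') (hyS j') (y j) (hyS j) τ' τ h2)).trans
          (hyI j).symm
      subst h3
      have h4 : τ = τ' := algHom_eq_of_iso (hyA j').stable.ne_zero_of_ofRep (y j') (hyE j') τ τ' h2
      subst h4
      have h5 : ∀ p : Σ j, F j →ₐ[k] K, ∀ (hp : B' p.1 = b), g X = p →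
          G X = ⟨p.1, p.2, hp⟩ := by
        rintro p hp rfl
        rfl
      exact h5 ⟨j', τ⟩ hj hp
  have hfin : ∀ j, Finite {_τ : F j →ₐ[k] K // B' j = b} := fun j => inferInstance
  have hFfin : ∀ j, Finite (F j) := fun j => Module.finite_of_finite k
  change Nat.card (q '' {x : Rep K b | IsAbsolutelyStable θ x}) = _
  rw [Nat.card_congr (Equiv.ofBijective G hG), Nat.card_sigma]
  refine Finset.sum_congr rfl fun j _ => ?_
  by_cases hj : B' j = b
  · rw [Nat.card_congr (Equiv.subtypeUnivEquiv fun _ => hj)]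
    by_cases hd : Module.finrank k (F j) ∣ Module.finrank k K
    · rw [if_pos ⟨hj, hd⟩]
      exact FiniteField.natCard_algHom_of_finrank_dvd hd
    · rw [if_neg fun h => hd h.2, Nat.card_eq_zero]
      left
      rw [← not_nonempty_iff, FiniteField.nonempty_algHom_iff_finrank_dvd]
      exact hd
  · rw [if_neg fun h => hj h.1, Nat.card_eq_zero]
    exact Or.inl ⟨fun p => hj p.2⟩

end Count

end QRep

namespace QRep

/-! ### The twisted identity over a fixed finite field -/

section Numeric

variable {I : Type u} [Quiver.{v} I] [Fintype I] {k : Type} [Field k] [Finite k]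

omit [Quiver.{v} I] [Fintype I] in
lemma exists_extension (k : Type) [Field k] [Finite k] {n : ℕ} (hn : n ≠ 0) :
    ∃ (K : Type) (_ : Field K) (_ : Algebra k K) (_ : Module.Finite k K) (_ : Finite K),
      Module.finrank k K = n ∧ Nat.card K = Nat.card k ^ n := by
  obtain ⟨p, hp⟩ := CharP.exists k
  have : Fact p.Prime := ⟨CharP.char_is_prime k p⟩
  have : NeZero n := ⟨hn⟩
  exact ⟨FiniteField.Extension k p n, inferInstance, inferInstance, inferInstance, inferInstance,
    FiniteField.finrank_extension k p n, FiniteField.natCard_extension k p n⟩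

variable [∀ i j : I, Fintype (i ⟶ j)]

lemma exists_stable_family (c : I → ℚ) (N : ℕ) :
    ∃ (ι : Type (max u v)) (_ : Fintype ι) (S : ι → QRep I k), (∀ j, (S j).Stable c) ∧
      (∀ i j, Iso (S i) (S j) → i = j) ∧
      ∀ T : QRep I k, T.Stable c → T.dimv.degree ≤ N → ∃ j, Iso (S j) T := by
  classical
  let α : (I → Fin (N + 1)) → I → ℕ := fun a i => a i
  let J := Σ a : I → Fin (N + 1), Quotient (MulAction.orbitRel (GLDim k (α a)) (Rep k (α a)))
  have hJ : Finite J := inferInstance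
  let S : J → QRep I k := fun p => ofRep p.2.out
  refine ⟨{p : J // (S p).Stable c}, Fintype.ofFinite _, fun p => S p.1, fun p => p.2, ?_, ?_⟩
  · rintro ⟨⟨a, x⟩, hx⟩ ⟨⟨a', x'⟩, hx'⟩ h
    have h1 : a = a' := funext fun i => Fin.ext <| by
      have h2 := DFunLike.congr_fun h.dimv_eq i
      rw [dimv_apply, dimv_apply, Module.finrank_fin_fun, Module.finrank_fin_fun] at h2
      exact h2
    subst h1
    have h2 := Quotient.sound ((orbitRel_iff_iso _ _).2 h)
    rw [Quotient.out_eq, Quotient.out_eq] at h2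
    subst h2
    rfl
  · intro T hT hN
    have hle : ∀ i, Module.finrank k (T.V i) < N + 1 := fun i =>
      Nat.lt_succ_of_le ((Finsupp.le_degree i T.dimv).trans hN)
    let a : I → Fin (N + 1) := fun i => ⟨Module.finrank k (T.V i), hle i⟩
    obtain ⟨x, hx⟩ := exists_iso_ofRep T (α := α a) fun i => rfl
    let p : J := ⟨a, Quotient.mk _ x⟩
    have h1 : Iso (S p) T :=
      ((orbitRel_iff_iso _ _).1 (Quotient.exact (Quotient.out_eq (Quotient.mk _ x)))).trans hx.symm
    exact ⟨⟨p, h1.symm.stable hT⟩, h1⟩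

omit [Quiver.{v} I] [Fintype I] [Finite k] [Field k] [∀ i j : I, Fintype (i ⟶ j)] in
lemma dvd_and_div_eq_iff {γ b : I →₀ ℕ} {n : ℕ} (hn : n ≠ 0) :
    ((∀ i, n ∣ γ i) ∧ b = γ.mapRange (· / n) (Nat.zero_div n)) ↔ n • b = γ := by
  constructor
  · rintro ⟨h, rfl⟩
    ext i
    exact Nat.mul_div_cancel' (h i)
  · rintro rfl
    refine ⟨fun i => Dvd.intro (b i) rfl, ?_⟩
    ext i
    exact (Nat.mul_div_cancel_left (b i) (Nat.pos_of_ne_zero hn)).symm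

-- Reindex by n = d l: then 1/l = d/n and (Q ^ d) ^ l = Q ^ n. The factor d is the number of
-- embeddings counted in `exists_descent_data`.
omit [Quiver.{v} I] [Fintype I] [Finite k] [Field k] [∀ i j : I, Fintype (i ⟶ j)] in
lemma coeff_qLogSeries_nsmul [DecidableEq I] (Q : ℚ) {d : ℕ} (hd : d ≠ 0) {B : I →₀ ℕ} (hB : B ≠ 0)
    (γ : I →₀ ℕ) :
    MvPowerSeries.coeff γ (qLogSeries (Q ^ d) 1 (d • B)) =
      ∑ n ∈ Finset.Icc 1 γ.degree,
        if n • B = γ ∧ d ∣ n then (n : ℚ)⁻¹ * (1 - Q ^ n)⁻¹ * d else 0 := by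
  have hdB : d • B ≠ 0 := smul_ne_zero hd hB
  have hB0 : B.degree ≠ 0 := fun h => hB ((Finsupp.degree_eq_zero_iff B).1 h)
  rw [qLogSeries, coeff_ray hdB _ γ _ (Nat.lt_succ_self _)]
  have h1 : ∀ l ∈ Finset.range (γ.degree + 1),
      (if l • d • B = γ then PowerSeries.coeff l (PowerSeries.mk fun n : ℕ =>
        (n : ℚ)⁻¹ * (1 - (Q ^ d) ^ n)⁻¹ * 1 ^ n) else 0) =
      if l • d • B = γ ∧ l ≠ 0 then (l : ℚ)⁻¹ * (1 - (Q ^ d) ^ l)⁻¹ else 0 := by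
    intro l _
    rw [PowerSeries.coeff_mk, one_pow, mul_one]
    by_cases hl : l = 0
    · simp [hl]
    · simp [hl]
  rw [Finset.sum_congr rfl h1, ← Finset.sum_filter, ← Finset.sum_filter]
  refine Finset.sum_nbij' (· * d) (· / d) ?_ ?_ ?_ ?_ ?_
  · intro l hl
    obtain ⟨-, hl, hl0⟩ := Finset.mem_filter.1 hl
    refine Finset.mem_filter.2 ⟨Finset.mem_Icc.2 ⟨Nat.one_le_iff_ne_zero.2 (mul_ne_zero hl0 hd), ?_⟩,
      by rw [mul_smul, hl], dvd_mul_left d l⟩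
    have h2 := congrArg Finsupp.degree hl
    rw [map_nsmul, map_nsmul, smul_eq_mul, smul_eq_mul, ← mul_assoc] at h2
    rw [← h2]
    exact Nat.le_mul_of_pos_right _ (Nat.pos_of_ne_zero hB0)
  · intro n hn
    obtain ⟨hn1, hn2, l, rfl⟩ := Finset.mem_filter.1 hn
    rw [Finset.mem_Icc] at hn1
    have hl : d * l / d = l := Nat.mul_div_cancel_left l (Nat.pos_of_ne_zero hd)
    simp only [hl]
    refine Finset.mem_filter.2 ⟨Finset.mem_range.2 ?_, by rw [← mul_smul, mul_comm, hn2], ?_⟩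
    · exact Nat.lt_succ_of_le ((Nat.le_mul_of_pos_left l (Nat.pos_of_ne_zero hd)).trans hn1.2)
    · rintro rfl
      simp at hn1
  · intro l _
    exact Nat.mul_div_cancel l (Nat.pos_of_ne_zero hd)
  · intro n hn
    exact Nat.div_mul_cancel (Finset.mem_filter.1 hn).2.2
  · intro l _
    have hd' : (d : ℚ) ≠ 0 := Nat.cast_ne_zero.2 hd
    push_cast
    rw [mul_inv, ← pow_mul, mul_comm d l]
    field_simp

/-- The counts over extensions enter through an arbitrary function e, so the identity serves both
before polynomiality is known, with counts over chosen fields, and after it, with values of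
polynomials at powers of #k. -/
theorem numeric_identity [DecidableEq I] (θ : I → ℤ) (m : ℚ) (e : ℕ → (I →₀ ℕ) → ℚ)
    (he : ∀ (n : ℕ) (b : I →₀ ℕ), n ≠ 0 → b ≠ 0 → slope θ b = m →
      ∃ (K : Type) (_ : Field K) (_ : Algebra k K) (_ : Module.Finite k K),
        Module.finrank k K = n ∧ e n b = numAbsolutelyStable θ K b)
    (he0 : ∀ (n : ℕ) (b : I →₀ ℕ), ¬ (b ≠ 0 ∧ slope θ b = m) → e n b = 0)
    {f E : MvPowerSeries I ℚ}
    (hf : ∀ γ, MvPowerSeries.coeff γ f = ∑ n ∈ Finset.Icc 1 γ.degree, if ∀ i, n ∣ γ i then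
      (n : ℚ)⁻¹ * (1 - (Nat.card k : ℚ) ^ n)⁻¹ * e n (γ.mapRange (· / n) (Nat.zero_div n)) else 0)
    (hE : IsExp f E) (α : I →₀ ℕ) (hα : α ≠ 0) :
    ∑ p ∈ Finset.HasAntidiagonal.antidiagonal α,
      (Nat.card k : ℚ) ^ (-ringelForm (fun i => (p.1 i : ℤ)) (fun i => (p.2 i : ℤ))) *
        ((numSS (cw θ m) k p.1 : ℚ) / Nat.card (GLDim k p.1) * MvPowerSeries.coeff p.2 E) = 0 := by
  classical
  -- Only coefficients of degree up to that of α enter, so finitely many stable representations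
  -- suffice.
  obtain ⟨ι, _, S, hS, hni, hcomplete⟩ := exists_stable_family (k := k) (cw θ m) α.degree
  obtain ⟨d, B, hdB, hcount⟩ := exists_descent_data hS hni hcomplete
  have hB0 : ∀ j, B j ≠ 0 := fun j h => (hS j).1.dimv_ne_zero (by rw [(hdB j).2.1, h, smul_zero])
  have hBm : ∀ j, slope θ (B j) = m := fun j => by
    refine (sum_cw_eq_zero_iff θ m (B j) fun h => hB0 j ?_).1 ?_
    · rw [← Finsupp.degree_eq_sum] at h
      exact (Finsupp.degree_eq_zero_iff _).1 h
    · have h1 := (hS j).2.1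
      rw [wt_top] at h1
      have h2 : ∀ i, cw θ m i * (Module.finrank k ((S j).V i) : ℚ) =
          d j * (cw θ m i * B j i) := fun i => by
        rw [← dimv_apply, (hdB j).2.1, Finsupp.smul_apply, smul_eq_mul]
        push_cast
        ring
      rw [Finset.sum_congr rfl fun i _ => h2 i, ← Finset.mul_sum] at h1
      exact (mul_eq_zero.1 h1).resolve_left (Nat.cast_ne_zero.2 (hdB j).1)
  have hexp : IsExp (∑ j, qLogSeries (numHom (S j) (S j) : ℚ) 1 (S j).dimv) (stableSeries S) := by
    refine isExp_sum Finset.univ fun j _ => isExp_qExpSeries (fun n => ?_) 1 (hS j).1.dimv_ne_zero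
    have h1 : (1 : ℚ) < numHom (S j) (S j) := by exact_mod_cast (hS j).one_lt_numHom_self
    exact (one_lt_pow₀ h1 (Nat.succ_ne_zero n)).ne'
  -- The logarithms agree: for fixed n with γ = n b, the terms of the stable representations with B
  -- j = b and d j ∣ n add up to the count over the extension of degree n.
  have hagree : ∀ γ : I →₀ ℕ, γ.degree ≤ α.degree → MvPowerSeries.coeff γ f =
      MvPowerSeries.coeff γ (∑ j, qLogSeries (numHom (S j) (S j) : ℚ) 1 (S j).dimv) := by
    intro γ hγ
    have h1 : ∀ j, MvPowerSeries.coeff γ (qLogSeries (numHom (S j) (S j) : ℚ) 1 (S j).dimv) =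
        ∑ n ∈ Finset.Icc 1 γ.degree, if n • B j = γ ∧ d j ∣ n then
          (n : ℚ)⁻¹ * (1 - (Nat.card k : ℚ) ^ n)⁻¹ * d j else 0 := fun j => by
      rw [(hdB j).2.1, (hdB j).2.2, Nat.cast_pow]
      exact coeff_qLogSeries_nsmul _ (hdB j).1 (hB0 j) γ
    rw [map_sum, Finset.sum_congr rfl fun j _ => h1 j, Finset.sum_comm, hf]
    refine Finset.sum_congr rfl fun n hn => ?_
    have hn0 : n ≠ 0 := Nat.one_le_iff_ne_zero.1 (Finset.mem_Icc.1 hn).1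
    by_cases hdvd : ∀ i, n ∣ γ i
    · rw [if_pos hdvd]
      set b := γ.mapRange (· / n) (Nat.zero_div n) with hb
      have hnb : n • b = γ := (dvd_and_div_eq_iff hn0).1 ⟨hdvd, hb⟩
      have h2 : ∀ j, n • B j = γ ↔ B j = b := fun j => by
        rw [← dvd_and_div_eq_iff hn0]
        exact and_iff_right hdvd
      have h3 : e n b = ∑ j, if B j = b ∧ d j ∣ n then (d j : ℚ) else 0 := by
        by_cases hbm : b ≠ 0 ∧ slope θ b = m
        · obtain ⟨K, _, _, _, hK, h4⟩ := he n b hn0 hbm.1 hbm.2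
          rw [h4, hcount K b hbm.1 hbm.2, hK]
          · push_cast
            exact Finset.sum_congr rfl fun j _ => by split_ifs <;> simp
          · rw [hK, ← smul_eq_mul, ← map_nsmul, hnb]
            exact hγ
        · rw [he0 n b hbm]
          refine (Finset.sum_eq_zero fun j _ => if_neg fun h => hbm ?_).symm
          rw [← h.1]
          exact ⟨hB0 j, hBm j⟩
      rw [h3, Finset.mul_sum]
      refine Finset.sum_congr rfl fun j _ => ?_
      simp only [h2]
      split_ifs <;> simp
    · rw [if_neg hdvd]
      refine (Finset.sum_eq_zero fun j _ => if_neg fun h => hdvd ?_).symm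
      exact ((dvd_and_div_eq_iff hn0).2 h.1).1
  rw [← twisted_inverse hS hni hcomplete α hα le_rfl]
  refine Finset.sum_congr rfl fun p hp => ?_
  rw [hE.coeff_congr hexp hagree p.2]
  rw [← Finset.HasAntidiagonal.mem_antidiagonal.1 hp, map_add]
  exact Nat.le_add_left _ _

end Numeric

end QRep

/-! ### Plethystic exponentials with integral coefficients -/

section Plethystic

variable {σ : Type*}

/-- The coefficientwise value of a power series at an integer. -/
def evSeries (n : ℕ) (f : MvPowerSeries σ (RatFunc ℚ)) : MvPowerSeries σ ℚ :=
  fun γ => evAt n (MvPowerSeries.coeff γ f)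

lemma coeff_evSeries (n : ℕ) (f : MvPowerSeries σ (RatFunc ℚ)) (γ : σ →₀ ℕ) :
    MvPowerSeries.coeff γ (evSeries n f) = evAt n (MvPowerSeries.coeff γ f) := rfl

lemma natCast_mem_regular (n : ℕ) : (n : RatFunc ℚ) ∈ regular := natCast_mem regular n

lemma evAt_natCast {m : ℕ} (hm : 2 ≤ m) (n : ℕ) : evAt m (n : RatFunc ℚ) = n := by
  have h := map_natCast (evHom m hm) n
  exact h

lemma natCast_inv_eq (n : ℕ) : (n : RatFunc ℚ)⁻¹ = RatFunc.C (n : ℚ)⁻¹ := by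
  rw [map_inv₀, map_natCast]

lemma natCast_inv_mem_regular (n : ℕ) : (n : RatFunc ℚ)⁻¹ ∈ regular := by
  rw [natCast_inv_eq]; exact C_mem_regular _

lemma evAt_natCast_inv (m n : ℕ) : evAt m (n : RatFunc ℚ)⁻¹ = (n : ℚ)⁻¹ := by
  rw [natCast_inv_eq, evAt_C]

/-- The recursion divides by the degree, which is harmless in `regular` but not in `monicRegular`;
integrality of the exponential needs the separate argument of `integralExp`. -/
lemma IsExp.coeff_mem_regular {f E : MvPowerSeries σ (RatFunc ℚ)} (h : IsExp f E)
    (hf : ∀ γ, MvPowerSeries.coeff γ f ∈ regular) (γ : σ →₀ ℕ) :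
    MvPowerSeries.coeff γ E ∈ regular := by
  classical
  induction hn : γ.degree using Nat.strong_induction_on generalizing γ with
  | _ n ih =>
  by_cases hγ : γ = 0
  · rw [hγ, h.1]
    exact regular.one_mem
  have hd : (γ.degree : RatFunc ℚ) ≠ 0 :=
    Nat.cast_ne_zero.2 fun h0 => hγ ((Finsupp.degree_eq_zero_iff γ).1 h0)
  have h1 := h.coeff_eq γ
  rw [← inv_mul_cancel_left₀ hd (MvPowerSeries.coeff γ E), h1]
  refine regular.mul_mem (natCast_inv_mem_regular _) (regular.sum_mem fun p hp => ?_)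
  by_cases hp0 : p.1 = 0
  · rw [hp0, map_zero, Nat.cast_zero, zero_mul, zero_mul]
    exact regular.zero_mem
  · exact regular.mul_mem (regular.mul_mem (natCast_mem_regular _) (hf _))
      (ih _ (hn ▸ degree_lt_of_mem_antidiagonal hp hp0) _ rfl)

lemma IsExp.evSeries {f E : MvPowerSeries σ (RatFunc ℚ)} (h : IsExp f E)
    (hf : ∀ γ, MvPowerSeries.coeff γ f ∈ regular) {n : ℕ} (hn : 2 ≤ n) :
    IsExp (evSeries n f) (evSeries n E) := by
  classical
  have hE := h.coeff_mem_regular hf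
  refine ⟨?_, ?_⟩
  · rw [coeff_evSeries, h.1, evAt_one]
  · ext γ
    rw [coeff_euler, coeff_evSeries, ← evAt_natCast hn,
      ← evAt_mul hn (natCast_mem_regular _) (hE γ), h.coeff_eq γ, MvPowerSeries.coeff_mul,
      evAt_sum hn _ fun p _ => regular.mul_mem (regular.mul_mem (natCast_mem_regular _) (hf _))
        (hE _)]
    refine Finset.sum_congr rfl fun p _ => ?_
    rw [evAt_mul hn (regular.mul_mem (natCast_mem_regular _) (hf _)) (hE _),
      evAt_mul hn (natCast_mem_regular _) (hf _), evAt_natCast hn]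
    rfl

/-- A series with constant coefficient 1 is already invertible over the subring. -/
lemma exists_mul_eq_one {E : MvPowerSeries σ (RatFunc ℚ)} (h0 : MvPowerSeries.coeff 0 E = 1)
    (hE : ∀ γ, MvPowerSeries.coeff γ E ∈ monicRegular) :
    ∃ F : MvPowerSeries σ (RatFunc ℚ), E * F = 1 ∧ ∀ γ, MvPowerSeries.coeff γ F ∈ monicRegular := by
  let E₀ : MvPowerSeries σ monicRegular := fun γ => ⟨MvPowerSeries.coeff γ E, hE γ⟩
  have hmap : MvPowerSeries.map monicRegular.subtype E₀ = E := by
    ext γ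
    rw [MvPowerSeries.coeff_map]
    rfl
  have h1 : MvPowerSeries.constantCoeff E₀ = 1 := Subtype.ext h0
  have h2 : IsUnit E₀ := MvPowerSeries.isUnit_iff_constantCoeff.2 (by rw [h1]; exact isUnit_one)
  obtain ⟨F₀, hF₀⟩ := h2.exists_right_inv
  refine ⟨MvPowerSeries.map monicRegular.subtype F₀, ?_, fun γ => ?_⟩
  · rw [← hmap, ← map_mul, hF₀, map_one]
  · rw [MvPowerSeries.coeff_map]
    exact (MvPowerSeries.coeff γ F₀).2

lemma coeff_mul_mem {R : Type*} [CommRing R] (A : Subring R) {E F : MvPowerSeries σ R}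
    (hE : ∀ γ, MvPowerSeries.coeff γ E ∈ A) (hF : ∀ γ, MvPowerSeries.coeff γ F ∈ A) (γ : σ →₀ ℕ) :
    MvPowerSeries.coeff γ (E * F) ∈ A := by
  classical
  rw [MvPowerSeries.coeff_mul]
  exact A.sum_mem fun p _ => A.mul_mem (hE _) (hF _)

variable [Fintype σ]

/-- The series `∑_n ψ_n(f / (1 - q)) / n`, where `f` has the coefficients `c`. -/
def adamsLog (c : (σ →₀ ℕ) → RatFunc ℚ) : MvPowerSeries σ (RatFunc ℚ) := fun γ =>
  ∑ n ∈ Finset.Icc 1 γ.degree, if ∀ i, n ∣ γ i then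
    (n : RatFunc ℚ)⁻¹ * ((1 - RatFunc.X ^ n)⁻¹ * psi n (c (γ.mapRange (· / n) (Nat.zero_div n))))
  else 0

lemma coeff_adamsLog (c : (σ →₀ ℕ) → RatFunc ℚ) (γ : σ →₀ ℕ) :
    MvPowerSeries.coeff γ (adamsLog c) =
      ∑ n ∈ Finset.Icc 1 γ.degree, if ∀ i, n ∣ γ i then (n : RatFunc ℚ)⁻¹ *
        ((1 - RatFunc.X ^ n)⁻¹ * psi n (c (γ.mapRange (· / n) (Nat.zero_div n)))) else 0 := rfl

lemma adamsLog_add (c c' : (σ →₀ ℕ) → RatFunc ℚ) :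
    adamsLog (c + c') = adamsLog c + adamsLog c' := by
  ext γ
  rw [map_add, coeff_adamsLog, coeff_adamsLog, coeff_adamsLog, ← Finset.sum_add_distrib]
  refine Finset.sum_congr rfl fun n hn => ?_
  have hn0 : n ≠ 0 := Nat.one_le_iff_ne_zero.1 (Finset.mem_Icc.1 hn).1
  split_ifs
  · rw [Pi.add_apply, psi_add hn0]; ring
  · rw [add_zero]

lemma adamsLog_zero : adamsLog (0 : (σ →₀ ℕ) → RatFunc ℚ) = 0 := by
  ext γ
  rw [coeff_adamsLog]
  exact Finset.sum_eq_zero fun n _ => by simp [psi_zero]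

lemma adamsLog_neg (c : (σ →₀ ℕ) → RatFunc ℚ) : adamsLog (-c) = -adamsLog c := by
  refine eq_neg_of_add_eq_zero_left ?_
  rw [← adamsLog_add, neg_add_cancel, adamsLog_zero]

lemma one_sub_X_pow_mem (n : ℕ) : 1 - (RatFunc.X : RatFunc ℚ) ^ n ∈ monicRegular :=
  monicRegular.sub_mem monicRegular.one_mem (monicRegular.pow_mem X_mem n)

lemma one_sub_X_pow_inv_mem {n : ℕ} (hn : n ≠ 0) :
    (1 - (RatFunc.X : RatFunc ℚ) ^ n)⁻¹ ∈ monicRegular := by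
  have h1 : (1 - (RatFunc.X : RatFunc ℚ) ^ n)⁻¹ = -(ofInt (X ^ n - 1))⁻¹ := by
    rw [← neg_sub, inv_neg]
    congr 2
    simp [ofInt]
  rw [h1]
  refine monicRegular.neg_mem (ofInt_inv_mem (monic_X_pow_sub_C 1 hn) fun m hm => ?_)
  rw [eval_sub, eval_pow, eval_X, eval_one, sub_ne_zero]
  have : 1 < m ^ n := Nat.one_lt_pow hn hm
  exact_mod_cast this.ne'

lemma evAt_one_sub_X_pow_inv {m n : ℕ} (hm : 2 ≤ m) (hn : n ≠ 0) :
    evAt m (1 - (RatFunc.X : RatFunc ℚ) ^ n)⁻¹ = (1 - (m : ℚ) ^ n)⁻¹ := by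
  have hX : (RatFunc.X : RatFunc ℚ) ∈ regular := monicRegular_le_regular X_mem
  have h1 : ∀ m : ℕ, 2 ≤ m → evAt m (1 - (RatFunc.X : RatFunc ℚ) ^ n) = 1 - (m : ℚ) ^ n :=
    fun m hm => by
      rw [evAt_sub hm regular.one_mem (regular.pow_mem hX n), evAt_one, evAt_pow hm hX, evAt_X]
  rw [evAt_inv hm (monicRegular_le_regular (one_sub_X_pow_mem n)) fun l hl => ?_, h1 m hm]
  rw [h1 l hl, sub_ne_zero]
  have : 1 < l ^ n := Nat.one_lt_pow hn hl
  exact_mod_cast this.ne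

lemma coeff_adamsLog_mem_regular {c : (σ →₀ ℕ) → RatFunc ℚ} (hc : ∀ β, c β ∈ regular)
    (γ : σ →₀ ℕ) : MvPowerSeries.coeff γ (adamsLog c) ∈ regular := by
  rw [coeff_adamsLog]
  refine regular.sum_mem fun n hn => ?_
  have hn0 : n ≠ 0 := Nat.one_le_iff_ne_zero.1 (Finset.mem_Icc.1 hn).1
  split_ifs
  · exact regular.mul_mem (natCast_inv_mem_regular n) (regular.mul_mem
      (monicRegular_le_regular (one_sub_X_pow_inv_mem hn0)) (psi_mem_regular hn0 (hc _)))
  · exact regular.zero_mem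

lemma evAt_coeff_adamsLog {c : (σ →₀ ℕ) → RatFunc ℚ} (hc : ∀ β, c β ∈ regular) {q : ℕ} (hq : 2 ≤ q)
    (γ : σ →₀ ℕ) :
    evAt q (MvPowerSeries.coeff γ (adamsLog c)) =
      ∑ n ∈ Finset.Icc 1 γ.degree, if ∀ i, n ∣ γ i then (n : ℚ)⁻¹ * (1 - (q : ℚ) ^ n)⁻¹ *
        evAt (q ^ n) (c (γ.mapRange (· / n) (Nat.zero_div n))) else 0 := by
  rw [coeff_adamsLog, evAt_sum hq]
  · refine Finset.sum_congr rfl fun n hn => ?_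
    have hn0 : n ≠ 0 := Nat.one_le_iff_ne_zero.1 (Finset.mem_Icc.1 hn).1
    have h1 := monicRegular_le_regular (one_sub_X_pow_inv_mem hn0)
    split_ifs
    · rw [evAt_mul hq (natCast_inv_mem_regular n)
        (regular.mul_mem h1 (psi_mem_regular hn0 (hc _))), evAt_mul hq h1
        (psi_mem_regular hn0 (hc _)), evAt_psi hn0 hq (hc _), evAt_natCast_inv,
        evAt_one_sub_X_pow_inv hq hn0, mul_assoc]
    · exact evAt_zero _
  · intro n hn
    have hn0 : n ≠ 0 := Nat.one_le_iff_ne_zero.1 (Finset.mem_Icc.1 hn).1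
    split_ifs
    · exact regular.mul_mem (natCast_inv_mem_regular n) (regular.mul_mem
        (monicRegular_le_regular (one_sub_X_pow_inv_mem hn0)) (psi_mem_regular hn0 (hc _)))
    · exact regular.zero_mem

/-- The families of coefficients whose plethystic exponential has coefficients with monic
denominators. -/
def integralExp (σ : Type*) [Fintype σ] : AddSubgroup ((σ →₀ ℕ) → RatFunc ℚ) where
  carrier := {c | ∃ E, IsExp (adamsLog c) E ∧ ∀ γ, MvPowerSeries.coeff γ E ∈ monicRegular}
  zero_mem' := ⟨1, by rw [adamsLog_zero]; exact isExp_zero, fun γ => by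
    classical
    rw [MvPowerSeries.coeff_one]
    split_ifs
    · exact monicRegular.one_mem
    · exact monicRegular.zero_mem⟩
  add_mem' := by
    rintro c c' ⟨E, h, hE⟩ ⟨E', h', hE'⟩
    exact ⟨E * E', by rw [adamsLog_add]; exact h.add h', coeff_mul_mem _ hE hE'⟩
  neg_mem' := by
    rintro c ⟨E, h, hE⟩
    obtain ⟨F, hEF, hF⟩ := exists_mul_eq_one h.1 hE
    exact ⟨F, by rw [adamsLog_neg]; exact h.neg hEF, hF⟩

lemma adamsLog_single [DecidableEq σ] {β : σ →₀ ℕ} (hβ : β ≠ 0) (j : ℕ) :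
    adamsLog (Pi.single β (RatFunc.X ^ j)) = qLogSeries RatFunc.X (RatFunc.X ^ j) β := by
  ext γ
  rw [coeff_adamsLog, qLogSeries, coeff_ray hβ _ γ _ (Nat.lt_succ_self _)]
  have hsub : Finset.Icc 1 γ.degree ⊆ Finset.range (γ.degree + 1) := fun n hn => by
    rw [Finset.mem_Icc] at hn
    rw [Finset.mem_range]
    omega
  rw [← Finset.sum_subset hsub fun n hn hn' => ?_]
  · refine Finset.sum_congr rfl fun n hn => ?_
    have hn0 : n ≠ 0 := Nat.one_le_iff_ne_zero.1 (Finset.mem_Icc.1 hn).1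
    have h1 := QRep.dvd_and_div_eq_iff (γ := γ) (b := β) hn0
    by_cases hdvd : ∀ i, n ∣ γ i
    · rw [and_iff_right hdvd] at h1
      rw [if_pos hdvd, Pi.single_apply, PowerSeries.coeff_mk]
      by_cases hb : β = γ.mapRange (· / n) (Nat.zero_div n)
      · rw [if_pos hb.symm, if_pos (h1.1 hb), psi_pow hn0, psi_X, ← pow_mul, ← pow_mul, mul_comm j n,
          mul_assoc]
      · rw [if_neg fun h => hb h.symm, if_neg fun h => hb (h1.2 h), psi_zero, mul_zero, mul_zero]
    · rw [if_neg hdvd, if_neg fun h => hdvd (h1.2 h).1]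
  -- The remaining index 0 contributes nothing, because the inverse of zero is zero.
  · have hn0 : n = 0 := by
      rw [Finset.mem_range] at hn
      rw [Finset.mem_Icc] at hn'
      omega
    rw [hn0, PowerSeries.coeff_mk]
    simp

lemma X_pow_ne_one (n : ℕ) : (RatFunc.X : RatFunc ℚ) ^ (n + 1) ≠ 1 := fun h => by
  have h1 := congrArg (evAt 2) h
  rw [evAt_pow le_rfl (monicRegular_le_regular X_mem), evAt_X, evAt_one] at h1
  exact (one_lt_pow₀ (by norm_num : (1 : ℚ) < (2 : ℕ)) (Nat.succ_ne_zero n)).ne' h1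

lemma qExpCoeff_mem (n : ℕ) : qExpCoeff (RatFunc.X : RatFunc ℚ) n ∈ monicRegular :=
  monicRegular.prod_mem fun i _ => one_sub_X_pow_inv_mem (Nat.succ_ne_zero i)

/-- The plethystic exponential of q^j x^β / (1 - q) is a quantum exponential, whose denominators are
products of factors 1 - q^i, monic up to sign. -/
lemma single_X_pow_mem_integralExp [DecidableEq σ] {β : σ →₀ ℕ} (hβ : β ≠ 0) (j : ℕ) :
    (Pi.single β (RatFunc.X ^ j) : (σ →₀ ℕ) → RatFunc ℚ) ∈ integralExp σ := by
  have : CharZero (RatFunc ℚ) := inferInstance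
  refine ⟨_, by rw [adamsLog_single hβ]; exact isExp_qExpSeries X_pow_ne_one _ hβ, fun γ => ?_⟩
  rw [qExpSeries, coeff_ray hβ _ γ _ (Nat.lt_succ_self _)]
  refine monicRegular.sum_mem fun n _ => ?_
  split_ifs
  · rw [PowerSeries.coeff_mk]
    exact monicRegular.mul_mem (qExpCoeff_mem n)
      (monicRegular.pow_mem (monicRegular.pow_mem X_mem j) n)
  · exact monicRegular.zero_mem

/-- An integral polynomial is an integral combination of powers of q, and `integralExp` is a group.
-/
lemma single_ofInt_mem_integralExp [DecidableEq σ] {β : σ →₀ ℕ} (hβ : β ≠ 0) (P : ℤ[X]) :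
    (Pi.single β (ofInt P) : (σ →₀ ℕ) → RatFunc ℚ) ∈ integralExp σ := by
  induction P using Polynomial.induction_on' with
  | add P Q hP hQ =>
    rw [ofInt_add, Pi.single_add]
    exact (integralExp σ).add_mem hP hQ
  | monomial j a =>
    have h1 : (Pi.single β (ofInt (monomial j a)) : (σ →₀ ℕ) → RatFunc ℚ) =
        a • Pi.single β (RatFunc.X ^ j) := by
      rw [← Pi.single_smul]
      congr 1
      rw [← C_mul_X_pow_eq_monomial, ofInt_mul]
      simp [ofInt]
    rw [h1]
    exact (integralExp σ).zsmul_mem (single_X_pow_mem_integralExp hβ j) a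

theorem exists_isExp_integral [DecidableEq σ] (s : Finset (σ →₀ ℕ)) (hs : (0 : σ →₀ ℕ) ∉ s)
    (A : (σ →₀ ℕ) → ℤ[X]) :
    ∃ E, IsExp (adamsLog fun β => if β ∈ s then ofInt (A β) else 0) E ∧
      ∀ γ, MvPowerSeries.coeff γ E ∈ monicRegular := by
  have h1 : (fun β => if β ∈ s then ofInt (A β) else 0) =
      ∑ β ∈ s, (Pi.single β (ofInt (A β)) : (σ →₀ ℕ) → RatFunc ℚ) := by
    funext γ
    rw [Finset.sum_apply, Finset.sum_pi_single]
  rw [h1]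
  exact (integralExp σ).sum_mem fun β hβ =>
    single_ofInt_mem_integralExp (fun h => hs (h ▸ hβ)) (A β)

end Plethystic

/-! ### Polynomiality of the absolutely stable counting function -/

section Polynomiality

variable {I : Type u} [Quiver.{v} I] [Fintype I]

lemma numAbsolutelyStable_zero (θ : I → ℤ) (k : Type) [Field k] :
    numAbsolutelyStable θ k (0 : I → ℕ) = 0 := by
  have h : {x : Rep k (0 : I → ℕ) | IsAbsolutelyStable θ x} = ∅ :=
    Set.eq_empty_of_forall_notMem fun x hx => hx.1.1 rfl
  rw [numAbsolutelyStable, h, Set.image_empty, Set.ncard_empty]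

lemma numSS_zero (c : I → ℚ) (k : Type) [Field k] : QRep.numSS c k (0 : I → ℕ) = 1 := by
  have : Subsingleton (Rep k (0 : I → ℕ)) := subsingleton_rep_zero
  have hwt : ∀ (x : Rep k (0 : I → ℕ)) (U : ∀ i, Submodule k ((QRep.ofRep x).V i)),
      QRep.wt c U = 0 := fun x U => by
    have : U = ⊥ := funext fun i => (Submodule.eq_bot_iff _).2 fun v _ => funext fun a => a.elim0
    rw [this, QRep.wt_bot]
  exact (Nat.card_eq_one_iff_unique).2 ⟨⟨fun a b => Subtype.ext (Subsingleton.elim _ _)⟩,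
    ⟨⟨fun _ _ _ => 0, hwt _ _, fun U _ => (hwt _ U).le⟩⟩⟩

lemma numSS_cw (θ : I → ℤ) (m : ℚ) (k : Type) [Field k] (α : I →₀ ℕ) :
    QRep.numSS (QRep.cw θ m) k α =
      if α = 0 ∨ slope θ α = m then numSemistable θ k α else 0 := by
  by_cases hα : α = 0
  · subst hα
    rw [if_pos (Or.inl rfl), Finsupp.coe_zero, numSemistable_zero, numSS_zero]
  have hα' : (α : I → ℕ) ≠ 0 := fun h => hα (DFunLike.coe_injective h)
  by_cases hm : slope θ α = m
  · rw [if_pos (Or.inr hm), numSemistable_eq_numSS hα', hm]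
  · rw [if_neg (by tauto)]
    refine Nat.card_eq_zero.2 (Or.inl ⟨fun x => hm ?_⟩)
    have h1 := x.2.1
    rw [wt_top_ofRep] at h1
    exact (QRep.sum_cw_eq_zero_iff θ m α (sum_ne_zero_of_ne_zero hα')).1 h1

lemma isCount_numSS [∀ i j : I, Fintype (i ⟶ j)] [DecidableEq I] (θ : I → ℤ) (m : ℚ)
    (α : I →₀ ℕ) :
    IsCount fun k _ _ => (QRep.numSS (QRep.cw θ m) k α : ℚ) / Nat.card (GLDim k α) := by
  by_cases h : α = 0 ∨ slope θ α = m
  · exact (isCount_numSemistable θ α).congr fun k _ _ => by rw [numSS_cw, if_pos h]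
  · exact isCount_zero.congr fun k _ _ => by rw [numSS_cw, if_neg h, Nat.cast_zero, zero_div]

/-- For n = 1 the field k itself is chosen, so counts over isomorphic fields need not be compared.
-/
lemma exists_extCount (θ : I → ℤ) (k : Type) [Field k] [Finite k] {n : ℕ} (hn : n ≠ 0)
    (b : I →₀ ℕ) :
    ∃ z : ℕ, ∃ (K : Type) (_ : Field K) (_ : Algebra k K) (_ : Module.Finite k K) (_ : Finite K),
      Module.finrank k K = n ∧ Nat.card K = Nat.card k ^ n ∧ z = numAbsolutelyStable θ K b ∧
        (n = 1 → z = numAbsolutelyStable θ k b) := by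
  by_cases h1 : n = 1
  · subst h1
    exact ⟨_, k, inferInstance, inferInstance, inferInstance, inferInstance,
      Module.finrank_self k, (pow_one _).symm, rfl, fun _ => rfl⟩
  · obtain ⟨K, i1, i2, i3, i4, h2, h3⟩ := QRep.exists_extension k hn
    exact ⟨_, K, i1, i2, i3, i4, h2, h3, rfl, fun h => (h1 h).elim⟩

/-- The number of absolutely stable representations over an extension of degree `n`. -/
def extCount (θ : I → ℤ) (k : Type) [Field k] [Finite k] (n : ℕ) (b : I →₀ ℕ) : ℕ :=
  if hn : n ≠ 0 then Classical.choose (exists_extCount θ k hn b) else 0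

lemma extCount_spec (θ : I → ℤ) (k : Type) [Field k] [Finite k] {n : ℕ} (hn : n ≠ 0)
    (b : I →₀ ℕ) :
    ∃ (K : Type) (_ : Field K) (_ : Algebra k K) (_ : Module.Finite k K) (_ : Finite K),
      Module.finrank k K = n ∧ Nat.card K = Nat.card k ^ n ∧
        extCount θ k n b = numAbsolutelyStable θ K b ∧
          (n = 1 → extCount θ k n b = numAbsolutelyStable θ k b) := by
  rw [extCount, dif_pos hn]
  exact Classical.choose_spec (exists_extCount θ k hn b)

/-- The count over an extension, restricted to dimension vectors of slope `m`. -/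
def slopeCount (θ : I → ℤ) (m : ℚ) (k : Type) [Field k] [Finite k] (n : ℕ) (b : I →₀ ℕ) : ℚ :=
  if b ≠ 0 ∧ slope θ b = m then (extCount θ k n b : ℚ) else 0

/-- The value at `#k` of the logarithm of the inverse of the semistable generating function. -/
def logSeries (θ : I → ℤ) (m : ℚ) (k : Type) [Field k] [Finite k] : MvPowerSeries I ℚ := fun γ =>
  ∑ n ∈ Finset.Icc 1 γ.degree, if ∀ i, n ∣ γ i then (n : ℚ)⁻¹ * (1 - (Nat.card k : ℚ) ^ n)⁻¹ *
    slopeCount θ m k n (γ.mapRange (· / n) (Nat.zero_div n)) else 0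

lemma coeff_logSeries (θ : I → ℤ) (m : ℚ) (k : Type) [Field k] [Finite k] (γ : I →₀ ℕ) :
    MvPowerSeries.coeff γ (logSeries θ m k) =
      ∑ n ∈ Finset.Icc 1 γ.degree, if ∀ i, n ∣ γ i then (n : ℚ)⁻¹ * (1 - (Nat.card k : ℚ) ^ n)⁻¹ *
        slopeCount θ m k n (γ.mapRange (· / n) (Nat.zero_div n)) else 0 := rfl

/-- The value at `#k` of the inverse of the semistable generating function. -/
def expSeries (θ : I → ℤ) (m : ℚ) (k : Type) [Field k] [Finite k] : MvPowerSeries I ℚ :=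
  (PowerSeries.exp ℚ).subst (logSeries θ m k)

lemma isExp_expSeries (θ : I → ℤ) (m : ℚ) (k : Type) [Field k] [Finite k] :
    IsExp (logSeries θ m k) (expSeries θ m k) :=
  isExp_exp_subst (by rw [coeff_logSeries, map_zero]; rfl)

variable [∀ i j : I, Fintype (i ⟶ j)] [DecidableEq I]

lemma expSeries_identity (θ : I → ℤ) (m : ℚ) (k : Type) [Field k] [Finite k] {α : I →₀ ℕ}
    (hα : α ≠ 0) :
    ∑ p ∈ Finset.HasAntidiagonal.antidiagonal α,
      (Nat.card k : ℚ) ^ (-ringelForm (fun i => (p.1 i : ℤ)) (fun i => (p.2 i : ℤ))) *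
        ((QRep.numSS (QRep.cw θ m) k p.1 : ℚ) / Nat.card (GLDim k p.1) *
          MvPowerSeries.coeff p.2 (expSeries θ m k)) = 0 := by
  refine QRep.numeric_identity θ m (slopeCount θ m k) (fun n b hn hb hm => ?_)
    (fun n b h => if_neg h) (coeff_logSeries θ m k) (isExp_expSeries θ m k) α hα
  obtain ⟨K, i1, i2, i3, -, h1, -, h2, -⟩ := extCount_spec θ k hn b
  refine ⟨K, i1, i2, i3, h1, ?_⟩
  rw [slopeCount, if_pos ⟨hb, hm⟩, h2]

omit [DecidableEq I] in
lemma ringelForm_zero_left (β : I → ℤ) :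
    ringelForm (fun i => ((0 : I →₀ ℕ) i : ℤ)) β = 0 := by
  simp [ringelForm]

/-- The semistable series starts with 1 and the twist is trivial there, so the twisted identity
expresses this coefficient by semistable counts and coefficients of smaller degree. -/
lemma isCount_coeff_expSeries (θ : I → ℤ) (m : ℚ) (γ : I →₀ ℕ) :
    IsCount fun k _ _ => MvPowerSeries.coeff γ (expSeries θ m k) := by
  induction hn : γ.degree using Nat.strong_induction_on generalizing γ with
  | _ n ih =>
  by_cases hγ : γ = 0
  · exact isCount_one.congr fun k _ _ => by rw [hγ]; exact (isExp_expSeries θ m k).1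
  have hmem : ((0 : I →₀ ℕ), γ) ∈ Finset.HasAntidiagonal.antidiagonal γ := by
    rw [Finset.HasAntidiagonal.mem_antidiagonal, zero_add]
  have h1 : IsCount fun k _ _ => -∑ p ∈ (Finset.HasAntidiagonal.antidiagonal γ).erase (0, γ),
      (Nat.card k : ℚ) ^ (-ringelForm (fun i => (p.1 i : ℤ)) (fun i => (p.2 i : ℤ))) *
        ((QRep.numSS (QRep.cw θ m) k p.1 : ℚ) / Nat.card (GLDim k p.1) *
          MvPowerSeries.coeff p.2 (expSeries θ m k)) := by
    refine (IsCount.sum _ fun p hp => ?_).neg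
    obtain ⟨hne, hp⟩ := Finset.mem_erase.1 hp
    refine (isCount_zpow _).mul ((isCount_numSS θ m p.1).mul (ih p.2.degree ?_ p.2 rfl))
    rw [← hn]
    refine degree_lt_of_mem_antidiagonal hp fun h0 => hne (Prod.ext h0 ?_)
    rw [← Finset.HasAntidiagonal.mem_antidiagonal.1 hp, h0, zero_add]
  refine h1.congr fun k _ _ => ?_
  have h2 := expSeries_identity θ m k hγ
  rw [← Finset.add_sum_erase _ _ hmem] at h2
  simp only [ringelForm_zero_left] at h2
  simp only [neg_zero, zpow_zero, one_mul, Finsupp.coe_zero, numSS_zero, card_GLDim_zero,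
    Nat.cast_one, div_one] at h2
  exact eq_neg_of_add_eq_zero_left h2

/-- Compare `expSeries`, which involves all counts of slope m, with the plethystic exponential of
the polynomials known in smaller degree. At α they differ exactly by the unknown count divided by 1
- #k, and both coefficients are rational functions with monic denominators. -/
theorem exists_polynomial (θ : I → ℤ) (α : I →₀ ℕ) :
    ∃ P : ℤ[X], ∀ (k : Type) [Field k] [Finite k],
      P.eval (Nat.card k : ℤ) = (numAbsolutelyStable θ k α : ℤ) := by
  classical
  induction hn : α.degree using Nat.strong_induction_on generalizing α with
  | _ n ih =>
  by_cases hα : α = 0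
  · exact ⟨0, fun k _ _ => by rw [hα, Finsupp.coe_zero, numAbsolutelyStable_zero, eval_zero]; rfl⟩
  set m := slope θ α with hm
  have hA : ∀ β : I →₀ ℕ, ∃ P : ℤ[X], β.degree < n → ∀ (k : Type) [Field k] [Finite k],
      P.eval (Nat.card k : ℤ) = (numAbsolutelyStable θ k β : ℤ) := fun β => by
    by_cases h : β.degree < n
    · obtain ⟨P, hP⟩ := ih _ h β rfl
      exact ⟨P, fun _ => hP⟩
    · exact ⟨0, fun h' => (h h').elim⟩
  choose A hA using hA
  have hfin : {β : I →₀ ℕ | β.degree < n ∧ β ≠ 0 ∧ slope θ β = m}.Finite :=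
    (Finsupp.finite_of_degree_le n).subset fun β hβ => hβ.1.le
  let s := hfin.toFinset
  have hs : ∀ β, β ∈ s ↔ β.degree < n ∧ β ≠ 0 ∧ slope θ β = m := fun β => hfin.mem_toFinset
  obtain ⟨E', hE', hE'm⟩ := exists_isExp_integral s (fun h => ((hs 0).1 h).2.1 rfl) A
  set c : (I →₀ ℕ) → RatFunc ℚ := fun β => if β ∈ s then ofInt (A β) else 0 with hc
  have hcreg : ∀ β, c β ∈ regular := fun β => by
    simp only [hc]
    split_ifs
    · exact monicRegular_le_regular (ofInt_mem _)
    · exact regular.zero_mem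
  have hterm : ∀ (k : Type) [Field k] [Finite k] (l : ℕ) (β : I →₀ ℕ), l ≠ 0 → β.degree < n →
      slopeCount θ m k l β = evAt (Nat.card k ^ l) (c β) := by
    intro k _ _ l β hl hβ
    by_cases h : β ≠ 0 ∧ slope θ β = m
    · have h1 : β ∈ s := (hs β).2 ⟨hβ, h⟩
      obtain ⟨K, _, _, _, _, -, hK, h2, -⟩ := extCount_spec θ k hl β
      rw [slopeCount, if_pos h, hc]
      simp only [if_pos h1]
      rw [evAt_ofInt, ← hK, hA β hβ K, h2]
      push_cast
      rfl
    · have h1 : β ∉ s := fun h1 => h ((hs β).1 h1).2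
      rw [slopeCount, if_neg h, hc]
      simp only [if_neg h1]
      exact (evAt_zero _).symm
  have hdeg : ∀ (γ : I →₀ ℕ) (l : ℕ), (γ.mapRange (· / l) (Nat.zero_div l)).degree ≤ γ.degree :=
    fun γ l => by
      rw [Finsupp.degree_eq_sum, Finsupp.degree_eq_sum]
      exact Finset.sum_le_sum fun i _ => Nat.div_le_self _ _
  have hα1 : 1 ∈ Finset.Icc 1 α.degree := by
    rw [Finset.mem_Icc]
    exact ⟨le_rfl, Nat.one_le_iff_ne_zero.2 fun h => hα ((Finsupp.degree_eq_zero_iff α).1 h)⟩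
  have hαdiv : α.mapRange (· / 1) (Nat.zero_div 1) = α := by
    ext i
    exact Nat.div_one _
  have hcα : c α = 0 := if_neg fun h => (((hs α).1 h).1.trans_eq hn.symm).false
  have hkey : ∀ (k : Type) [Field k] [Finite k], (numAbsolutelyStable θ k α : ℚ) =
      (1 - (Nat.card k : ℚ) ^ (1 : ℤ)) * (MvPowerSeries.coeff α (expSeries θ m k) -
        evAt (Nat.card k) (MvPowerSeries.coeff α E')) := by
    intro k _ _
    have hq := two_le_card k
    have h1 := (isExp_expSeries θ m k).coeff_sub
      (hE'.evSeries (coeff_adamsLog_mem_regular hcreg) hq) α hα fun γ hγ => by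
        rw [coeff_logSeries, coeff_evSeries, evAt_coeff_adamsLog hcreg hq]
        refine Finset.sum_congr rfl fun l hl => ?_
        have hl0 : l ≠ 0 := Nat.one_le_iff_ne_zero.1 (Finset.mem_Icc.1 hl).1
        rw [hterm k l _ hl0 ((hdeg γ l).trans_lt (hn ▸ hγ))]
    rw [coeff_evSeries, coeff_evSeries, coeff_logSeries, evAt_coeff_adamsLog hcreg hq,
      ← Finset.add_sum_erase _ _ hα1, ← Finset.add_sum_erase _ _ hα1] at h1
    -- For l > 1 the vector α / l has smaller degree than α, so its count over the extension is the
    -- value of a known polynomial.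
    have h2 : ∀ l ∈ (Finset.Icc 1 α.degree).erase 1,
        (if ∀ i, l ∣ α i then (l : ℚ)⁻¹ * (1 - (Nat.card k : ℚ) ^ l)⁻¹ *
          slopeCount θ m k l (α.mapRange (· / l) (Nat.zero_div l)) else 0) =
        if ∀ i, l ∣ α i then (l : ℚ)⁻¹ * (1 - (Nat.card k : ℚ) ^ l)⁻¹ *
          evAt (Nat.card k ^ l) (c (α.mapRange (· / l) (Nat.zero_div l))) else 0 := by
      intro l hl
      obtain ⟨hl1, hl⟩ := Finset.mem_erase.1 hl
      have hl0 : l ≠ 0 := Nat.one_le_iff_ne_zero.1 (Finset.mem_Icc.1 hl).1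
      by_cases hdvd : ∀ i, l ∣ α i
      · rw [hterm k l _ hl0]
        have h3 := (QRep.dvd_and_div_eq_iff (b := α.mapRange (· / l) (Nat.zero_div l)) hl0).1
          ⟨hdvd, rfl⟩
        have h4 := congrArg Finsupp.degree h3
        rw [map_nsmul, smul_eq_mul] at h4
        have h5 : α.degree ≠ 0 := fun h => hα ((Finsupp.degree_eq_zero_iff α).1 h)
        rw [← hn, ← h4]
        have h6 : 0 < (α.mapRange (· / l) (Nat.zero_div l)).degree :=
          Nat.pos_of_ne_zero fun h => h5 (by rw [← h4, h, mul_zero])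
        exact lt_mul_of_one_lt_left h6 (by omega)
      · rw [if_neg hdvd, if_neg hdvd]
    -- Only the terms with l = 1 differ; on the polynomial side this term is zero because α is not
    -- in s.
    rw [Finset.sum_congr rfl h2, add_sub_add_right_eq_sub, if_pos fun i => one_dvd _,
      if_pos fun i => one_dvd _, hαdiv, hcα, evAt_zero, mul_zero, sub_zero, Nat.cast_one, inv_one,
      one_mul, pow_one, slopeCount, if_pos ⟨hα, hm.symm⟩] at h1
    obtain ⟨-, -, -, -, -, -, -, -, h7⟩ := extCount_spec θ k one_ne_zero α
    rw [h7 rfl] at h1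
    have h8 : (1 - (Nat.card k : ℚ)) ≠ 0 := by
      rw [sub_ne_zero]
      exact_mod_cast (by omega : (1 : ℕ) ≠ Nat.card k)
    rw [zpow_one, h1, mul_inv_cancel_left₀ h8]
  have hcount : IsCount fun k _ _ => (numAbsolutelyStable θ k α : ℚ) := by
    refine ((isCount_one.sub (isCount_zpow 1)).mul ((isCount_coeff_expSeries θ m α).sub
      ⟨_, hE'm α, fun k _ _ => rfl⟩)).congr fun k _ _ => hkey k
  obtain ⟨f, hf, hfk⟩ := hcount
  obtain ⟨P, rfl⟩ := exists_ofInt_of_integral_values hf fun p hp => by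
    have : Fact p.Prime := ⟨hp⟩
    have h1 := hfk (ZMod p)
    rw [Nat.card_zmod] at h1
    exact ⟨_, h1.trans (Int.cast_natCast _).symm⟩
  refine ⟨P, fun k _ _ => ?_⟩
  have h1 : _ = (numAbsolutelyStable θ k α : ℚ) := hfk k
  rw [evAt_ofInt] at h1
  exact_mod_cast h1

end Polynomiality

/-! ### The identity of generating functions -/

section Identity

variable {I : Type u} [Quiver.{v} I] [Fintype I]

lemma CountsAbsolutelyStable.unique {θ : I → ℤ} {a a' : (I →₀ ℕ) → ℤ[X]}
    (h : CountsAbsolutelyStable θ a) (h' : CountsAbsolutelyStable θ a') : a = a' := by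
  funext α
  refine ofInt_injective (eq_of_evAt_eq
    (fun p hp => monicRegular_le_regular (ofInt_mem _) p hp.two_le)
    (fun p hp => monicRegular_le_regular (ofInt_mem _) p hp.two_le) fun p hp => ?_)
  have : Fact p.Prime := ⟨hp⟩
  have h1 := h α (ZMod p)
  have h2 := h' α (ZMod p)
  rw [Nat.card_zmod] at h1 h2
  rw [evAt_ofInt, evAt_ofInt, h1, h2]

lemma CountsSemistable.unique {θ : I → ℤ} {r r' : (I →₀ ℕ) → RatFunc ℚ}
    (h : CountsSemistable θ r) (h' : CountsSemistable θ r') : r = r' := by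
  funext α
  have h1 : ∀ {r : (I →₀ ℕ) → RatFunc ℚ}, CountsSemistable θ r → ∀ p : ℕ, (hp : p.Prime) →
      (r α).denom.eval (p : ℚ) ≠ 0 := fun {r} h p hp => by
    have : Fact p.Prime := ⟨hp⟩
    have h1 := (h α (ZMod p)).1
    rwa [Nat.card_zmod] at h1
  refine eq_of_evAt_eq (h1 h) (h1 h') fun p hp => ?_
  have : Fact p.Prime := ⟨hp⟩
  have h1 := (h α (ZMod p)).2
  have h2 := (h' α (ZMod p)).2
  rw [Nat.card_zmod] at h1 h2
  exact h1.trans h2.symm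

-- For n ≥ 1 the substitution is multiplicative, so ψ_n(g / (1 - q)) = ψ_n(g) / (1 - q ^ n).
omit [Quiver.{v} I] in
lemma adamsSum_eq_adamsLog [DecidableEq I] (g : MvPowerSeries I (RatFunc ℚ)) :
    adamsSum ((1 - RatFunc.X : RatFunc ℚ)⁻¹ • g) =
      adamsLog fun β => MvPowerSeries.coeff β g := by
  ext γ
  rw [coeff_adamsLog]
  change ∑ n ∈ Finset.Icc 1 (∑ i, γ i), (1 / (n : RatFunc ℚ)) *
    MvPowerSeries.coeff γ (adams n ((1 - RatFunc.X : RatFunc ℚ)⁻¹ • g)) = _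
  rw [Finsupp.degree_eq_sum]
  refine Finset.sum_congr rfl fun n hn => ?_
  have hn0 : n ≠ 0 := Nat.one_le_iff_ne_zero.1 (Finset.mem_Icc.1 hn).1
  change (1 / (n : RatFunc ℚ)) * (if ∀ i, n ∣ γ i then psi n (MvPowerSeries.coeff
    (γ.mapRange (· / n) (Nat.zero_div n)) ((1 - RatFunc.X : RatFunc ℚ)⁻¹ • g)) else 0) = _
  have h1 : psi n (1 - RatFunc.X : RatFunc ℚ) = 1 - RatFunc.X ^ n := by
    rw [sub_eq_add_neg, psi_add hn0, psi_neg hn0, psi_one, psi_X, ← sub_eq_add_neg]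
  split_ifs
  · rw [map_smul, smul_eq_mul, psi_mul hn0, psi_inv hn0, h1, one_div]
  · rw [mul_zero]

variable [∀ i j : I, Fintype (i ⟶ j)] [DecidableEq I]

theorem exists_countsAbsolutelyStable (θ : I → ℤ) :
    ∃ a : (I →₀ ℕ) → ℤ[X], CountsAbsolutelyStable θ a := by
  choose a ha using exists_polynomial θ
  exact ⟨a, fun α k _ _ => ha α k⟩

theorem exists_countsSemistable (θ : I → ℤ) :
    ∃ r : (I →₀ ℕ) → RatFunc ℚ, CountsSemistable θ r ∧ ∀ α, r α ∈ regular := by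
  choose r hr hrk using isCount_numSemistable θ
  exact ⟨r, fun α k _ _ => ⟨monicRegular_le_regular (hr α) _ (two_le_card k), hrk α k⟩,
    fun α => monicRegular_le_regular (hr α)⟩

theorem twMul_plethysticExp_eq_one (θ : I → ℤ) (m : ℚ) {a : (I →₀ ℕ) → ℤ[X]}
    {r : (I →₀ ℕ) → RatFunc ℚ} (ha : CountsAbsolutelyStable θ a) (hr : CountsSemistable θ r) :
    twMul (slopeSeries θ m r) (plethysticExp ((1 - RatFunc.X : RatFunc ℚ)⁻¹ •
      slopeSeries θ m fun α => ofInt (a α))) = 1 := by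
  classical
  -- The hypothesis on r excludes poles only at prime powers; by uniqueness r is the constructed
  -- family, which has no poles at any integer at least 2.
  have hrreg : ∀ α, r α ∈ regular := by
    obtain ⟨r', hr', hreg⟩ := exists_countsSemistable θ
    rw [hr.unique hr']
    exact hreg
  -- Replacing the value at the zero vector by 0 preserves the counting property, so uniqueness
  -- forces it.
  have ha0 : a 0 = 0 := by
    have h : CountsAbsolutelyStable θ (Function.update a 0 0) := fun α k _ _ => by
      by_cases hα : α = 0
      · subst hα
        rw [Function.update_self, Finsupp.coe_zero, numAbsolutelyStable_zero, eval_zero]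
        rfl
      · rw [Function.update_of_ne hα]
        exact ha α k
    rw [ha.unique h, Function.update_self]
  have hr0 : r 0 = 1 := by
    have h : CountsSemistable θ (Function.update r 0 1) := fun α k _ _ => by
      by_cases hα : α = 0
      · subst hα
        rw [Function.update_self, Finsupp.coe_zero, numSemistable_zero, card_GLDim_zero]
        exact ⟨regular.one_mem _ (two_le_card k), (evAt_one _).trans (by simp)⟩
      · rw [Function.update_of_ne hα]
        exact hr α k
    rw [hr.unique h, Function.update_self]
  have hrslope : ∀ α, MvPowerSeries.coeff α (slopeSeries θ m r) =
      if α = 0 ∨ slope θ α = m then r α else 0 := fun α => rfl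
  have hrsreg : ∀ α, MvPowerSeries.coeff α (slopeSeries θ m r) ∈ regular := fun α => by
    rw [hrslope]
    split_ifs
    · exact hrreg α
    · exact regular.zero_mem
  let c : (I →₀ ℕ) → RatFunc ℚ := fun β =>
    MvPowerSeries.coeff β (slopeSeries θ m fun α => ofInt (a α))
  have hc : ∀ β, c β = if β ≠ 0 ∧ slope θ β = m then ofInt (a β) else 0 := fun β => by
    change (if β = 0 ∨ slope θ β = m then ofInt (a β) else 0) = _
    by_cases hβ : β = 0
    · rw [if_pos (Or.inl hβ), if_neg fun h => h.1 hβ, hβ, ha0, ofInt_zero]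
    · simp only [hβ, false_or, ne_eq, not_false_eq_true, true_and]
  have hcreg : ∀ β, c β ∈ regular := fun β => by
    rw [hc]
    split_ifs
    · exact monicRegular_le_regular (ofInt_mem _)
    · exact regular.zero_mem
  have hlog := coeff_adamsLog_mem_regular hcreg
  have hE : IsExp (adamsLog c) (plethysticExp ((1 - RatFunc.X : RatFunc ℚ)⁻¹ •
      slopeSeries θ m fun α => ofInt (a α))) := by
    rw [plethysticExp, adamsSum_eq_adamsLog]
    exact isExp_exp_subst (by rw [coeff_adamsLog, map_zero]; rfl)
  set E := plethysticExp ((1 - RatFunc.X : RatFunc ℚ)⁻¹ •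
    slopeSeries θ m fun α => ofInt (a α)) with hEdef
  have hEreg := hE.coeff_mem_regular hlog
  ext γ
  rw [MvPowerSeries.coeff_one]
  change ∑ p ∈ Finset.HasAntidiagonal.antidiagonal γ,
    RatFunc.X ^ (-ringelForm (fun i => (p.1 i : ℤ)) (fun i => (p.2 i : ℤ))) *
      (MvPowerSeries.coeff p.1 (slopeSeries θ m r) * MvPowerSeries.coeff p.2 E) = _
  have hX : ∀ l : ℤ, (RatFunc.X : RatFunc ℚ) ^ l ∈ regular := fun l =>
    monicRegular_le_regular (X_zpow_mem l)
  have hterm : ∀ p : (I →₀ ℕ) × (I →₀ ℕ),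
      RatFunc.X ^ (-ringelForm (fun i => (p.1 i : ℤ)) (fun i => (p.2 i : ℤ))) *
        (MvPowerSeries.coeff p.1 (slopeSeries θ m r) * MvPowerSeries.coeff p.2 E) ∈ regular :=
    fun p => regular.mul_mem (hX _) (regular.mul_mem (hrsreg _) (hEreg _))
  split_ifs with hγ
  · subst hγ
    rw [Finset.HasAntidiagonal.antidiagonal_zero, Finset.sum_singleton, hrslope, if_pos (Or.inl rfl), hr0, hE.1,
      ringelForm_zero_left, neg_zero, zpow_zero, one_mul, one_mul]
  -- It suffices to compare values at primes p, where the prime field ZMod p makes the coefficients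
  -- actual counts.
  refine eq_of_evAt_eq (fun p hp => regular.sum_mem (fun x _ => hterm x) p hp.two_le)
    (fun p hp => regular.zero_mem p hp.two_le) fun p hp => ?_
  have : Fact p.Prime := ⟨hp⟩
  have hq := hp.two_le
  have hcard : Nat.card (ZMod p) = p := Nat.card_zmod p
  have hr1 : ∀ α : I →₀ ℕ, evAt p (MvPowerSeries.coeff α (slopeSeries θ m r)) =
      (QRep.numSS (QRep.cw θ m) (ZMod p) α : ℚ) / Nat.card (GLDim (ZMod p) α) := fun α => by
    rw [hrslope, numSS_cw]
    split_ifs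
    · have h1 := (hr α (ZMod p)).2
      rw [hcard] at h1
      exact h1
    · rw [Nat.cast_zero, zero_div]
      exact (evAt_zero _)
  rw [evAt_zero, evAt_sum hq _ fun x _ => hterm x]
  -- The Adams operation evaluates a_b at p ^ n, and this is the count over the extension of ZMod p
  -- of degree n.
  refine Eq.trans (Finset.sum_congr rfl fun x _ => ?_)
    (QRep.numeric_identity (k := ZMod p) θ m (fun n b => evAt (p ^ n) (c b))
      (fun n b hn hb hbm => ?_) (fun n b h => ?_) (f := evSeries p (adamsLog c))
      (E := evSeries p E) (fun γ => ?_) (hE.evSeries hlog hq) γ hγ)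
  · rw [evAt_mul hq (hX _) (regular.mul_mem (hrsreg _) (hEreg _)),
      evAt_mul hq (hrsreg _) (hEreg _), evAt_X_zpow hq, hr1, hcard, coeff_evSeries]
  · obtain ⟨K, i1, i2, i3, i4, h1, h2⟩ := QRep.exists_extension (ZMod p) hn
    refine ⟨K, i1, i2, i3, h1, ?_⟩
    have h3 := ha b K
    rw [h2, hcard] at h3
    rw [hc, if_pos ⟨hb, hbm⟩, evAt_ofInt, h3, Int.cast_natCast]
  · simp only [hc, if_neg h]
    exact evAt_zero _
  · rw [coeff_evSeries, evAt_coeff_adamsLog hcreg hq, hcard]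

end Identity

end

end QuiverCount

theorem theorem4p1 {I : Type*} [Fintype I] [DecidableEq I] [Quiver I]
    [∀ i j : I, Fintype (i ⟶ j)] (θ : I → ℤ) (m : ℚ) :
    (∃! a : (I →₀ ℕ) → Polynomial ℤ, QuiverCount.CountsAbsolutelyStable θ a) ∧
    (∃! r : (I →₀ ℕ) → RatFunc ℚ, QuiverCount.CountsSemistable θ r) ∧
    ∀ (a : (I →₀ ℕ) → Polynomial ℤ) (r : (I →₀ ℕ) → RatFunc ℚ),
      QuiverCount.CountsAbsolutelyStable θ a → QuiverCount.CountsSemistable θ r →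
      QuiverCount.twMul
        (QuiverCount.slopeSeries θ m r)
        (QuiverCount.plethysticExp
          ((1 - RatFunc.X : RatFunc ℚ)⁻¹ •
            QuiverCount.slopeSeries θ m
              (fun α => algebraMap (Polynomial ℚ) (RatFunc ℚ)
                ((a α).map (Int.castRingHom ℚ))))) = 1 := by
  obtain ⟨a₀, ha₀⟩ := QuiverCount.exists_countsAbsolutelyStable θ
  obtain ⟨r₀, hr₀, -⟩ := QuiverCount.exists_countsSemistable θ
  exact ⟨⟨a₀, ha₀, fun a ha => ha.unique ha₀⟩, ⟨r₀, hr₀, fun r hr => hr.unique hr₀⟩,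
    fun a r ha hr => QuiverCount.twMul_plethysticExp_eq_one θ m ha hr⟩
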